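/- Let $n\ge 0$ and let $B_n = C_2\wr S_n = C_2^{\,n}\rtimes S_n$ be the Weyl group of type $B_n$. Put $\mathbb Z_q=\mathbb Z[q,q^{-1}]$, $i_{q^2}=(1-q^{2i})/(1-q^2)$, $n_{q^2}!=n_{q^2}(n-1)_{q^2}\cdots 2_{q^2}$ and $\mathbb Z_{q,n}=\mathbb Z[q,q^{-1},1/n_{q^2}!]$. A split global solution to the Donald–Flanigan problem for a finite group $G$, starting from $\mathbb Z$, consists of a deformation $A_t$ of $\mathbb ZG$ (a $\mathbb Z[[t]]$-algebra, free as a module on a basis indexed by $G$, which reduces to $\mathbb ZG$ at $t=0$) and a multiplicatively closed subset $S$ of $\mathbb Z[[t]]$, not meeting the ideal generated by any rational prime dividing $\#G$, such that $S^{-1}A_t$ is separable over $S^{-1}\mathbb Z[[t]]$ and is a direct sum of matrix algebras over $S^{-1}\mathbb Z[[t]]$. 1. There is a split global solution to the Donald–Flanigan problem for $B_n$ starting from $\mathbb Z$. 2. If $n\ge 2$, the coefficient ring after deformation can be taken to be $\mathbb Z_{q,n}$: there is a $\mathbb Z_q$-algebra $A$, free as a module on a basis indexed by $B_n$ and reducing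 to $\mathbb ZB_n$ at $q=1$, such that $\mathbb Z_{q,n}\otimes_{\mathbb Z_q}A$ is a direct sum of matrix algebras over $\mathbb Z_{q,n}$, and such that, with $q=1+t$, the deformation $\mathbb Z[[t]]\otimes_{\mathbb Z_q}A$ together with the set $S$ of powers of $n_{(1+t)^2}!$ is a split global solution for $B_n$. 3. All complex irreducible representations of $B_n$ are rational, i.e. each can be realized by matrices with entries in $\mathbb Q$. -/

import Mathlib

open scoped TensorProduct

noncomputable section

namespace DonaldFlanigan

/-! ### The Weyl groups of type `B_n` -/

/-- The Weyl group of type `B_n`, i.e. the wreath product `C_2 ≀ S_n = (C_2)^n ⋊ S_n`, where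
`σ ∈ S_n` acts by `(σ x) i = x (σ⁻¹ i)`. -/
abbrev WeylB (n : ℕ) : Type :=
  (Fin n → Multiplicative (ZMod 2)) ⋊[mulAutArrow] Equiv.Perm (Fin n)

/-! ### Deformations of group rings -/

/-- Let `ε : R →+* k` be a homomorphism of commutative rings (in the applications, setting a
deformation parameter to its special value). A deformation over `R` (along `ε`) of the group ring
`k[G]` is an associative unital `R`-algebra `A` that is free as an `R`-module on a basis indexed
by `G`, together with a ring homomorphism `A →+* k[G]` which sends `∑ r_g • b_g` to `∑ ε(r_g) g`;
thus `A / (ker ε) A` is `k[G]` when `ε` is surjective. -/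
structure GroupRingDeformation {R k : Type*} [CommRing R] [CommRing k] (ε : R →+* k)
    (G : Type*) [Group G] (A : Type*) [Ring A] [Algebra R A] where
  /-- the basis of the underlying `R`-module -/
  basis : Module.Basis G R A
  /-- the specialization homomorphism -/
  reduction : A →+* MonoidAlgebra k G
  reduction_smul_basis : ∀ (r : R) (g : G),
    reduction (r • basis g) = MonoidAlgebra.single g (ε r)

/-! ### Separable algebras and split algebras -/

/-- A (not necessarily commutative) `R`-algebra `A` is separable if there is a separability
idempotent: an element `e = ∑ x_i ⊗ y_i` of `A ⊗ A` with `∑ a x_i ⊗ y_i = ∑ x_i ⊗ y_i a` for all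
`a`, and `∑ x_i y_i = 1`. -/
def IsSeparableAlgebra (R A : Type*) [CommRing R] [Ring A] [Algebra R A] : Prop :=
  ∃ e : A ⊗[R] A, (∀ a : A, (a ⊗ₜ[R] (1 : A)) * e = e * ((1 : A) ⊗ₜ[R] a)) ∧
    LinearMap.mul' R A e = 1

/-- An `R`-algebra is split if it is a finite direct sum of (nonzero size) matrix algebras
over `R`. -/
def IsSplitAlgebra (R A : Type*) [CommRing R] [Ring A] [Algebra R A] : Prop :=
  ∃ (r : ℕ) (d : Fin r → ℕ), (∀ i, 0 < d i) ∧
    Nonempty (A ≃ₐ[R] ((i : Fin r) → Matrix (Fin (d i)) (Fin (d i)) R))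

/-! ### Global solutions -/

/-- A global solution to the Donald–Flanigan problem for `G`, starting from `ℤ`: a deformation
`A` over `ℤ⟦t⟧` of the integral group ring `ℤ[G]`, and a multiplicatively closed subset `S` of
`ℤ⟦t⟧` not meeting the ideal generated by any rational prime dividing the order of `G`,
such that `S⁻¹A` is separable over `S⁻¹ℤ⟦t⟧`. -/
structure IsGlobalSolution (G : Type*) [Group G] (A : Type*) [Ring A]
    [Algebra (PowerSeries ℤ) A] (S : Submonoid (PowerSeries ℤ)) : Prop where
  deformation : Nonempty (GroupRingDeformation (PowerSeries.constantCoeff (R := ℤ)) G A)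
  avoids : ∀ p : ℕ, p.Prime → p ∣ Nat.card G →
    Disjoint (S : Set (PowerSeries ℤ)) (Ideal.span {(p : PowerSeries ℤ)} : Set (PowerSeries ℤ))
  separable : IsSeparableAlgebra (Localization S) (Localization S ⊗[PowerSeries ℤ] A)

/-- A global solution is split if `S⁻¹A` is a direct sum of matrix algebras over `S⁻¹ℤ⟦t⟧`. -/
structure IsSplitGlobalSolution (G : Type*) [Group G] (A : Type*) [Ring A]
    [Algebra (PowerSeries ℤ) A] (S : Submonoid (PowerSeries ℤ)) : Prop
    extends IsGlobalSolution G A S where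
  split : IsSplitAlgebra (Localization S) (Localization S ⊗[PowerSeries ℤ] A)

/-! ### Quantum factorials and the ring `ℤ_{q,n}` -/

/-- The quantum factorial `n_x ! = n_x (n-1)_x ⋯ 2_x`, where
`i_x = 1 + x + ⋯ + x^(i-1) = (1 - x^i)/(1 - x)`. -/
def quantumFactorial {R : Type*} [CommRing R] (x : R) (n : ℕ) : R :=
  ∏ i ∈ Finset.Icc 2 n, ∑ j ∈ Finset.range i, x ^ j

/-- `ℤ_q = ℤ[q, q⁻¹]`; the element `q` is `LaurentPolynomial.T 1`. -/
abbrev Zq : Type := LaurentPolynomial ℤ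

/-- The element `q` of `ℤ_q`. -/
def q : Zq := LaurentPolynomial.T 1

/-- `ℤ_{q,n} = ℤ[q, q⁻¹, 1 / n_{q²}!]`. -/
abbrev Zqn (n : ℕ) : Type := Localization.Away (quantumFactorial (q ^ 2) n)

/-- The specialization `q = 1`. -/
def evalOne : Zq →+* ℤ := LaurentPolynomial.eval₂ (RingHom.id ℤ) 1

/-- `1 + t` is a unit of `ℤ⟦t⟧`. -/
theorem isUnit_one_add_X : IsUnit (1 + PowerSeries.X : PowerSeries ℤ) := by
  rw [PowerSeries.isUnit_iff_constantCoeff]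
  simp

/-- The substitution `q = 1 + t`, as a ring homomorphism `ℤ[q, q⁻¹] → ℤ⟦t⟧`. -/
def substOneAdd : Zq →+* PowerSeries ℤ :=
  LaurentPolynomial.eval₂ (algebraMap ℤ (PowerSeries ℤ)) isUnit_one_add_X.unit

/-- `ℤ⟦t⟧` as an algebra over `ℤ[q, q⁻¹]` through `q = 1 + t`. -/
instance algebraZqPowerSeries : Algebra Zq (PowerSeries ℤ) := substOneAdd.toAlgebra

/-! ### Rationality of representations -/

/-- All complex irreducible representations of `G` are rational: each is finite dimensional and
has a basis in which the elements of `G` act by matrices with rational entries, which form a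
matrix representation of `G` over `ℚ`. -/
def ComplexIrreduciblesRational.{u} (G : Type*) [Group G] : Prop :=
  ∀ (V : Type u) [AddCommGroup V] [Module ℂ V] (ρ : Representation ℂ G V), ρ.IsIrreducible →
    ∃ (m : ℕ) (b : Module.Basis (Fin m) ℂ V) (M : G →* Matrix (Fin m) (Fin m) ℚ),
      ∀ g : G, LinearMap.toMatrix b b (ρ g) = (M g).map (algebraMap ℚ ℂ)

end DonaldFlanigan

end

open DonaldFlanigan

universe u

/-! The deformation is an Iwahori–Hecke algebra of type B_n, `HeckeB`, with x = q². The generators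
coming from S_n have eigenvalues x and -1, while the special generator T_0 has eigenvalues 1 + x and
0. At x = 1 the elements 1 - s_0 and the adjacent transpositions satisfy these relations, so the
algebra specializes to ℤB_n.

The eigenvalue 0 keeps the denominators small. In Young's seminormal form on standard bitableaux,
successive boxes with residues ρ, ρ' contribute the coefficient (x-1)/(1-ρ/ρ'). A box of content c
has residue (1+x)x^c in one component and 0 in the other. Across components the coefficient
therefore degenerates to x-1 or 0, without a denominator. Inside a component it is x^d/[d], where d
is a difference of contents and |d| < n. Only [1], …, [n] and 1 + x = [2] must be inverted, and [2]
divides n_x! as soon as n ≥ 2.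

Three facts combine in `exists_spanning_and_blocks`. Words along the chain B_0 < B_1 < … span the
algebra by 2^n n! elements (`HeckeRelations.exists_span_eq_top`). The seminormal operators generate
every matrix unit between standard bitableaux of equal shape (`hasMatrixUnit`,
`adjoin_block_eq_top`). The number of pairs of such bitableaux is 2^n n! (`sum_stdCount`). Hence the
spanning family is a basis and, after inverting the quantum integers, the algebra is a product of
matrix algebras.

Freeness descends to ℤ[q, q⁻¹] because that ring embeds in its localization, and
`nonempty_groupRingDeformation` turns an arbitrary basis into one indexed by the group. The powers
of the quantum factorial avoid every prime p because the factorial stays nonzero modulo p. At x = 1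
over ℚ the same splitting gives ℚB_n as a product of matrix algebras over ℚ, whose columns are
rational forms of the irreducible representations. -/

namespace DonaldFlanigan

/-! ### Quantum integers -/

section QuantumInteger

variable {K : Type*} [CommRing K]

/-- The quantum integer `(x ^ d - 1) / (x - 1)`, for a unit `x` and `d : ℤ`. -/
noncomputable def qInt (x : Kˣ) : ℤ → K
  | Int.ofNat d => ∑ i ∈ Finset.range d, (x : K) ^ i
  | Int.negSucc d => -((x ^ (-(d + 1 : ℤ)) : Kˣ) : K) * ∑ i ∈ Finset.range (d + 1), (x : K) ^ i

theorem qInt_natCast (x : Kˣ) (d : ℕ) : qInt x d = ∑ i ∈ Finset.range d, (x : K) ^ i := rfl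

theorem qInt_negSucc (x : Kˣ) (d : ℕ) :
    qInt x (Int.negSucc d) = -((x ^ (-(d + 1 : ℤ)) : Kˣ) : K) * qInt x ((d + 1 : ℕ) : ℤ) := rfl

@[simp] theorem qInt_zero (x : Kˣ) : qInt x 0 = 0 := by
  simpa using qInt_natCast x 0

@[simp] theorem qInt_one (x : Kˣ) : qInt x 1 = 1 := by
  simpa using qInt_natCast x 1

/-- Since x - 1 need not be invertible, and is 0 in the rational case x = 1, this identity and
`qInt_add` replace the quotient formula. -/
theorem sub_one_mul_qInt (x : Kˣ) (d : ℤ) : ((x : K) - 1) * qInt x d = ((x ^ d : Kˣ) : K) - 1 := by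
  rcases d with d | d
  · rw [Int.ofNat_eq_natCast, qInt_natCast, mul_comm, geom_sum_mul]
    simp
  · have h : ((x : K) - 1) * qInt x ((d + 1 : ℕ) : ℤ) = (x : K) ^ (d + 1) - 1 := by
      rw [qInt_natCast, mul_comm, geom_sum_mul]
    have h2 : ((x ^ (-(d + 1 : ℤ)) : Kˣ) : K) * (x : K) ^ (d + 1) = 1 := by
      rw [← Units.val_pow_eq_pow_val, ← Units.val_mul, ← zpow_natCast, ← zpow_add]
      simp
    rw [qInt_negSucc, mul_left_comm, h, Int.negSucc_eq]
    linear_combination -h2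

theorem qInt_add_one (x : Kˣ) (d : ℤ) : qInt x (d + 1) = qInt x d + ((x ^ d : Kˣ) : K) := by
  rcases d with d | d
  · rw [Int.ofNat_eq_natCast]
    rw [show ((d : ℤ) + 1) = ((d + 1 : ℕ) : ℤ) by push_cast; rfl, qInt_natCast, qInt_natCast,
      Finset.sum_range_succ]
    simp
  · rcases d with _ | d
    · rw [show Int.negSucc 0 + 1 = 0 from rfl, qInt_negSucc]
      simp [Int.negSucc_eq]
    · rw [show Int.negSucc (d + 1) + 1 = Int.negSucc d from rfl, qInt_negSucc, qInt_negSucc,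
        Int.negSucc_eq, qInt_natCast, qInt_natCast, Finset.sum_range_succ' _ (d + 1)]
      have h : ((x ^ (-((d + 1 : ℕ) + 1 : ℤ)) : Kˣ) : K) * (x : K) = ((x ^ (-(d + 1 : ℤ)) : Kˣ) : K) := by
        rw [← Units.val_mul, ← zpow_add_one]
        congr 2
      simp only [pow_succ _ (_ : ℕ), ← Finset.sum_mul]
      rw [← h]
      ring

theorem qInt_add (x : Kˣ) (d e : ℤ) :
    qInt x (d + e) = qInt x e + ((x ^ e : Kˣ) : K) * qInt x d := by
  induction d using Int.induction_on with
  | zero => simp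
  | succ d ih =>
    rw [show (d : ℤ) + 1 + e = (d + e) + 1 by ring, qInt_add_one, ih, qInt_add_one, zpow_add]
    push_cast
    ring
  | pred d ih =>
    have h1 := qInt_add_one x (-(d : ℤ) - 1)
    have h2 := qInt_add_one x (-(d : ℤ) - 1 + e)
    rw [show -(d : ℤ) - 1 + 1 = -d by ring] at h1
    rw [show -(d : ℤ) - 1 + e + 1 = -d + e by ring, zpow_add] at h2
    push_cast at h2
    linear_combination ih - h2 + ((x ^ e : Kˣ) : K) * h1

theorem qInt_neg (x : Kˣ) (d : ℤ) : qInt x (-d) = -((x ^ (-d) : Kˣ) : K) * qInt x d := by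
  have h := qInt_add x d (-d)
  rw [add_neg_cancel, qInt_zero] at h
  linear_combination -h

/-- The quantum integers `1, …, n` are units. -/
def QUnits (x : Kˣ) (n : ℕ) : Prop := ∀ j : ℕ, 0 < j → j ≤ n → IsUnit (qInt x (j : ℤ))

theorem QUnits.mono {x : Kˣ} {m n : ℕ} (h : QUnits x n) (hmn : m ≤ n) : QUnits x m :=
  fun j h1 h2 => h j h1 (h2.trans hmn)

theorem QUnits.isUnit {x : Kˣ} {n : ℕ} (h : QUnits x n) {d : ℤ} (h0 : d ≠ 0) (hd : |d| ≤ n) :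
    IsUnit (qInt x d) := by
  rcases le_total 0 d with h1 | h1
  · lift d to ℕ using h1
    exact h d (by lia) (by simpa using hd)
  · obtain ⟨e, rfl⟩ : ∃ e : ℕ, d = -e := ⟨d.natAbs, by lia⟩
    rw [qInt_neg]
    exact (Units.isUnit _).neg.mul (h e (by lia) (by simpa using hd))

end QuantumInteger

/-! ### The coefficients of the seminormal form -/

/-- A node records a component of a bipartition and a content. -/
abbrev Node : Type := Bool × ℤ

section Coefficients

variable {K : Type*} [CommRing K]

/-- The diagonal coefficient of the seminormal form, for consecutive nodes `p`, `q`. -/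
noncomputable def diagCoeff (x : Kˣ) (p q : Node) : K :=
  if p.1 = q.1 then ((x ^ (q.2 - p.2) : Kˣ) : K) * Ring.inverse (qInt x (q.2 - p.2))
  -- The limits of (x-1)/(1-ρ/ρ') when the residue ρ of `p`, respectively ρ' of `q`, is 0: component
  -- `false` has residue 0.
  else if p.1 = false then (x : K) - 1 else 0

/-- Two nodes are adjacent if they are in the same component and their contents differ by at
most one. -/
def Adjacent (p q : Node) : Prop := p.1 = q.1 ∧ |q.2 - p.2| ≤ 1

instance (p q : Node) : Decidable (Adjacent p q) := by unfold Adjacent; infer_instance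

theorem Adjacent.symm {p q : Node} (h : Adjacent p q) : Adjacent q p :=
  ⟨h.1.symm, by rw [abs_sub_comm]; exact h.2⟩

/-- The off-diagonal coefficient of the seminormal form, for consecutive nodes `p`, `q`. -/
noncomputable def swapCoeff (x : Kˣ) (p q : Node) : K :=
  -- The quadratic relation fixes only the product of the two opposite off-diagonal entries; this
  -- normalization needs no square roots.
  if Adjacent p q then 0 else (x : K) - diagCoeff x p q

/-- The difference of contents of two nodes in the same component is an invertible quantum
integer. -/
def Separated (x : Kˣ) (p q : Node) : Prop := p.1 = q.1 → IsUnit (qInt x (q.2 - p.2))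

theorem Separated.symm {x : Kˣ} {p q : Node} (h : Separated x p q) : Separated x q p := by
  intro e
  have := qInt_neg x (q.2 - p.2)
  rw [neg_sub] at this
  rw [this]
  exact (Units.isUnit _).neg.mul (h e.symm)

/-- The trace of the 2 × 2 block of a generator with eigenvalues x and -1. -/
theorem diagCoeff_add_swap {x : Kˣ} {p q : Node} (h : Separated x p q) :
    diagCoeff x p q + diagCoeff x q p = (x : K) - 1 := by
  by_cases e : p.1 = q.1
  · have h1 := h e
    have h2 := h.symm e.symm
    have e1 := Ring.mul_inverse_cancel _ h1
    have e2 := Ring.mul_inverse_cancel _ h2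
    simp only [diagCoeff, e, if_true]
    have h3 := qInt_neg x (q.2 - p.2)
    rw [neg_sub] at h3
    have h4 := sub_one_mul_qInt x (q.2 - p.2)
    have h5 : ((x ^ (p.2 - q.2) : Kˣ) : K) * ((x ^ (q.2 - p.2) : Kˣ) : K) = 1 := by
      rw [← Units.val_mul, ← zpow_add]; simp
    apply h1.mul_left_cancel
    have h6 : qInt x (q.2 - p.2) * (((x ^ (p.2 - q.2) : Kˣ) : K) * Ring.inverse (qInt x (p.2 - q.2)))
        = -1 := by
      linear_combination (-1 : K) * e2 + (Ring.inverse (qInt x (p.2 - q.2))) * h3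
    rw [mul_add, h6, mul_left_comm, e1]
    linear_combination -h4
  · have e' : ¬ q.1 = p.1 := fun h => e h.symm
    simp only [diagCoeff, e, e', if_false]
    rcases p with ⟨_ | _, c⟩ <;> rcases q with ⟨_ | _, d⟩ <;> simp at *

/-- The partial fraction identity for (x-1)/(1-ρ/ρ') at three residues, together with its
degenerations when one or two of them are 0. It carries the braid relation. -/
theorem diagCoeff_triple {x : Kˣ} {p q r : Node} (hpq : Separated x p q) (hqr : Separated x q r)
    (hpr : Separated x p r) :
    diagCoeff x p q * diagCoeff x q r + diagCoeff x p r * diagCoeff x q p =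
      diagCoeff x q r * diagCoeff x p r := by
  have h1 := diagCoeff_add_swap hpq
  have h2 := diagCoeff_add_swap hqr
  have h3 := diagCoeff_add_swap hpr
  by_cases e1 : p.1 = q.1
  · by_cases e2 : q.1 = r.1
    · have e3 : p.1 = r.1 := e1.trans e2
      have u1 := hpq e1
      have u2 := hqr e2
      have u3 := hpr e3
      rw [show diagCoeff x q p = (x : K) - 1 - diagCoeff x p q by linear_combination h1]
      simp only [diagCoeff, e1, e2, if_true]
      have i1 := Ring.mul_inverse_cancel _ u1
      have i2 := Ring.mul_inverse_cancel _ u2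
      have i3 := Ring.mul_inverse_cancel _ u3
      have s := sub_one_mul_qInt x (q.2 - p.2)
      have t := qInt_add x (q.2 - p.2) (r.2 - q.2)
      have w : ((x ^ (r.2 - p.2) : Kˣ) : K) =
          ((x ^ (q.2 - p.2) : Kˣ) : K) * ((x ^ (r.2 - q.2) : Kˣ) : K) := by
        rw [← Units.val_mul, ← zpow_add]; congr 2; ring
      rw [show q.2 - p.2 + (r.2 - q.2) = r.2 - p.2 by ring] at t
      rw [w]
      generalize qInt x (q.2 - p.2) = A at *
      generalize qInt x (r.2 - q.2) = B at *
      generalize qInt x (r.2 - p.2) = C at *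
      generalize ((x ^ (q.2 - p.2) : Kˣ) : K) = X at *
      generalize ((x ^ (r.2 - q.2) : Kˣ) : K) = Y at *
      generalize Ring.inverse A = A' at *
      generalize Ring.inverse B = B' at *
      generalize Ring.inverse C = C' at *
      apply ((u1.mul u2).mul u3).mul_left_cancel
      have l1 : A * B * C * (X * A' * (Y * B')) = X * Y * C := by
        linear_combination X * Y * C * (B * B') * i1 + X * Y * C * i2
      have l2 : A * B * C * (X * Y * C' * (↑x - 1 - X * A')) =
          X * Y * B * (((x : K) - 1) * A - X) := by
        linear_combination X * Y * B * A * ((x : K) - 1 - X * A') * i3 - X * Y * B * X * i1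
      have l3 : A * B * C * (Y * B' * (X * Y * C')) = X * Y * Y * A := by
        linear_combination X * Y * Y * A * (C * C') * i2 + X * Y * Y * A * i3
      rw [mul_add, l1, l2, l3]
      linear_combination X * Y * t + X * Y * B * s
    · have d1 : diagCoeff x q r = diagCoeff x p r := by
        simp only [diagCoeff, e1, e2, if_false]
      have d2 : diagCoeff x p r * diagCoeff x p r = ((x : K) - 1) * diagCoeff x p r := by
        have : ¬ p.1 = r.1 := by rw [e1]; exact e2
        simp only [diagCoeff, this, if_false]
        split_ifs <;> ring
      rw [d1]
      linear_combination diagCoeff x p r * h1 - d2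
  · by_cases e2 : q.1 = r.1
    · have e3 : ¬ p.1 = r.1 := by rw [← e2]; exact e1
      have d1 : diagCoeff x p q = diagCoeff x p r := by
        simp only [diagCoeff, e1, e3, if_false]
      have d2 : diagCoeff x p r * diagCoeff x q p = 0 := by
        have e1' : ¬ q.1 = p.1 := fun h => e1 h.symm
        simp only [diagCoeff, e1', e3, if_false]
        rcases p with ⟨_ | _, c⟩ <;> rcases q with ⟨_ | _, d⟩ <;> simp at *
      rw [d1, d2]
      ring
    · have e3 : p.1 = r.1 := by
        revert e1 e2
        generalize p.1 = a
        generalize q.1 = b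
        generalize r.1 = c
        revert a b c
        decide
      have d1 : diagCoeff x p q * diagCoeff x q r = 0 := by
        simp only [diagCoeff, e1, e2, if_false]
        rcases p with ⟨_ | _, c⟩ <;> rcases q with ⟨_ | _, d⟩ <;> simp at *
      have d2 : diagCoeff x q p = diagCoeff x q r := by
        have e1' : ¬ q.1 = p.1 := fun h => e1 h.symm
        simp only [diagCoeff, e1', e2, if_false]
      rw [d1, d2]
      ring

theorem diagCoeff_of_sub_eq_one {x : Kˣ} {p q : Node} (h : p.1 = q.1) (h' : q.2 - p.2 = 1) :
    diagCoeff x p q = x := by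
  simp [diagCoeff, h, h']

theorem diagCoeff_of_sub_eq_neg_one {x : Kˣ} {p q : Node} (h : p.1 = q.1) (h' : q.2 - p.2 = -1) :
    diagCoeff x p q = -1 := by
  have h3 := qInt_neg x 1
  have h2 : IsUnit (qInt x (-1)) := by rw [h3, qInt_one, mul_one]; exact (Units.isUnit _).neg
  have e2 := Ring.mul_inverse_cancel _ h2
  rw [h3, qInt_one, mul_one] at e2
  simp only [diagCoeff, h, h', if_true]
  rw [h3, qInt_one, mul_one]
  linear_combination -e2

/-- Given the trace x - 1, this says that the 2 × 2 block has determinant -x. For adjacent nodes the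
diagonal entry is already x or -1, so the right side vanishes too. -/
theorem swapCoeff_mul_swap {x : Kˣ} {p q : Node} (hne : p ≠ q) (h : Separated x p q) :
    swapCoeff x p q * swapCoeff x q p = ((x : K) - diagCoeff x p q) * (1 + diagCoeff x p q) := by
  by_cases e : Adjacent p q
  · simp only [swapCoeff, e, e.symm, if_true]
    have h1 : q.2 - p.2 ≠ 0 := fun h2 => hne (Prod.ext e.1 (by lia))
    have h2 := e.2
    rw [abs_le] at h2
    rcases (by omega : q.2 - p.2 = 1 ∨ q.2 - p.2 = -1) with h3 | h3
    · rw [diagCoeff_of_sub_eq_one e.1 h3]; ring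
    · rw [diagCoeff_of_sub_eq_neg_one e.1 h3]; ring
  · have e' : ¬ Adjacent q p := fun h => e h.symm
    simp only [swapCoeff, e, e', if_false]
    linear_combination -((x : K) - diagCoeff x p q) * diagCoeff_add_swap h

/-- Within a component x - x^d/[d] = x[d-1]/[d], and d - 1 can reach -(n + 1), whence the range in
`hx`. Across components the value is 1 or x. -/
theorem isUnit_swapCoeff {x : Kˣ} {n : ℕ} (hx : QUnits x (n + 1)) {p q : Node}
    (h : ¬ Adjacent p q) (h' : p.1 = q.1 → |q.2 - p.2| ≤ n) : IsUnit (swapCoeff x p q) := by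
  rw [swapCoeff, if_neg h]
  by_cases e : p.1 = q.1
  · have h1 : ¬ |q.2 - p.2| ≤ 1 := fun h2 => h ⟨e, h2⟩
    have h2 := h' e
    rw [abs_le] at h1 h2
    have u1 : IsUnit (qInt x (q.2 - p.2)) := hx.isUnit (by omega) (by rw [abs_le]; push_cast; omega)
    have u2 : IsUnit (qInt x (q.2 - p.2 - 1)) := hx.isUnit (by omega) (by rw [abs_le]; push_cast; omega)
    have i1 := Ring.mul_inverse_cancel _ u1
    have t := qInt_add x (q.2 - p.2 - 1) 1
    have s := sub_one_mul_qInt x (q.2 - p.2)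
    rw [sub_add_cancel, qInt_one, zpow_one] at t
    have : (x : K) - diagCoeff x p q =
        x * qInt x (q.2 - p.2 - 1) * Ring.inverse (qInt x (q.2 - p.2)) := by
      simp only [diagCoeff, e, if_true]
      linear_combination (-(x : K)) * i1 + Ring.inverse (qInt x (q.2 - p.2)) * (t + s)
    rw [this]
    exact (x.isUnit.mul u2).mul u1.ringInverse
  · simp only [diagCoeff, e, if_false]
    split_ifs
    · simp
    · simp

/-- Within one component x^a/[a] - x^b/[b] = x^a[b-a]/([a][b]). If only one of `q`, `r` shares the
component of `p`, the difference is a single diagonal coefficient up to sign. If neither does, it is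
0, which `h` rules out. -/
theorem isUnit_diagCoeff_sub {x : Kˣ} {p q r : Node} (hpq : Separated x p q)
    (hpr : Separated x p r) (hqr : Separated x q r) (h : p.1 = q.1 ∨ p.1 = r.1) :
    IsUnit (diagCoeff x p q - diagCoeff x p r) := by
  have unit_diag : ∀ {p q : Node}, p.1 = q.1 → Separated x p q → IsUnit (diagCoeff x p q) := by
    intro p q e h
    simp only [diagCoeff, e, if_true]
    exact (Units.isUnit _).mul (h e).ringInverse
  have key : ∀ {p q r : Node}, p.1 = q.1 → ¬ p.1 = r.1 → Separated x p q →
      IsUnit (diagCoeff x p q - diagCoeff x p r) := by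
    intro p q r e e' h
    by_cases hf : p.1 = false
    · have h1 := unit_diag e.symm h.symm
      have h2 := diagCoeff_add_swap h
      have h3 : diagCoeff x p r = (x : K) - 1 := by rw [diagCoeff, if_neg e', if_pos hf]
      rw [show diagCoeff x p q - diagCoeff x p r = -diagCoeff x q p by rw [h3]; linear_combination h2]
      exact h1.neg
    · have h3 : diagCoeff x p r = 0 := by rw [diagCoeff, if_neg e', if_neg hf]
      rw [h3, sub_zero]
      exact unit_diag e h
  by_cases e1 : p.1 = q.1
  · by_cases e2 : p.1 = r.1
    · have u1 := hpq e1
      have u2 := hpr e2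
      have u3 := hqr (e1.symm.trans e2)
      have i1 := Ring.mul_inverse_cancel _ u1
      have i2 := Ring.mul_inverse_cancel _ u2
      have s1 := sub_one_mul_qInt x (q.2 - p.2)
      have t := qInt_add x (r.2 - q.2) (q.2 - p.2)
      have t' := qInt_add x (q.2 - p.2) (r.2 - q.2)
      have w : ((x ^ (r.2 - p.2) : Kˣ) : K) =
          ((x ^ (q.2 - p.2) : Kˣ) : K) * ((x ^ (r.2 - q.2) : Kˣ) : K) := by
        rw [← Units.val_mul, ← zpow_add]; congr 2; ring
      have s3 := sub_one_mul_qInt x (r.2 - q.2)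
      rw [show r.2 - q.2 + (q.2 - p.2) = r.2 - p.2 by ring] at t
      have : diagCoeff x p q - diagCoeff x p r = ((x ^ (q.2 - p.2) : Kˣ) : K) * qInt x (r.2 - q.2) *
          (Ring.inverse (qInt x (q.2 - p.2)) * Ring.inverse (qInt x (r.2 - p.2))) := by
        simp only [diagCoeff, e1, e1 ▸ e2, if_true]
        apply (u1.mul u2).mul_left_cancel
        rw [w]
        generalize qInt x (q.2 - p.2) = A at *
        generalize qInt x (r.2 - q.2) = B at *
        generalize qInt x (r.2 - p.2) = C at *
        generalize ((x ^ (q.2 - p.2) : Kˣ) : K) = X at *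
        generalize ((x ^ (r.2 - q.2) : Kˣ) : K) = Y at *
        generalize Ring.inverse A = A' at *
        generalize Ring.inverse C = C' at *
        have l1 : A * C * (X * A' - X * Y * C') = C * X - A * (X * Y) := by
          linear_combination C * X * i1 - A * X * Y * i2
        have l2 : A * C * (X * B * (A' * C')) = X * B := by
          linear_combination X * B * (C * C') * i1 + X * B * i2
        rw [l1, l2, t]
        linear_combination X * A * s3 - X * B * s1
      rw [this]
      exact ((Units.isUnit _).mul u3).mul (u1.ringInverse.mul u2.ringInverse)
    · exact key e1 e2 hpq
  · have e2 : p.1 = r.1 := h.resolve_left e1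
    rw [← neg_sub]
    exact (key e2 e1 hpr).neg

end Coefficients

/-! ### Standard bitableaux as lists of nodes -/

/-- The Maya diagram of the empty bipartition. -/
def emptyShape : Node → Bool := fun p => decide (p.2 < 0)

/-- Adding the box with node `p` to a pair of Maya diagrams. -/
def addNode (m : Node → Bool) (p : Node) : Node → Bool := fun r =>
  if r = p then true else if r = (p.1, p.2 - 1) then false else m r

/-- Removing the box with node `p` from a pair of Maya diagrams. -/
def removeNode (m : Node → Bool) (p : Node) : Node → Bool := fun r =>
  if r = p then false else if r = (p.1, p.2 - 1) then true else m r

/-- A box with node `p` can be added. -/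
def Addable (m : Node → Bool) (p : Node) : Prop := m (p.1, p.2 - 1) = true ∧ m p = false

/-- A box with node `p` can be removed. -/
def Removable (m : Node → Bool) (p : Node) : Prop := m (p.1, p.2 - 1) = false ∧ m p = true

/-! ### Maya diagrams: adding a box of content c moves a bead from c - 1 to c. -/

theorem pred_ne (p : Node) : (p.1, p.2 - 1) ≠ p := fun h => by
  have := congrArg Prod.snd h
  simp at this

theorem addNode_self (m : Node → Bool) (p : Node) : addNode m p p = true := by simp [addNode]

theorem addNode_pred (m : Node → Bool) (p : Node) : addNode m p (p.1, p.2 - 1) = false := by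
  simp [addNode, pred_ne]

theorem addNode_of_ne (m : Node → Bool) {p r : Node} (h : r ≠ p) (h' : r ≠ (p.1, p.2 - 1)) :
    addNode m p r = m r := by
  simp [addNode, h, h']

theorem removeNode_of_ne (m : Node → Bool) {p r : Node} (h : r ≠ p) (h' : r ≠ (p.1, p.2 - 1)) :
    removeNode m p r = m r := by
  simp [removeNode, h, h']

theorem removeNode_self (m : Node → Bool) (p : Node) : removeNode m p p = false := by
  simp [removeNode]

theorem removeNode_pred (m : Node → Bool) (p : Node) : removeNode m p (p.1, p.2 - 1) = true := by
  simp [removeNode, pred_ne]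

theorem Addable.removable_addNode (m : Node → Bool) (p : Node) : Removable (addNode m p) p :=
  ⟨addNode_pred m p, addNode_self m p⟩

theorem Removable.addable_removeNode (m : Node → Bool) (p : Node) : Addable (removeNode m p) p :=
  ⟨removeNode_pred m p, removeNode_self m p⟩

theorem Addable.removeNode_addNode {m : Node → Bool} {p : Node} (h : Addable m p) :
    removeNode (addNode m p) p = m := by
  funext r
  by_cases h1 : r = p
  · subst h1; rw [removeNode_self, h.2]
  · by_cases h2 : r = (p.1, p.2 - 1)
    · subst h2; rw [removeNode_pred, h.1]
    · rw [removeNode_of_ne _ h1 h2, addNode_of_ne _ h1 h2]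

theorem Removable.addNode_removeNode {m : Node → Bool} {p : Node} (h : Removable m p) :
    addNode (removeNode m p) p = m := by
  funext r
  by_cases h1 : r = p
  · subst h1; rw [addNode_self, h.2]
  · by_cases h2 : r = (p.1, p.2 - 1)
    · subst h2; rw [addNode_pred, h.1]
    · rw [addNode_of_ne _ h1 h2, removeNode_of_ne _ h1 h2]

theorem addNode_injective {m m' : Node → Bool} {p : Node} (h : Addable m p) (h' : Addable m' p)
    (e : addNode m p = addNode m' p) : m = m' := by
  rw [← h.removeNode_addNode, e, h'.removeNode_addNode]

/-- Nodes whose boxes do not interact. -/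
def Far (p q : Node) : Prop := p ≠ q ∧ p ≠ (q.1, q.2 - 1) ∧ q ≠ (p.1, p.2 - 1)

theorem Far.symm {p q : Node} (h : Far p q) : Far q p := ⟨h.1.symm, h.2.2, h.2.1⟩

theorem Far.pred_ne_pred {p q : Node} (h : Far p q) : (p.1, p.2 - 1) ≠ (q.1, q.2 - 1) := by
  intro e
  rw [Prod.mk.injEq] at e
  exact h.1 (Prod.ext e.1 (by linarith [e.2]))

theorem far_of_not_adjacent {p q : Node} (h : ¬ Adjacent p q) : Far p q := by
  refine ⟨?_, ?_, ?_⟩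
  · rintro rfl; exact h ⟨rfl, by simp⟩
  · intro e
    exact h ⟨by rw [e], by rw [e]; simp⟩
  · intro e
    exact h ⟨by rw [e], by rw [e]; simp⟩

theorem Far.not_adjacent {p q : Node} (h : Far p q) : ¬ Adjacent p q := by
  rintro ⟨e, h1⟩
  obtain ⟨a, c⟩ := p
  obtain ⟨b, d⟩ := q
  simp only at e h1
  subst e
  obtain ⟨h2, h3, h4⟩ := h
  simp only [ne_eq, Prod.mk.injEq, true_and] at h2 h3 h4
  rw [abs_le] at h1
  omega

theorem Far.addNode_comm {p q : Node} (h : Far p q) (m : Node → Bool) :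
    addNode (addNode m p) q = addNode (addNode m q) p := by
  funext r
  have h1 := h.pred_ne_pred
  obtain ⟨h2, h3, h4⟩ := h
  by_cases e1 : r = p
  · subst e1
    rw [addNode_self, addNode_of_ne _ h2 h3, addNode_self]
  by_cases e2 : r = q
  · subst e2
    rw [addNode_self, addNode_of_ne _ (Ne.symm h2) h4, addNode_self]
  by_cases e3 : r = (p.1, p.2 - 1)
  · rw [e3, addNode_pred, addNode_of_ne _ (e3 ▸ e2) h1, addNode_pred]
  by_cases e4 : r = (q.1, q.2 - 1)
  · rw [e4, addNode_pred, addNode_of_ne _ (e4 ▸ e1) h1.symm, addNode_pred]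
  rw [addNode_of_ne _ e2 e4, addNode_of_ne _ e1 e3, addNode_of_ne _ e1 e3, addNode_of_ne _ e2 e4]

theorem Far.addable_addNode {p q : Node} (h : Far p q) (m : Node → Bool) :
    Addable (addNode m p) q ↔ Addable m q := by
  rw [Addable, Addable, addNode_of_ne _ (Ne.symm h.2.1) h.symm.pred_ne_pred,
    addNode_of_ne _ (Ne.symm h.1) h.2.2]

theorem Far.removable_addNode {p q : Node} (h : Far p q) (m : Node → Bool) :
    Removable (addNode m p) q ↔ Removable m q := by
  rw [Removable, Removable, addNode_of_ne _ (Ne.symm h.2.1) h.symm.pred_ne_pred,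
    addNode_of_ne _ (Ne.symm h.1) h.2.2]

theorem Far.addable_removeNode {p q : Node} (h : Far p q) (m : Node → Bool) :
    Addable (removeNode m p) q ↔ Addable m q := by
  rw [Addable, Addable, removeNode_of_ne _ (Ne.symm h.2.1) h.symm.pred_ne_pred,
    removeNode_of_ne _ (Ne.symm h.1) h.2.2]

theorem Far.removeNode_addNode {p q : Node} (h : Far p q) {m : Node → Bool} (hq : Removable m q) :
    removeNode (addNode m p) q = addNode (removeNode m q) p := by
  have h1 : Addable (addNode (removeNode m q) p) q :=
    (h.addable_addNode _).2 (Removable.addable_removeNode m q)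
  rw [← h1.removeNode_addNode, h.addNode_comm, hq.addNode_removeNode]

/-- For neighbouring contents the two moves would need the same position both occupied and vacant.
-/
theorem Addable.far {m : Node → Bool} {p q : Node} (hp : Addable m p) (hq : Addable m q)
    (h : p ≠ q) : Far p q := by
  refine ⟨h, ?_, ?_⟩
  · rintro rfl; simpa [hq.1] using hp.2
  · rintro rfl; simpa [hp.1] using hq.2

theorem Removable.far {m : Node → Bool} {p q : Node} (hp : Removable m p) (hq : Removable m q)
    (h : p ≠ q) : Far p q := by
  refine ⟨h, ?_, ?_⟩
  · rintro rfl; simpa [hq.1] using hp.2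
  · rintro rfl; simpa [hp.1] using hq.2

/-- The pair of Maya diagrams obtained from a list of nodes, of which the head is added last. -/
def shape : List Node → Node → Bool
  | [] => emptyShape
  | p :: t => addNode (shape t) p

/-- Every node of the list is addable to the shape of the tail which follows it: the list encodes
a standard bitableau. -/
def IsStd : List Node → Prop
  | [] => True
  | p :: t => IsStd t ∧ Addable (shape t) p

theorem IsStd.swap {p q : Node} {t : List Node} (h : IsStd (p :: q :: t)) (hpq : Far p q) :
    IsStd (q :: p :: t) ∧ shape (q :: p :: t) = shape (p :: q :: t) := by
  obtain ⟨⟨h1, h2⟩, h3⟩ := h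
  refine ⟨⟨⟨h1, (hpq.symm.addable_addNode _).1 h3⟩, (hpq.addable_addNode _).2 h2⟩, ?_⟩
  exact hpq.addNode_comm _

theorem IsStd.ne_of_cons_cons {p q : Node} {t : List Node} (h : IsStd (p :: q :: t)) : p ≠ q := by
  rintro rfl
  obtain ⟨⟨h1, h2⟩, h3⟩ := h
  have := h3.2
  simp [shape, addNode_self] at this

/-- After a bead moves from c - 1 to c, repeating the move requires both a new bead at c - 1 and a
vacancy at c; one intermediate move cannot provide both. -/
theorem IsStd.ne_of_cons_cons_cons {p q r : Node} {t : List Node}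
    (h : IsStd (p :: q :: r :: t)) : p ≠ r := by
  rintro rfl
  obtain ⟨⟨⟨h1, h2⟩, h3⟩, h4⟩ := h
  by_cases e : Far q p
  · have := (e.addable_addNode _).1 h4
    simpa [shape, addNode_self] using this.2
  · have e1 : q ≠ p := by
      rintro rfl
      simpa [shape, addNode_self] using h3.2
    have : q = (p.1, p.2 - 1) ∨ p = (q.1, q.2 - 1) := by
      by_contra! h5
      exact e ⟨e1, h5.1, h5.2⟩
    rcases this with h5 | h5
    · have h6 := h4.2
      simp only [shape] at h6
      rw [addNode_of_ne _ e1.symm, addNode_self] at h6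
      · exact absurd h6 (by simp)
      · rw [h5]
        intro h
        have := congrArg Prod.snd h
        simp only at this
        omega
    · have h6 := h4.1
      simp only [shape] at h6
      rw [addNode_of_ne, addNode_pred] at h6
      · exact absurd h6 (by simp)
      · rw [h5]
        intro h
        have := congrArg Prod.snd h
        simp only at this
        omega
      · rw [← h5]
        exact pred_ne p

/-! ### The contents occurring in a standard bitableau. -/

theorem shape_eq_true {t : List Node} {p : Node} (h : shape t p = true) : p.2 < 0 ∨ p ∈ t := by
  induction t with
  | nil => left; simpa [shape, emptyShape] using h
  | cons q t ih =>
    simp only [shape, addNode] at h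
    split_ifs at h with h1 h2
    · right; simp [h1]
    · rcases ih h with h3 | h3
      · exact Or.inl h3
      · right; simp [h3]

theorem shape_eq_false {t : List Node} {p : Node} (h : shape t p = false) :
    0 ≤ p.2 ∨ (p.1, p.2 + 1) ∈ t := by
  induction t with
  | nil => left; simpa [shape, emptyShape] using h
  | cons q t ih =>
    simp only [shape, addNode] at h
    split_ifs at h with h1 h2
    · right; simp [h2]
    · rcases ih h with h3 | h3
      · exact Or.inl h3
      · right; simp [h3]

/-- The bead moved by `p` sits at a nonnegative position, which is empty initially, so an earlier
box brought a bead there. -/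
theorem IsStd.pred_mem {t : List Node} (h : IsStd t) {p : Node} (hp : p ∈ t) (h0 : 0 < p.2) :
    (p.1, p.2 - 1) ∈ t := by
  induction t with
  | nil => simp at hp
  | cons q t ih =>
    rcases List.mem_cons.1 hp with rfl | hp
    · rcases shape_eq_true h.2.1 with h1 | h1
      · simp only at h1; omega
      · simp [h1]
    · exact List.mem_cons_of_mem _ (ih h.1 hp)

theorem IsStd.succ_mem {t : List Node} (h : IsStd t) {p : Node} (hp : p ∈ t) (h0 : p.2 < 0) :
    (p.1, p.2 + 1) ∈ t := by
  induction t with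
  | nil => simp at hp
  | cons q t ih =>
    rcases List.mem_cons.1 hp with rfl | hp
    · rcases shape_eq_false h.2.2 with h1 | h1
      · omega
      · simp [h1]
    · exact List.mem_cons_of_mem _ (ih h.1 hp)

theorem IsStd.mem_of_nonneg {t : List Node} (h : IsStd t) {ε : Bool} (c : ℕ)
    (hp : (ε, (c : ℤ)) ∈ t) {d : ℤ} (h0 : 0 ≤ d) (hd : d ≤ c) : (ε, d) ∈ t := by
  induction c with
  | zero => rwa [show d = ((0 : ℕ) : ℤ) by push_cast at *; omega]
  | succ c ih =>
    rcases eq_or_ne d ((c + 1 : ℕ) : ℤ) with rfl | h1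
    · exact hp
    · refine ih ?_ (by push_cast at *; omega)
      have := h.pred_mem hp (by push_cast; omega)
      simpa using this

theorem IsStd.mem_of_nonpos {t : List Node} (h : IsStd t) {ε : Bool} (c : ℕ)
    (hp : (ε, -(c : ℤ)) ∈ t) {d : ℤ} (h0 : d ≤ 0) (hd : -(c : ℤ) ≤ d) : (ε, d) ∈ t := by
  induction c with
  | zero => rwa [show d = -((0 : ℕ) : ℤ) by push_cast at *; omega]
  | succ c ih =>
    rcases eq_or_ne d (-((c + 1 : ℕ) : ℤ)) with rfl | h1
    · exact hp
    · refine ih ?_ (by push_cast at *; omega)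
      have := h.succ_mem hp (by push_cast; omega)
      simpa using this

theorem IsStd.mem_of_le_of_le {t : List Node} (h : IsStd t) {ε : Bool} {c d e : ℤ}
    (hc : (ε, c) ∈ t) (he : (ε, e) ∈ t) (hcd : c ≤ d) (hde : d ≤ e) : (ε, d) ∈ t := by
  rcases le_total 0 d with h0 | h0
  · lift e to ℕ using h0.trans hde
    exact h.mem_of_nonneg e he h0 hde
  · obtain ⟨c', rfl⟩ : ∃ c' : ℕ, c = -c' := ⟨c.natAbs, by omega⟩
    exact h.mem_of_nonpos c' hc h0 hcd

/-- The contents in one component fill an interval, so the e - c + 1 contents between c and e are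
distinct entries of the list. This bound is why no quantum integer beyond [n] is needed for the
relations. -/
theorem IsStd.sub_lt_length {t : List Node} (h : IsStd t) {ε : Bool} {c e : ℤ}
    (hc : (ε, c) ∈ t) (he : (ε, e) ∈ t) : e - c < t.length := by
  classical
  have h1 : (Finset.Icc c e).image (fun d => (ε, d)) ⊆ t.toFinset := by
    intro p hp
    obtain ⟨d, hd, rfl⟩ := Finset.mem_image.1 hp
    rw [Finset.mem_Icc] at hd
    rw [List.mem_toFinset]
    exact h.mem_of_le_of_le hc he hd.1 hd.2
  have h2 := (Finset.card_le_card h1).trans (List.toFinset_card_le t)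
  rw [Finset.card_image_of_injective _ (fun a b h => by simpa using h), Int.card_Icc] at h2
  have : 0 < t.length := List.length_pos_of_mem hc
  omega

theorem IsStd.abs_sub_lt_length {t : List Node} (h : IsStd t) {p q : Node} (hp : p ∈ t)
    (hq : q ∈ t) (e : p.1 = q.1) : |q.2 - p.2| < t.length := by
  obtain ⟨ε, c⟩ := p
  obtain ⟨ε', d⟩ := q
  simp only at e
  subst e
  have h1 := h.sub_lt_length hp hq
  have h2 := h.sub_lt_length hq hp
  rw [abs_lt]
  constructor <;> simp only <;> omega

theorem IsStd.zero_mem {t : List Node} (h : IsStd t) {p : Node} (hp : p ∈ t) : (p.1, 0) ∈ t := by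
  obtain ⟨ε, c⟩ := p
  rcases le_total 0 c with h0 | h0
  · lift c to ℕ using h0
    exact h.mem_of_nonneg c hp le_rfl (by simp)
  · obtain ⟨c', rfl⟩ : ∃ c' : ℕ, c = -c' := ⟨c.natAbs, by omega⟩
    exact h.mem_of_nonpos c' hp le_rfl (by simp)

theorem IsStd.abs_lt_length {t : List Node} (h : IsStd t) {p : Node} (hp : p ∈ t) :
    |p.2| < t.length := by
  simpa using h.abs_sub_lt_length (h.zero_mem hp) hp rfl

/-! ### Changing the box that is added last. -/

theorem not_removable_emptyShape (p : Node) : ¬ Removable emptyShape p := by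
  rintro ⟨h1, h2⟩
  simp only [emptyShape, decide_eq_false_iff_not, decide_eq_true_eq] at h1 h2
  omega

/-- A removable box does not interact with any other removable box, so it can be exchanged step by
step with the boxes added after it. -/
theorem IsStd.exists_cons_of_removable {t : List Node} (h : IsStd t) {p : Node}
    (hp : Removable (shape t) p) :
    ∃ u, IsStd (p :: u) ∧ shape (p :: u) = shape t ∧ (p :: u).length = t.length := by
  induction t with
  | nil => exact absurd hp (not_removable_emptyShape p)
  | cons q t ih =>
    by_cases e : p = q
    · subst e
      exact ⟨t, h, rfl, rfl⟩
    · have hf : Far p q := hp.far (Addable.removable_addNode (shape t) q) e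
      have h1 : Removable (shape t) p := (hf.symm.removable_addNode _).1 hp
      obtain ⟨u, hu, hs, hl⟩ := ih h.1 h1
      have h2 : IsStd (q :: p :: u) := ⟨hu, by rw [hs]; exact h.2⟩
      obtain ⟨h3, h4⟩ := h2.swap hf.symm
      refine ⟨q :: u, h3, ?_, ?_⟩
      · rw [h4]
        change addNode (shape (p :: u)) q = addNode (shape t) q
        rw [hs]
      · simp only [List.length_cons] at *
        omega

theorem IsStd.exists_removable {t : List Node} (h : IsStd t) {p : Node} (hp : p ∈ t) :
    ∃ r, r.1 = p.1 ∧ Removable (shape t) r := by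
  induction t with
  | nil => simp at hp
  | cons q t ih =>
    by_cases e : q.1 = p.1
    · exact ⟨q, e, Addable.removable_addNode _ _⟩
    · rcases List.mem_cons.1 hp with rfl | hp
      · exact absurd rfl e
      obtain ⟨r, hr, hrem⟩ := ih h.1 hp
      refine ⟨r, hr, (far_of_not_adjacent ?_).removable_addNode _ |>.2 hrem⟩
      intro h1
      exact e (h1.1.trans hr)

theorem eq_zero_of_addable {t : List Node} {p : Node} (hp : Addable (shape t) p)
    (h : ∀ q ∈ t, q.1 ≠ p.1) : p.2 = 0 := by
  have h1 : p.2 - 1 < 0 := by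
    rcases shape_eq_true hp.1 with h1 | h1
    · exact h1
    · exact (h _ h1 rfl).elim
  have h2 : 0 ≤ p.2 := by
    rcases shape_eq_false hp.2 with h1 | h1
    · exact h1
    · exact (h _ h1 rfl).elim
  omega

theorem addable_emptyShape_iff {p : Node} : Addable emptyShape p ↔ p.2 = 0 := by
  constructor
  · intro h
    exact eq_zero_of_addable (t := []) h (by simp)
  · intro h
    constructor <;> simp [emptyShape, h]

/-! ### Hecke algebras of type `B_n` with parameters `(1 + x, 0)` and `(x, -1)` -/

/-- The relations of the generic Iwahori–Hecke algebra of type `B_n` in which the special generator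
has the eigenvalues `1 + x` and `0`, and the others `x` and `-1`. -/
structure HeckeRelations {Λ B : Type*} [CommRing Λ] [Ring B] [Algebra Λ B] (x : Λ) (n : ℕ)
    (T : ℕ → B) : Prop where
  sq_zero : 0 < n → T 0 * T 0 = (1 + x) • T 0
  sq_succ : ∀ i, i + 1 < n → T (i + 1) * T (i + 1) = (x - 1) • T (i + 1) + x • (1 : B)
  braid_zero : 1 < n → T 0 * T 1 * T 0 * T 1 = T 1 * T 0 * T 1 * T 0
  braid_succ : ∀ i, i + 2 < n →
    T (i + 1) * T (i + 2) * T (i + 1) = T (i + 2) * T (i + 1) * T (i + 2)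
  comm : ∀ i j, i + 1 < j → j < n → T i * T j = T j * T i
  vanish : ∀ i, n ≤ i → T i = 0

section Words

variable {Λ B : Type*} [CommRing Λ] [Ring B] [Algebra Λ B]

/-- The product `T k * T (k - 1) * ⋯ * T (k + 1 - j)` of `j` factors. -/
def downWord (T : ℕ → B) (k : ℕ) : ℕ → B
  | 0 => 1
  | j + 1 => downWord T k j * T (k - j)

/-- The product `T k * T (k - 1) * ⋯ * T 0 * T 1 * ⋯ * T j`. -/
def upWord (T : ℕ → B) (k : ℕ) : ℕ → B
  | 0 => downWord T k (k + 1)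
  | j + 1 => upWord T k j * T (j + 1)

variable {x : Λ} {n : ℕ} {T : ℕ → B}

theorem HeckeRelations.downWord_mul_of_lt (h : HeckeRelations x n T) {k : ℕ} (hk : k < n) (j i : ℕ)
    (hij : i + j < k) : downWord T k j * T i = T i * downWord T k j := by
  induction j with
  | zero => simp [downWord]
  | succ j ih =>
    rw [downWord, mul_assoc, ← h.comm i (k - j) (by omega) (by omega), ← mul_assoc,
      ih (by omega), mul_assoc]

/-- Moving left, T (i + 2) commutes with the factors of index at most i, becomes T (i + 1) by the
braid relation, and then commutes with the factors of index at least i + 3. -/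
theorem HeckeRelations.downWord_mul_of_gt (h : HeckeRelations x n T) {k : ℕ} (hk : k < n) (j i : ℕ)
    (hi : i + 2 ≤ k) (hij : k < i + 1 + j) (hj : j ≤ k) :
    downWord T k j * T (i + 2) = T (i + 1) * downWord T k j := by
  induction j with
  | zero => omega
  | succ j ih =>
    rcases eq_or_ne (k - j) (i + 1) with e | e
    · obtain ⟨j', rfl⟩ : ∃ j', j = j' + 1 := ⟨j - 1, by omega⟩
      have e' : k - j' = i + 2 := by omega
      rw [downWord, downWord, e, e', mul_assoc, mul_assoc, ← mul_assoc (T (i + 2)),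
        ← h.braid_succ i (by omega), ← mul_assoc, ← mul_assoc,
        h.downWord_mul_of_lt hk j' (i + 1) (by omega)]
      simp only [mul_assoc]
    · rw [downWord, mul_assoc, h.comm (k - j) (i + 2) (by omega) (by omega), ← mul_assoc,
        ih (by omega) (by omega), mul_assoc]

theorem HeckeRelations.upWord_zero_mul (h : HeckeRelations x n T) {k : ℕ} (hk : k < n) (i : ℕ)
    (hi : i + 2 ≤ k) : upWord T k 0 * T (i + 2) = T (i + 1) * upWord T k 0 := by
  rw [upWord, downWord, Nat.sub_self, mul_assoc, h.comm 0 (i + 2) (by omega) (by omega),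
    ← mul_assoc, h.downWord_mul_of_gt hk k i hi (by omega) le_rfl, mul_assoc]

theorem HeckeRelations.upWord_mul_of_gt (h : HeckeRelations x n T) {k : ℕ} (hk : k < n) (j i : ℕ)
    (hi : i + 2 ≤ k) (hij : j ≤ i) : upWord T k j * T (i + 2) = T (i + 1) * upWord T k j := by
  induction j with
  | zero => exact h.upWord_zero_mul hk i hi
  | succ j ih =>
    rw [upWord, mul_assoc, h.comm (j + 1) (i + 2) (by omega) (by omega), ← mul_assoc,
      ih (by omega), mul_assoc]

/-- The ascending half of the word raises the index by one, and the descending half lowers it again.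
-/
theorem HeckeRelations.upWord_mul_of_lt (h : HeckeRelations x n T) {k : ℕ} (hk : k < n) (j i : ℕ)
    (hij : i + 2 ≤ j) (hj : j ≤ k) : upWord T k j * T (i + 1) = T (i + 1) * upWord T k j := by
  induction j with
  | zero => omega
  | succ j ih =>
    rcases eq_or_ne j (i + 1) with rfl | e
    · rw [upWord, upWord, mul_assoc, mul_assoc, ← mul_assoc (T (i + 1)),
        h.braid_succ i (by omega), ← mul_assoc, ← mul_assoc,
        h.upWord_mul_of_gt hk i i (by omega) le_rfl]
      simp only [mul_assoc]
    · rw [upWord, mul_assoc, ← h.comm (i + 1) (j + 1) (by omega) (by omega), ← mul_assoc,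
        ih (by omega) (by omega), mul_assoc]

theorem HeckeRelations.upWord_mul_zero (h : HeckeRelations x n T) {k : ℕ} (hk : k < n) (j : ℕ)
    (h1 : 1 ≤ j) (hj : j ≤ k) : upWord T k j * T 0 = T 0 * upWord T k j := by
  induction j with
  | zero => omega
  | succ j ih =>
    rcases Nat.eq_zero_or_pos j with rfl | e
    · obtain ⟨k, rfl⟩ : ∃ k', k = k' + 1 := ⟨k - 1, by omega⟩
      have e1 : upWord T (k + 1) 1 = downWord T (k + 1) k * (T 1 * T 0 * T 1) := by
        simp [upWord, downWord, mul_assoc]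
      rw [e1, mul_assoc, ← h.braid_zero (by omega), mul_assoc (T 0), mul_assoc (T 0), ← mul_assoc,
        h.downWord_mul_of_lt hk k 0 (by omega)]
      simp only [mul_assoc]
    · rw [upWord, mul_assoc, ← h.comm 0 (j + 1) (by omega) (by omega), ← mul_assoc,
        ih (by omega) (by omega), mul_assoc]

/-- The words of length `i ≤ 2 k + 1`. -/
def cosetWord (T : ℕ → B) (k i : ℕ) : B :=
  if i ≤ k then downWord T k i else upWord T k (i - (k + 1))

theorem cosetWord_of_le (T : ℕ → B) {k i : ℕ} (h : i ≤ k + 1) :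
    cosetWord T k i = downWord T k i := by
  rw [cosetWord]
  split_ifs with h1
  · rfl
  · obtain rfl : i = k + 1 := by omega
    simp [upWord]

theorem cosetWord_of_lt (T : ℕ → B) {k i : ℕ} (h : k < i) :
    cosetWord T k i = upWord T k (i - (k + 1)) := by
  rw [cosetWord, if_neg (by omega)]

/-- A word multiplied by a generator is a combination of words with coefficients from the
algebra of lower rank. -/
theorem HeckeRelations.cosetWord_mul (h : HeckeRelations x n T) {k : ℕ} (hk : k < n) (i j : ℕ)
    (hi : i < 2 * (k + 1)) (hj : j ≤ k) :
    (∃ j' < k, cosetWord T k i * T j = T j' * cosetWord T k i) ∨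
    cosetWord T k i * T j ∈ Submodule.span Λ
      (Set.range fun i : Fin (2 * (k + 1)) => cosetWord T k i) := by
  have mem : ∀ i, i < 2 * (k + 1) → cosetWord T k i ∈ Submodule.span Λ
      (Set.range fun i : Fin (2 * (k + 1)) => cosetWord T k i) :=
    fun i hi => Submodule.subset_span ⟨⟨i, hi⟩, rfl⟩
  have quad : ∀ (u : B) (j : ℕ), j < n → (u * T j * T j) = (if j = 0 then (1 + x) else (x - 1)) •
      (u * T j) + (if j = 0 then 0 else x) • u := by
    intro u j hj
    rw [mul_assoc]
    rcases j with _ | j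
    · rw [h.sq_zero hj]
      simp
    · rw [h.sq_succ j hj]
      simp [mul_add]
  by_cases hik : i ≤ k
  · rw [cosetWord_of_le T (by omega)]
    rcases lt_trichotomy (i + j) k with h1 | h1 | h1
    · exact Or.inl ⟨j, by omega, h.downWord_mul_of_lt hk i j (by omega)⟩
    · right
      have := mem (i + 1) (by omega)
      rw [cosetWord_of_le T (by omega), downWord] at this
      rwa [show j = k - i by omega]
    · rcases eq_or_ne (i + j) (k + 1) with h2 | h2
      · right
        obtain ⟨i, rfl⟩ : ∃ i', i = i' + 1 := ⟨i - 1, by omega⟩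
        have e : k - i = j := by omega
        have m1 := mem (i + 1) (by omega)
        have m0 := mem i (by omega)
        rw [cosetWord_of_le T (by omega)] at m1 m0
        rw [downWord, e] at m1 ⊢
        rw [quad _ _ (by omega)]
        exact add_mem (Submodule.smul_mem _ _ m1) (Submodule.smul_mem _ _ m0)
      · obtain ⟨j, rfl⟩ : ∃ j', j = j' + 2 := ⟨j - 2, by omega⟩
        exact Or.inl ⟨j + 1, by omega, h.downWord_mul_of_gt hk i j (by omega) (by omega) hik⟩
  · rw [cosetWord_of_lt T (by omega)]
    obtain ⟨l, rfl⟩ : ∃ l, i = l + (k + 1) := ⟨i - (k + 1), by omega⟩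
    rw [Nat.add_sub_cancel]
    have mem' : ∀ l, l ≤ k → upWord T k l ∈ Submodule.span Λ
        (Set.range fun i : Fin (2 * (k + 1)) => cosetWord T k i) := by
      intro l hl
      have := mem (l + (k + 1)) (by omega)
      rwa [cosetWord_of_lt T (by omega), Nat.add_sub_cancel] at this
    rcases eq_or_ne j (l + 1) with rfl | h1
    · exact Or.inr (mem' (l + 1) hj)
    rcases eq_or_ne j l with rfl | h2
    · right
      rcases j with _ | j
      · have m1 := mem' 0 (by omega)
        have m0 := mem k (by omega)
        rw [cosetWord_of_le T (by omega)] at m0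
        rw [upWord, downWord, Nat.sub_self] at m1 ⊢
        rw [quad _ _ (by omega)]
        exact add_mem (Submodule.smul_mem _ _ m1) (Submodule.smul_mem _ _ m0)
      · have m1 := mem' (j + 1) (by omega)
        have m0 := mem' j (by omega)
        rw [upWord] at m1 ⊢
        rw [quad _ _ (by omega)]
        exact add_mem (Submodule.smul_mem _ _ m1) (Submodule.smul_mem _ _ m0)
    left
    rcases lt_or_ge l j with h3 | h3
    · obtain ⟨j, rfl⟩ : ∃ j', j = j' + 2 := ⟨j - 2, by omega⟩
      exact ⟨j + 1, by omega, h.upWord_mul_of_gt hk l j (by omega) (by omega)⟩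
    · rcases j with _ | j
      · exact ⟨0, by omega, h.upWord_mul_zero hk l (by omega) (by omega)⟩
      · exact ⟨j + 1, by omega, h.upWord_mul_of_lt hk l j (by omega) (by omega)⟩

/-- The words play the role of the 2(k+1) representatives of the cosets of B_k in B_{k+1}: if S is
the span for k and W the span of the words, then S W is closed under right multiplication, as
`cosetWord_mul` moves a generator into S or keeps it in W. -/
theorem HeckeRelations.exists_span_closed (h : HeckeRelations x n T) (k : ℕ) (hk : k ≤ n) :
    ∃ m : Fin (2 ^ k * k.factorial) → B, 1 ∈ Submodule.span Λ (Set.range m) ∧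
      ∀ j < k, ∀ u ∈ Submodule.span Λ (Set.range m), u * T j ∈ Submodule.span Λ (Set.range m) := by
  induction k with
  | zero => exact ⟨fun _ => 1, Submodule.subset_span ⟨⟨0, by simp⟩, rfl⟩, fun j hj => by omega⟩
  | succ k ih =>
    obtain ⟨m, h1, hm⟩ := ih (by omega)
    let e : Fin (2 ^ (k + 1) * (k + 1).factorial) ≃
        Fin (2 ^ k * k.factorial) × Fin (2 * (k + 1)) :=
      (finCongr (by rw [Nat.factorial_succ, pow_succ]; ring)).trans finProdFinEquiv.symm
    let S := Submodule.span Λ (Set.range m)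
    let W := Submodule.span Λ (Set.range fun i : Fin (2 * (k + 1)) => cosetWord T k i)
    have hspan : Submodule.span Λ (Set.range fun i => m (e i).1 * cosetWord T k (e i).2) =
        S * W := by
      rw [Submodule.span_mul_span]
      congr 1
      ext u
      constructor
      · rintro ⟨i, rfl⟩
        exact Set.mul_mem_mul ⟨_, rfl⟩ ⟨_, rfl⟩
      · rintro ⟨_, ⟨a, rfl⟩, _, ⟨b, rfl⟩, rfl⟩
        exact ⟨e.symm (a, b), by simp⟩
    refine ⟨fun i => m (e i).1 * cosetWord T k (e i).2, ?_, ?_⟩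
    · rw [hspan, ← mul_one (1 : B)]
      refine Submodule.mul_mem_mul h1 (Submodule.subset_span ⟨⟨0, by omega⟩, ?_⟩)
      simp [cosetWord, downWord]
    · intro j hj u hu
      rw [hspan] at hu ⊢
      induction hu using Submodule.mul_induction_on' with
      | mem_mul_mem s hs w hw =>
        induction hw using Submodule.span_induction with
        | mem w hw =>
          obtain ⟨i, rfl⟩ := hw
          rw [mul_assoc]
          rcases h.cosetWord_mul (by omega : k < n) i j i.2 (by omega) with ⟨j', hj', e1⟩ | h2
          · rw [e1, ← mul_assoc]
            exact Submodule.mul_mem_mul (hm j' hj' s hs) (Submodule.subset_span ⟨i, rfl⟩)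
          · exact Submodule.mul_mem_mul hs h2
        | zero => simp
        | add a b _ _ ha hb => rw [mul_add, add_mul]; exact add_mem ha hb
        | smul c a _ ha => rw [mul_smul_comm, smul_mul_assoc]; exact Submodule.smul_mem _ _ ha
      | add a _ b _ ha hb => rw [add_mul]; exact add_mem ha hb

theorem HeckeRelations.exists_span_eq_top (h : HeckeRelations x n T)
    (hT : Algebra.adjoin Λ (Set.range T) = ⊤) :
    ∃ m : Fin (2 ^ n * n.factorial) → B, Submodule.span Λ (Set.range m) = ⊤ := by
  obtain ⟨m, h1, hm⟩ := h.exists_span_closed n le_rfl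
  refine ⟨m, ?_⟩
  have key : ∀ b ∈ Algebra.adjoin Λ (Set.range T), ∀ u ∈ Submodule.span Λ (Set.range m),
      u * b ∈ Submodule.span Λ (Set.range m) := by
    intro b hb
    induction hb using Algebra.adjoin_induction with
    | mem b hb =>
      obtain ⟨j, rfl⟩ := hb
      intro u hu
      rcases lt_or_ge j n with h2 | h2
      · exact hm j h2 u hu
      · rw [h.vanish j h2, mul_zero]; exact zero_mem _
    | algebraMap r =>
      intro u hu
      rw [← Algebra.commutes, ← Algebra.smul_def]
      exact Submodule.smul_mem _ _ hu
    | add a b _ _ ha hb =>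
      intro u hu
      rw [mul_add]
      exact add_mem (ha u hu) (hb u hu)
    | mul a b _ _ ha hb =>
      intro u hu
      rw [← mul_assoc]
      exact hb _ (ha u hu)
  rw [eq_top_iff]
  intro b _
  rw [← one_mul b]
  exact key b (by rw [hT]; trivial) 1 h1

end Words

/-! ### The algebra presented by the relations -/

section Presentation

variable {Λ : Type*} [CommRing Λ]

/-- The defining relations, between elements of the free algebra. -/
inductive HeckeRel (x : Λ) (n : ℕ) : FreeAlgebra Λ ℕ → FreeAlgebra Λ ℕ → Prop
  | sq_zero : 0 < n → HeckeRel x n (FreeAlgebra.ι Λ 0 * FreeAlgebra.ι Λ 0)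
      ((1 + x) • FreeAlgebra.ι Λ 0)
  | sq_succ (i : ℕ) : i + 1 < n → HeckeRel x n
      (FreeAlgebra.ι Λ (i + 1) * FreeAlgebra.ι Λ (i + 1))
      ((x - 1) • FreeAlgebra.ι Λ (i + 1) + x • (1 : FreeAlgebra Λ ℕ))
  | braid_zero : 1 < n → HeckeRel x n
      (FreeAlgebra.ι Λ 0 * FreeAlgebra.ι Λ 1 * FreeAlgebra.ι Λ 0 * FreeAlgebra.ι Λ 1)
      (FreeAlgebra.ι Λ 1 * FreeAlgebra.ι Λ 0 * FreeAlgebra.ι Λ 1 * FreeAlgebra.ι Λ 0)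
  | braid_succ (i : ℕ) : i + 2 < n → HeckeRel x n
      (FreeAlgebra.ι Λ (i + 1) * FreeAlgebra.ι Λ (i + 2) * FreeAlgebra.ι Λ (i + 1))
      (FreeAlgebra.ι Λ (i + 2) * FreeAlgebra.ι Λ (i + 1) * FreeAlgebra.ι Λ (i + 2))
  | comm (i j : ℕ) : i + 1 < j → j < n → HeckeRel x n
      (FreeAlgebra.ι Λ i * FreeAlgebra.ι Λ j) (FreeAlgebra.ι Λ j * FreeAlgebra.ι Λ i)
  | vanish (i : ℕ) : n ≤ i → HeckeRel x n (FreeAlgebra.ι Λ i) 0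

/-- The Iwahori–Hecke algebra of type `B_n` with parameters `(1 + x, 0)` and `(x, -1)`. -/
abbrev HeckeB (x : Λ) (n : ℕ) : Type _ := RingQuot (HeckeRel x n)

/-- The generators. -/
noncomputable def HeckeB.gen (x : Λ) (n : ℕ) (i : ℕ) : HeckeB x n :=
  RingQuot.mkAlgHom Λ (HeckeRel x n) (FreeAlgebra.ι Λ i)

theorem HeckeB.relations (x : Λ) (n : ℕ) : HeckeRelations x n (HeckeB.gen x n) where
  sq_zero h := by
    simpa [HeckeB.gen] using RingQuot.mkAlgHom_rel Λ (HeckeRel.sq_zero (x := x) h)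
  sq_succ i h := by
    simpa [HeckeB.gen] using RingQuot.mkAlgHom_rel Λ (HeckeRel.sq_succ (x := x) i h)
  braid_zero h := by
    simpa [HeckeB.gen] using RingQuot.mkAlgHom_rel Λ (HeckeRel.braid_zero (x := x) h)
  braid_succ i h := by
    simpa [HeckeB.gen] using RingQuot.mkAlgHom_rel Λ (HeckeRel.braid_succ (x := x) i h)
  comm i j h h' := by
    simpa [HeckeB.gen] using RingQuot.mkAlgHom_rel Λ (HeckeRel.comm (x := x) i j h h')
  vanish i h := by
    simpa [HeckeB.gen] using RingQuot.mkAlgHom_rel Λ (HeckeRel.vanish (x := x) i h)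

theorem HeckeB.adjoin_range_gen (x : Λ) (n : ℕ) :
    Algebra.adjoin Λ (Set.range (HeckeB.gen x n)) = ⊤ := by
  have h1 : Set.range (HeckeB.gen x n) =
      RingQuot.mkAlgHom Λ (HeckeRel x n) '' Set.range (FreeAlgebra.ι Λ) := by
    rw [← Set.range_comp]
    rfl
  rw [h1, ← AlgHom.map_adjoin, FreeAlgebra.adjoin_range_ι, Algebra.map_top,
    AlgHom.range_eq_top]
  exact RingQuot.mkAlgHom_surjective Λ _

/-- The universal property of the presented algebra. -/
theorem HeckeRelations.exists_algHom {B : Type*} [Ring B] [Algebra Λ B] {x : Λ} {n : ℕ}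
    {T : ℕ → B} (h : HeckeRelations x n T) :
    ∃ f : HeckeB x n →ₐ[Λ] B, ∀ i, f (HeckeB.gen x n i) = T i := by
  refine ⟨RingQuot.liftAlgHom Λ ⟨FreeAlgebra.lift Λ T, ?_⟩, fun i => ?_⟩
  · intro a b hab
    induction hab with
    | sq_zero h1 => simpa using h.sq_zero h1
    | sq_succ i h1 => simpa using h.sq_succ i h1
    | braid_zero h1 => simpa using h.braid_zero h1
    | braid_succ i h1 => simpa using h.braid_succ i h1
    | comm i j h1 h2 => simpa using h.comm i j h1 h2
    | vanish i h1 => simpa using h.vanish i h1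
  · simp [HeckeB.gen]

end Presentation

/-! ### The seminormal representation -/

section Seminormal

variable {K : Type*} [CommRing K]

/-- The basis vector of a list of nodes. -/
noncomputable abbrev vec (K : Type*) [CommRing K] (t : List Node) : List Node →₀ K :=
  Finsupp.single t 1

/-- Adding a node in front. -/
noncomputable def consMap (K : Type*) [CommRing K] (p : Node) :
    (List Node →₀ K) →ₗ[K] (List Node →₀ K) :=
  Finsupp.linearCombination K fun t => vec K (p :: t)

/-- The action of an endomorphism on the tails of nonempty lists. -/
noncomputable def tailMap (f : Module.End K (List Node →₀ K)) : Module.End K (List Node →₀ K) :=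
  Finsupp.linearCombination K fun
    | [] => 0
    | p :: t => consMap K p (f (vec K t))

/-- The action of the last generator on lists with at least two nodes. -/
noncomputable def topMap (x : Kˣ) : Module.End K (List Node →₀ K) :=
  Finsupp.linearCombination K fun
    -- The head `p` is added after `q`, so the earlier node is the first argument.
    | p :: q :: t => diagCoeff x q p • vec K (p :: q :: t) + swapCoeff x q p • vec K (q :: p :: t)
    | _ => 0

/-- The action of the special generator on lists with one node. -/
noncomputable def signMap (x : Kˣ) : Module.End K (List Node →₀ K) :=
  Finsupp.linearCombination K fun
    -- The scalar is the residue of a box of content 0 in the component.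
    | [p] => (if p.1 then 1 + (x : K) else 0) • vec K [p]
    | _ => 0

@[simp] theorem consMap_vec (p : Node) (t : List Node) :
    consMap K p (vec K t) = vec K (p :: t) := by
  simp [consMap]

@[simp] theorem tailMap_vec_cons (f : Module.End K (List Node →₀ K)) (p : Node) (t : List Node) :
    tailMap f (vec K (p :: t)) = consMap K p (f (vec K t)) := by
  simp [tailMap]

@[simp] theorem topMap_vec (x : Kˣ) (p q : Node) (t : List Node) :
    topMap x (vec K (p :: q :: t)) =
      diagCoeff x q p • vec K (p :: q :: t) + swapCoeff x q p • vec K (q :: p :: t) := by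
  simp [topMap]

@[simp] theorem signMap_vec (x : Kˣ) (p : Node) :
    signMap x (vec K [p]) = (if p.1 then 1 + (x : K) else 0) • vec K [p] := by
  simp [signMap]

theorem hom_ext_vec {M : Type*} [AddCommGroup M] [Module K M] {f g : (List Node →₀ K) →ₗ[K] M}
    (h : ∀ t, f (vec K t) = g (vec K t)) : f = g := by
  ext t
  simpa using h t

theorem tailMap_consMap (f : Module.End K (List Node →₀ K)) (p : Node) (v : List Node →₀ K) :
    tailMap f (consMap K p v) = consMap K p (f v) := by
  have : (tailMap f) ∘ₗ consMap K p = consMap K p ∘ₗ f := hom_ext_vec fun t => by simp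
  exact LinearMap.congr_fun this v

theorem topMap_consMap_consMap (x : Kˣ) (p q : Node) (v : List Node →₀ K) :
    topMap x (consMap K p (consMap K q v)) =
      diagCoeff x q p • consMap K p (consMap K q v) +
        swapCoeff x q p • consMap K q (consMap K p v) := by
  have : (topMap x) ∘ₗ consMap K p ∘ₗ consMap K q = diagCoeff x q p • consMap K p ∘ₗ consMap K q +
      swapCoeff x q p • consMap K q ∘ₗ consMap K p := hom_ext_vec fun t => by simp
  exact LinearMap.congr_fun this v

theorem tailMap_zero : tailMap (0 : Module.End K (List Node →₀ K)) = 0 := by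
  refine hom_ext_vec fun t => ?_
  rcases t with _ | ⟨p, t⟩ <;> simp [tailMap]

/-- The operators of the seminormal representation on lists of length `n`. -/
noncomputable def seminormal (x : Kˣ) : ℕ → ℕ → Module.End K (List Node →₀ K)
  | 0, _ => 0
  | n + 1, i => if i = n then (if n = 0 then signMap x else topMap x) else tailMap (seminormal x n i)

theorem seminormal_one_zero (x : Kˣ) : seminormal x 1 0 = signMap x := by simp [seminormal]

theorem seminormal_top (x : Kˣ) (n : ℕ) : seminormal x (n + 2) (n + 1) = topMap x := by
  simp [seminormal]

theorem seminormal_of_ne (x : Kˣ) {n i : ℕ} (h : i ≠ n) :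
    seminormal x (n + 1) i = tailMap (seminormal x n i) := by
  simp [seminormal, h]

theorem seminormal_eq_zero (x : Kˣ) {n i : ℕ} (h : n ≤ i) : seminormal x n i = 0 := by
  induction n with
  | zero => rfl
  | succ n ih => rw [seminormal_of_ne x (by omega), ih (by omega), tailMap_zero]

/-- The standard lists of length `n` and of given shape. -/
def stdLists (n : ℕ) (m : Node → Bool) : Set (List Node) :=
  {t | IsStd t ∧ t.length = n ∧ shape t = m}

/-- The endomorphism preserves the spans of the standard lists of each shape. -/
def PreservesStd (n : ℕ) (f : Module.End K (List Node →₀ K)) : Prop :=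
  ∀ m, ∀ v ∈ Finsupp.supported K K (stdLists n m), f v ∈ Finsupp.supported K K (stdLists n m)

theorem vec_mem_supported {s : Set (List Node)} {t : List Node} (h : t ∈ s) :
    vec K t ∈ Finsupp.supported K K s := Finsupp.single_mem_supported K 1 h

theorem map_mem_supported {f : (List Node →₀ K) →ₗ[K] (List Node →₀ K)} {s s' : Set (List Node)}
    (h : ∀ t ∈ s, f (vec K t) ∈ Finsupp.supported K K s') {v : List Node →₀ K}
    (hv : v ∈ Finsupp.supported K K s) : f v ∈ Finsupp.supported K K s' := by
  rw [Finsupp.supported_eq_span_single] at hv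
  induction hv using Submodule.span_induction with
  | mem v hv =>
    obtain ⟨t, ht, rfl⟩ := hv
    exact h t ht
  | zero => simp
  | add a b _ _ ha hb => rw [map_add]; exact add_mem ha hb
  | smul c a _ ha => rw [map_smul]; exact Submodule.smul_mem _ _ ha

theorem preservesStd_of_vec {n : ℕ} {f : Module.End K (List Node →₀ K)}
    (h : ∀ m, ∀ t ∈ stdLists n m, f (vec K t) ∈ Finsupp.supported K K (stdLists n m)) :
    PreservesStd n f := fun m _ hv => map_mem_supported (h m) hv

theorem PreservesStd.tailMap {n : ℕ} {f : Module.End K (List Node →₀ K)} (h : PreservesStd n f) :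
    PreservesStd (n + 1) (tailMap f) := by
  refine preservesStd_of_vec fun m t ht => ?_
  obtain ⟨h1, h2, rfl⟩ := ht
  rcases t with _ | ⟨p, t⟩
  · simp at h2
  rw [tailMap_vec_cons]
  refine map_mem_supported (s := stdLists n (shape t)) ?_
    (h _ _ (vec_mem_supported ⟨h1.1, by simpa using h2, rfl⟩))
  rintro u ⟨hu, hl, hs⟩
  rw [consMap_vec]
  refine vec_mem_supported ⟨⟨hu, by rw [hs]; exact h1.2⟩, by simp [hl], ?_⟩
  change addNode (shape u) p = addNode (shape t) p
  rw [hs]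

/-- Exchanging the last two boxes can destroy standardness only for adjacent nodes, where the swap
coefficient is 0 by definition. -/
theorem preservesStd_topMap (x : Kˣ) (n : ℕ) : PreservesStd n (topMap x) := by
  refine preservesStd_of_vec fun m t ht => ?_
  rcases t with _ | ⟨p, _ | ⟨q, t⟩⟩
  · simp [topMap]
  · simp [topMap]
  rw [topMap_vec]
  refine add_mem (Submodule.smul_mem _ _ (vec_mem_supported ht)) ?_
  by_cases h : Adjacent q p
  · simp [swapCoeff, h]
  · obtain ⟨h1, h2, h3⟩ := ht
    obtain ⟨h4, h5⟩ := h1.swap (far_of_not_adjacent h).symm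
    exact Submodule.smul_mem _ _ (vec_mem_supported ⟨h4, by simpa using h2, h5.trans h3⟩)

theorem preservesStd_seminormal (x : Kˣ) (n i : ℕ) : PreservesStd n (seminormal x n i) := by
  induction n with
  | zero => intro m v _; simp [seminormal]
  | succ n ih =>
    rcases eq_or_ne i n with rfl | h
    · rcases i with _ | n
      · rw [seminormal_one_zero]
        refine preservesStd_of_vec fun m t ht => ?_
        rcases t with _ | ⟨p, _ | ⟨q, t⟩⟩
        · simp [signMap]
        · rw [signMap_vec]
          exact Submodule.smul_mem _ _ (vec_mem_supported ht)
        · simp [signMap]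
      · rw [seminormal_top]
        exact preservesStd_topMap x _
    · rw [seminormal_of_ne x h]
      exact ih.tailMap

theorem IsStd.separated {x : Kˣ} {n : ℕ} (hx : QUnits x n) {t : List Node} (ht : IsStd t)
    (hn : t.length ≤ n + 1) {p q : Node} (hp : p ∈ t) (hq : q ∈ t) (hne : p ≠ q) :
    Separated x p q := by
  intro e
  refine hx.isUnit (fun h => hne (Prod.ext e (by omega))) ?_
  have := ht.abs_sub_lt_length hp hq e
  omega

/-- Two endomorphisms agree on the standard lists of length `n`. -/
def EqOnStd (n : ℕ) (f g : Module.End K (List Node →₀ K)) : Prop :=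
  ∀ t, IsStd t → t.length = n → f (vec K t) = g (vec K t)

theorem EqOnStd.tailMap {n : ℕ} {f g : Module.End K (List Node →₀ K)} (h : EqOnStd n f g) :
    EqOnStd (n + 1) (tailMap f) (tailMap g) := by
  rintro (_ | ⟨p, t⟩) h1 h2
  · simp at h2
  · rw [tailMap_vec_cons, tailMap_vec_cons, h t h1.1 (by simpa using h2)]

theorem eqOnStd_of_cons {n : ℕ} {f g : Module.End K (List Node →₀ K)}
    (h : ∀ p t, IsStd (p :: t) → t.length = n → f (vec K (p :: t)) = g (vec K (p :: t))) :
    EqOnStd (n + 1) f g := by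
  rintro (_ | ⟨p, t⟩) h1 h2
  · simp at h2
  · exact h p t h1 (by simpa using h2)

theorem tailMap_mul (f g : Module.End K (List Node →₀ K)) :
    tailMap (f * g) = tailMap f * tailMap g := by
  refine hom_ext_vec fun t => ?_
  rcases t with _ | ⟨p, t⟩
  · simp [tailMap]
  · simp [tailMap_consMap]

theorem tailMap_add (f g : Module.End K (List Node →₀ K)) :
    tailMap (f + g) = tailMap f + tailMap g := by
  refine hom_ext_vec fun t => ?_
  rcases t with _ | ⟨p, t⟩
  · simp [tailMap]
  · simp

theorem tailMap_smul (c : K) (f : Module.End K (List Node →₀ K)) :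
    tailMap (c • f) = c • tailMap f := by
  refine hom_ext_vec fun t => ?_
  rcases t with _ | ⟨p, t⟩
  · simp [tailMap]
  · simp

/-! ### The Hecke relations on standard lists. -/

theorem topMap_sq {x : Kˣ} {p q : Node} {t : List Node} (hne : p ≠ q) (h : Separated x q p) :
    topMap x (topMap x (vec K (p :: q :: t))) =
      ((x : K) - 1) • topMap x (vec K (p :: q :: t)) + (x : K) • vec K (p :: q :: t) := by
  have h1 := diagCoeff_add_swap h
  have h2 := swapCoeff_mul_swap hne.symm h
  simp only [topMap_vec, map_add, map_smul]
  generalize vec K (p :: q :: t) = u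
  generalize vec K (q :: p :: t) = v
  match_scalars
  · linear_combination h2
  · linear_combination swapCoeff x q p * h1

/-- Both sides are expanded in the six orderings of the three nodes. Trace, determinant and
`diagCoeff_triple` match the coefficients; three of them agree identically. -/
theorem topMap_braid {x : Kˣ} {p q r : Node} {t : List Node} (hpq : p ≠ q) (hqr : q ≠ r)
    (h1 : Separated x r q) (h2 : Separated x q p) (h3 : Separated x r p) :
    topMap x (tailMap (topMap x) (topMap x (vec K (p :: q :: r :: t)))) =
      tailMap (topMap x) (topMap x (tailMap (topMap x) (vec K (p :: q :: r :: t)))) := by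
  have a1 := diagCoeff_add_swap h1
  have a2 := diagCoeff_add_swap h2
  have b1 := swapCoeff_mul_swap hqr.symm h1
  have b2 := swapCoeff_mul_swap hpq.symm h2
  have c := diagCoeff_triple h1 h2 h3
  simp only [topMap_vec, tailMap_vec_cons, consMap_vec, map_add, map_smul]
  generalize vec K (p :: q :: r :: t) = v1
  generalize vec K (q :: p :: r :: t) = v2
  generalize vec K (p :: r :: q :: t) = v3
  generalize vec K (q :: r :: p :: t) = v4
  generalize vec K (r :: p :: q :: t) = v5
  generalize vec K (r :: q :: p :: t) = v6
  rw [show diagCoeff x q r = (x : K) - 1 - diagCoeff x r q by linear_combination a1] at *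
  rw [show diagCoeff x p q = (x : K) - 1 - diagCoeff x q p by linear_combination a2] at *
  generalize diagCoeff x r q = A at *
  generalize diagCoeff x q p = B at *
  generalize diagCoeff x r p = C at *
  generalize swapCoeff x r q = s1 at *
  generalize swapCoeff x q r = s1' at *
  generalize swapCoeff x q p = s2 at *
  generalize swapCoeff x p q = s2' at *
  generalize swapCoeff x r p = s3 at *
  match_scalars
  · linear_combination C * b2 - C * b1 + (B - A) * c
  · linear_combination s2 * c
  · linear_combination (-s1) * c
  · ring
  · ring
  · ring

theorem seminormal_sq_zero (x : Kˣ) {n : ℕ} (hn : 0 < n) :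
    EqOnStd n (seminormal x n 0 * seminormal x n 0) ((1 + (x : K)) • seminormal x n 0) := by
  induction n with
  | zero => omega
  | succ n ih =>
    rcases Nat.eq_zero_or_pos n with rfl | h
    · rw [seminormal_one_zero]
      refine eqOnStd_of_cons fun p t _ h => ?_
      obtain rfl : t = [] := List.length_eq_zero_iff.1 h
      simp only [Module.End.mul_apply, LinearMap.smul_apply, signMap_vec, map_smul]
      split_ifs <;> simp
    · rw [seminormal_of_ne x h.ne, ← tailMap_mul, ← tailMap_smul]
      exact (ih h).tailMap

theorem seminormal_sq_succ {x : Kˣ} {n : ℕ} (hx : QUnits x n) (i : ℕ) (hi : i + 1 < n) :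
    EqOnStd n (seminormal x n (i + 1) * seminormal x n (i + 1))
      (((x : K) - 1) • seminormal x n (i + 1) + (x : K) • 1) := by
  induction n with
  | zero => omega
  | succ n ih =>
    rcases eq_or_ne n (i + 1) with rfl | h
    · rw [seminormal_top]
      refine eqOnStd_of_cons fun p t h h' => ?_
      rcases t with _ | ⟨q, t⟩
      · simp at h'
      simp only [Module.End.mul_apply, LinearMap.smul_apply, LinearMap.add_apply,
        Module.End.one_apply]
      exact topMap_sq h.ne_of_cons_cons
        (h.separated hx (by simp only [List.length_cons] at *; omega) (by simp) (by simp)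
          h.ne_of_cons_cons.symm)
    · rw [seminormal_of_ne x h.symm, ← tailMap_mul]
      intro t h1 h2
      rw [(ih (hx.mono (by omega)) (by omega)).tailMap t h1 h2, tailMap_add, tailMap_smul,
        tailMap_smul]
      rcases t with _ | ⟨p, t⟩
      · simp at h2
      · simp

/-- If both boxes lie in one component, T_0 acts by the same scalar before and after the swap.
Otherwise T_0 is a multiple of the projection onto the ordering whose first box lies in component
`true`; the diagonal entry of T_1 there is 0, so both sides vanish. -/
theorem seminormal_braid_zero (x : Kˣ) {n : ℕ} (hn : 1 < n) :
    EqOnStd n (seminormal x n 0 * seminormal x n 1 * seminormal x n 0 * seminormal x n 1)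
      (seminormal x n 1 * seminormal x n 0 * seminormal x n 1 * seminormal x n 0) := by
  induction n with
  | zero => omega
  | succ n ih =>
    rcases eq_or_ne n 1 with rfl | h
    · rw [seminormal_top, seminormal_of_ne x zero_ne_one, seminormal_one_zero]
      refine eqOnStd_of_cons fun p t h h' => ?_
      obtain ⟨q, rfl⟩ := List.length_eq_one_iff.1 h'
      simp only [Module.End.mul_apply, topMap_vec, tailMap_vec_cons, signMap_vec, map_smul,
        map_add, consMap_vec]
      rcases p with ⟨_ | _, c⟩ <;> rcases q with ⟨_ | _, d⟩
      · simp
      · simp [diagCoeff]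
      · simp [diagCoeff]
      · simp only [if_true]
        match_scalars <;> ring
    · rw [seminormal_of_ne x (by omega), seminormal_of_ne x (by omega)]
      simp only [← tailMap_mul]
      exact (ih (by omega)).tailMap

theorem seminormal_braid_succ {x : Kˣ} {n : ℕ} (hx : QUnits x n) (i : ℕ) (hi : i + 2 < n) :
    EqOnStd n (seminormal x n (i + 1) * seminormal x n (i + 2) * seminormal x n (i + 1))
      (seminormal x n (i + 2) * seminormal x n (i + 1) * seminormal x n (i + 2)) := by
  induction n with
  | zero => omega
  | succ n ih =>
    rcases eq_or_ne n (i + 2) with rfl | h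
    · rw [seminormal_top, seminormal_of_ne x (by omega), seminormal_top]
      refine eqOnStd_of_cons fun p t h h' => ?_
      rcases t with _ | ⟨q, _ | ⟨r, t⟩⟩
      · simp at h'
      · simp at h'
      have sep : ∀ {u v : Node}, u ∈ p :: q :: r :: t → v ∈ p :: q :: r :: t → u ≠ v →
          Separated x u v := fun hu hv hne =>
        h.separated hx (by simp only [List.length_cons] at *; omega) hu hv hne
      exact (topMap_braid h.ne_of_cons_cons h.1.ne_of_cons_cons
        (sep (by simp) (by simp) h.1.ne_of_cons_cons.symm)
        (sep (by simp) (by simp) h.ne_of_cons_cons.symm)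
        (sep (by simp) (by simp) h.ne_of_cons_cons_cons.symm)).symm
    · rw [seminormal_of_ne x (by omega), seminormal_of_ne x (by omega)]
      simp only [← tailMap_mul]
      exact (ih (hx.mono (by omega)) (by omega)).tailMap

theorem seminormal_comm (x : Kˣ) {n : ℕ} (i j : ℕ) (hij : i + 1 < j) (hj : j < n) :
    EqOnStd n (seminormal x n i * seminormal x n j) (seminormal x n j * seminormal x n i) := by
  induction n with
  | zero => omega
  | succ n ih =>
    rcases eq_or_ne j n with rfl | h
    · obtain ⟨j, rfl⟩ : ∃ j', j = j' + 2 := ⟨j - 2, by omega⟩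
      rw [seminormal_top, seminormal_of_ne x (by omega), seminormal_of_ne x (by omega)]
      refine eqOnStd_of_cons fun p t h h' => ?_
      rcases t with _ | ⟨q, t⟩
      · simp at h'
      simp only [Module.End.mul_apply, topMap_vec, tailMap_vec_cons, map_smul, map_add,
        topMap_consMap_consMap]
    · rw [seminormal_of_ne x (by omega), seminormal_of_ne x (by omega)]
      simp only [← tailMap_mul]
      exact (ih (by omega)).tailMap

end Seminormal

/-! ### Matrix units in the image of the seminormal representation -/

section MatrixUnits

variable {K : Type*} [CommRing K]

/-- The algebra generated by the operators of the seminormal representation. -/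
noncomputable def seminormalAlgebra (x : Kˣ) (n : ℕ) : Subalgebra K (Module.End K (List Node →₀ K)) :=
  Algebra.adjoin K (Set.range (seminormal x n))

theorem seminormal_mem (x : Kˣ) (n i : ℕ) : seminormal x n i ∈ seminormalAlgebra x n :=
  Algebra.subset_adjoin ⟨i, rfl⟩

theorem seminormalAlgebra_sub_mem {x : Kˣ} {n : ℕ} {f g : Module.End K (List Node →₀ K)}
    (hf : f ∈ seminormalAlgebra x n) (hg : g ∈ seminormalAlgebra x n) :
    f - g ∈ seminormalAlgebra x n := by
  have h : f - g = f + (-1 : K) • g := LinearMap.ext fun v => by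
    rw [LinearMap.sub_apply, LinearMap.add_apply, LinearMap.smul_apply, neg_one_smul,
      sub_eq_add_neg]
  rw [h]
  exact add_mem hf (Subalgebra.smul_mem _ hg _)

theorem exists_lift_seminormalAlgebra (x : Kˣ) {n : ℕ} {f : Module.End K (List Node →₀ K)}
    (hf : f ∈ seminormalAlgebra x n) :
    ∃ g ∈ seminormalAlgebra x (n + 1), ∀ p v, g (consMap K p v) = consMap K p (f v) := by
  induction hf using Algebra.adjoin_induction with
  | mem f hf =>
    obtain ⟨i, rfl⟩ := hf
    rcases eq_or_ne i n with rfl | h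
    -- The generator of index n is 0 on length n but becomes the last generator on length n + 1, so
    -- it is lifted to 0.
    · exact ⟨0, zero_mem _, fun p v => by simp [seminormal_eq_zero x le_rfl]⟩
    · refine ⟨_, seminormal_mem x (n + 1) i, fun p v => ?_⟩
      rw [seminormal_of_ne x h, tailMap_consMap]
  | algebraMap r =>
    exact ⟨algebraMap K _ r, algebraMap_mem _ r, fun p v => by simp [Module.algebraMap_end_apply]⟩
  | add a b _ _ ha hb =>
    obtain ⟨a', ha', ha⟩ := ha
    obtain ⟨b', hb', hb⟩ := hb
    exact ⟨a' + b', add_mem ha' hb', fun p v => by simp [ha, hb]⟩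
  | mul a b _ _ ha hb =>
    obtain ⟨a', ha', ha⟩ := ha
    obtain ⟨b', hb', hb⟩ := hb
    exact ⟨a' * b', mul_mem ha' hb', fun p v => by simp [ha, hb]⟩

open Classical in
/-- The algebra of the seminormal representation contains an element which acts on the standard
lists as the matrix unit that maps `s'` to `s`. -/
def HasMatrixUnit (x : Kˣ) (n : ℕ) (s s' : List Node) : Prop :=
  ∃ f ∈ seminormalAlgebra x n, ∀ t, IsStd t → t.length = n →
    f (vec K t) = if t = s' then vec K s else 0

theorem HasMatrixUnit.trans {x : Kˣ} {n : ℕ} {s s' s'' : List Node} (h : HasMatrixUnit x n s s')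
    (h' : HasMatrixUnit x n s' s'') (hs : IsStd s') (hl : s'.length = n) :
    HasMatrixUnit x n s s'' := by
  obtain ⟨f, hf, hf'⟩ := h
  obtain ⟨g, hg, hg'⟩ := h'
  refine ⟨f * g, mul_mem hf hg, fun t h1 h2 => ?_⟩
  rw [Module.End.mul_apply, hg' t h1 h2]
  split_ifs with h3
  · rw [hf' s' hs hl, if_pos rfl]
  · simp

open Classical in
theorem HasMatrixUnit.exists_tail {x : Kˣ} {n : ℕ} {s s' : List Node}
    (h : HasMatrixUnit x n s s') :
    ∃ f ∈ seminormalAlgebra x (n + 1), ∀ p t, IsStd t → t.length = n →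
      f (vec K (p :: t)) = if t = s' then vec K (p :: s) else 0 := by
  obtain ⟨f, hf, hf'⟩ := h
  obtain ⟨g, hg, hg'⟩ := exists_lift_seminormalAlgebra x hf
  refine ⟨g, hg, fun p t h1 h2 => ?_⟩
  rw [← consMap_vec, hg', hf' t h1 h2]
  split_ifs
  · rw [consMap_vec]
  · simp

theorem finite_addable {s : List Node} (hs : IsStd s) : {p | Addable (shape s) p}.Finite := by
  refine ((Set.finite_univ (α := Bool)).prod
    (Set.finite_Icc (-(s.length : ℤ)) s.length)).subset ?_
  intro p hp
  have h : IsStd (p :: s) := ⟨hs, hp⟩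
  have := h.abs_lt_length (p := p) (by simp)
  rw [abs_lt] at this
  simp only [List.length_cons, Nat.cast_add, Nat.cast_one] at this
  exact ⟨trivial, by rw [Set.mem_Icc]; omega⟩

open Classical in
/-- The last generator separates the nodes which can be added. -/
theorem hasMatrixUnit_cons_of_isUnit {x : Kˣ} {n : ℕ} {q p : Node} {u : List Node}
    (hs : IsStd (q :: u)) (hn : (q :: u).length = n) (hp : Addable (shape (q :: u)) p)
    (hJ : HasMatrixUnit x n (q :: u) (q :: u))
    (hunit : ∀ r, Addable (shape (q :: u)) r → r ≠ p →
      IsUnit (diagCoeff x q p - diagCoeff x q r)) :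
    HasMatrixUnit x (n + 1) (p :: q :: u) (p :: q :: u) := by
  obtain ⟨J, hJ, hJ'⟩ := hJ.exists_tail
  have hτ : topMap x ∈ seminormalAlgebra x (n + 1) := by
    rw [← hn, List.length_cons, ← seminormal_top]
    exact seminormal_mem _ _ _
  -- `J` projects onto the lists with tail `q :: u`. The swapped list has another tail and is
  -- killed, so the compression of the last generator is diagonal.
  have hG : ∀ r, Addable (shape (q :: u)) r →
      J (topMap x (J (vec K (r :: q :: u)))) = diagCoeff x q r • vec K (r :: q :: u) := by
    intro r hr
    rw [hJ' r _ hs hn, if_pos rfl, topMap_vec, map_add, map_smul, map_smul, hJ' r _ hs hn,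
      if_pos rfl]
    by_cases h : Adjacent q r
    · simp [swapCoeff, h]
    · have h1 : IsStd (r :: q :: u) := ⟨hs, hr⟩
      have h2 := h1.swap (far_of_not_adjacent h).symm
      rw [hJ' q _ h2.1.1 (by simpa using hn), if_neg, smul_zero, add_zero]
      intro h3
      exact h1.ne_of_cons_cons (by simpa using h3)
  -- Lagrange interpolation in this diagonal operator: each factor kills one `r` and is normalized
  -- to 1 at `p`.
  have key : ∀ B : Finset Node, (∀ r ∈ B, Addable (shape (q :: u)) r ∧ r ≠ p) →
      ∃ f ∈ seminormalAlgebra x (n + 1), ∃ φ : Node → K, φ p = 1 ∧ (∀ r ∈ B, φ r = 0) ∧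
        ∀ r t, IsStd (r :: t) → t.length = n →
          f (vec K (r :: t)) = if t = q :: u then φ r • vec K (r :: t) else 0 := by
    intro B
    induction B using Finset.induction_on with
    | empty =>
      intro _
      refine ⟨J, hJ, fun _ => 1, rfl, by simp, fun r t h1 h2 => ?_⟩
      rw [hJ' r t h1.1 h2]
      split_ifs with h3
      · rw [one_smul, h3]
      · rfl
    | insert r B hr ih =>
      intro hB
      obtain ⟨f, hf, φ, hφ, hφ', hf'⟩ := ih fun r hr => hB r (Finset.mem_insert_of_mem hr)
      obtain ⟨c, hc⟩ := hunit r (hB r (by simp)).1 (hB r (by simp)).2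
      refine ⟨f * ((↑c⁻¹ : K) • (J * topMap x * J - diagCoeff x q r • J)),
        mul_mem hf (Subalgebra.smul_mem _ (seminormalAlgebra_sub_mem (mul_mem (mul_mem hJ hτ) hJ)
          (Subalgebra.smul_mem _ hJ _)) _),
        fun r' => φ r' * (↑c⁻¹ * (diagCoeff x q r' - diagCoeff x q r)), ?_, ?_, ?_⟩
      · simp only [hφ, ← hc, one_mul, Units.inv_mul]
      · intro r' hr'
        rcases Finset.mem_insert.1 hr' with rfl | hr'
        · simp
        · simp [hφ' r' hr']
      · intro r' t h1 h2
        simp only [Module.End.mul_apply, LinearMap.smul_apply, LinearMap.sub_apply]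
        split_ifs with h3
        · subst h3
          rw [hG r' h1.2, hJ' r' _ hs hn, if_pos rfl, ← sub_smul, smul_smul, map_smul,
            hf' r' _ h1 h2, if_pos rfl, smul_smul, mul_comm]
        · rw [hJ' r' t h1.1 h2, if_neg h3]
          simp
  obtain ⟨f, hf, φ, hφ, hφ', hf'⟩ := key ((finite_addable hs).toFinset.erase p)
    fun r hr => by rwa [Finset.mem_erase, Set.Finite.mem_toFinset, and_comm] at hr
  refine ⟨f, hf, fun t h1 h2 => ?_⟩
  rcases t with _ | ⟨r, t⟩
  · simp at h2
  rw [hf' r t h1 (by simpa using h2)]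
  by_cases h3 : t = q :: u
  · subst h3
    rw [if_pos rfl]
    by_cases h4 : r = p
    · subst h4
      rw [if_pos rfl, hφ, one_smul]
    · rw [if_neg (by simpa using h4), hφ' r (by simp [h4, h1.2]), zero_smul]
  · rw [if_neg h3, if_neg (by simp [h3])]

/-- Every shape which admits the addition of the node `p` is the shape of a standard list whose
head allows to separate `p` from the other addable nodes. -/
theorem exists_separating {x : Kˣ} {n : ℕ} (hx : QUnits x (n + 1)) {s : List Node} (hs : IsStd s)
    (hn : s.length = n) (h0 : 0 < n) {p : Node} (hp : Addable (shape s) p) :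
    ∃ q u, IsStd (q :: u) ∧ (q :: u).length = n ∧ shape (q :: u) = shape s ∧
      ∀ r, Addable (shape (q :: u)) r → r ≠ p →
        IsUnit (diagCoeff x q p - diagCoeff x q r) := by
  have main : ∀ q u, IsStd (q :: u) → (q :: u).length = n → shape (q :: u) = shape s →
      ∀ r, Addable (shape (q :: u)) r → r ≠ p → (q.1 = p.1 ∨ q.1 = r.1) →
        IsUnit (diagCoeff x q p - diagCoeff x q r) := by
    intro q u h1 h2 h3 r hr hne hor
    have hp' : Addable (shape (q :: u)) p := by rw [h3]; exact hp
    have hf := hr.far hp' hne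
    have s1 : IsStd (p :: q :: u) := ⟨h1, hp'⟩
    have s2 : IsStd (r :: q :: u) := ⟨h1, hr⟩
    have s3 : IsStd (r :: p :: q :: u) := ⟨s1, (hf.symm.addable_addNode _).2 hr⟩
    refine isUnit_diagCoeff_sub ?_ ?_ ?_ hor
    · exact s1.separated hx (by simp at *; omega) (by simp) (by simp) s1.ne_of_cons_cons.symm
    · exact s2.separated hx (by simp at *; omega) (by simp) (by simp) s2.ne_of_cons_cons.symm
    · exact s3.separated hx (by simp at *; omega) (by simp) (by simp) hne.symm
  -- A head outside the component of `p` cannot separate two addable nodes of that component, so the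
  -- head is taken in it whenever it contains a box.
  by_cases h : ∃ q ∈ s, q.1 = p.1
  · obtain ⟨q, hq, e⟩ := h
    obtain ⟨r, hr, hrem⟩ := hs.exists_removable hq
    obtain ⟨u, h1, h2, h3⟩ := hs.exists_cons_of_removable hrem
    exact ⟨r, u, h1, h3.trans hn, h2, fun r' h4 h5 =>
      main r u h1 (h3.trans hn) h2 r' h4 h5 (Or.inl (hr.trans e))⟩
  -- Now the component of `p` is empty and `p` is its only addable node; every competitor `r` lies
  -- in the component of the head.
  · push Not at h
    rcases s with _ | ⟨q, u⟩
    · simp at hn; omega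
    refine ⟨q, u, hs, hn, rfl, fun r hr hne => main q u hs hn rfl r hr hne (Or.inr ?_)⟩
    by_contra e
    have h1 : q.1 ≠ p.1 := h q (by simp)
    have h2 : r.1 = p.1 := by
      revert e h1
      generalize q.1 = a
      generalize r.1 = b
      generalize p.1 = c
      revert a b c
      decide
    refine hne (Prod.ext h2 ?_)
    rw [eq_zero_of_addable hp h, eq_zero_of_addable hr (by rw [h2]; exact h)]

-- T_0/(1+x) and its complement are the idempotents of the two one-box shapes; this is where 1 + x
-- is inverted.
open Classical in
theorem hasMatrixUnit_one {x : Kˣ} (hx : IsUnit (1 + (x : K))) {s s' : List Node} (hs : IsStd s)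
    (hl : s.length = 1) (hs' : IsStd s') (hl' : s'.length = 1) (h : shape s = shape s') :
    HasMatrixUnit x 1 s s' := by
  obtain ⟨⟨ε, c⟩, rfl⟩ := List.length_eq_one_iff.1 hl
  obtain ⟨⟨ε', c'⟩, rfl⟩ := List.length_eq_one_iff.1 hl'
  obtain rfl : c = 0 := addable_emptyShape_iff.1 hs.2
  obtain rfl : c' = 0 := addable_emptyShape_iff.1 hs'.2
  obtain rfl : ε = ε' := by
    by_contra e
    have h1 := congrFun h (ε, 0)
    simp [shape, addNode, emptyShape, e] at h1
  obtain ⟨c, hc⟩ := hx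
  have hm : signMap x ∈ seminormalAlgebra x 1 := by
    rw [← seminormal_one_zero]; exact seminormal_mem _ _ _
  rcases ε with _ | _
  · refine ⟨1 - (↑c⁻¹ : K) • signMap x, seminormalAlgebra_sub_mem (one_mem _) (Subalgebra.smul_mem _ hm _),
      fun t h1 h2 => ?_⟩
    obtain ⟨⟨ε, d⟩, rfl⟩ := List.length_eq_one_iff.1 h2
    obtain rfl : d = 0 := addable_emptyShape_iff.1 h1.2
    rw [LinearMap.sub_apply, LinearMap.smul_apply, signMap_vec, ← hc, smul_smul]
    rcases ε with _ | _ <;> simp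
  · refine ⟨(↑c⁻¹ : K) • signMap x, Subalgebra.smul_mem _ hm _, fun t h1 h2 => ?_⟩
    obtain ⟨⟨ε, d⟩, rfl⟩ := List.length_eq_one_iff.1 h2
    obtain rfl : d = 0 := addable_emptyShape_iff.1 h1.2
    rw [LinearMap.smul_apply, signMap_vec, ← hc, smul_smul]
    rcases ε with _ | _ <;> simp

-- Between the two diagonal matrix units the last generator leaves only its off-diagonal entry, an
-- invertible swap coefficient.
open Classical in
theorem hasMatrixUnit_cons_cons {x : Kˣ} {n : ℕ} (hx : QUnits x (n + 1)) {p q : Node}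
    {u : List Node} (hs : IsStd (p :: q :: u)) (hn : (p :: q :: u).length = n + 1) (hf : Far p q)
    (h1 : HasMatrixUnit x (n + 1) (p :: q :: u) (p :: q :: u))
    (h2 : HasMatrixUnit x (n + 1) (q :: p :: u) (q :: p :: u)) :
    HasMatrixUnit x (n + 1) (q :: p :: u) (p :: q :: u) := by
  obtain ⟨f, hf1, hf'⟩ := h1
  obtain ⟨g, hg, hg'⟩ := h2
  have hτ : topMap x ∈ seminormalAlgebra x (n + 1) := by
    rw [← hn, List.length_cons, List.length_cons, ← seminormal_top]
    exact seminormal_mem _ _ _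
  obtain ⟨c, hc⟩ := isUnit_swapCoeff hx hf.symm.not_adjacent fun e => by
    have := hs.abs_sub_lt_length (p := q) (q := p) (by simp) (by simp) e
    rw [hn] at this
    push_cast at this
    omega
  refine ⟨(↑c⁻¹ : K) • (g * topMap x * f),
    Subalgebra.smul_mem _ (mul_mem (mul_mem hg hτ) hf1) _, fun t h3 h4 => ?_⟩
  rw [LinearMap.smul_apply, Module.End.mul_apply, Module.End.mul_apply, hf' t h3 h4]
  split_ifs with h5
  · rw [topMap_vec, map_add, map_smul, map_smul, hg' _ hs hn,
      hg' _ (hs.swap hf).1 (by simpa using hn), if_pos rfl, if_neg, smul_zero, zero_add, smul_smul,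
      ← hc, Units.inv_mul, one_smul]
    intro h6
    exact hf.1 (by simpa using congrArg List.head? h6)
  · simp

/-- Induction on n. Matrix units of the tails carry a given tail to one whose head separates the
node to be added, and back, which gives the diagonal units. Lists with equal heads are then
connected through their tails. -/
theorem hasMatrixUnit {x : Kˣ} {n : ℕ} (hx : QUnits x n) (hy : IsUnit (1 + (x : K)))
    {s s' : List Node} (hs : IsStd s) (hl : s.length = n) (hs' : IsStd s') (hl' : s'.length = n)
    (h : shape s = shape s') : HasMatrixUnit x n s s' := by
  induction n generalizing s s' with
  | zero =>
    rw [List.length_eq_zero_iff] at hl hl'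
    subst hl hl'
    refine ⟨1, one_mem _, fun t _ ht => ?_⟩
    rw [List.length_eq_zero_iff] at ht
    simp [ht]
  | succ n ih =>
    rcases Nat.eq_zero_or_pos n with rfl | h0
    · exact hasMatrixUnit_one hy hs hl hs' hl' h
    replace ih := @ih (hx.mono (by omega))
    have diag : ∀ {p s}, IsStd (p :: s) → s.length = n →
        HasMatrixUnit x (n + 1) (p :: s) (p :: s) := by
      classical
      intro p s h1 h2
      obtain ⟨q, u, h3, h4, h5, h6⟩ := exists_separating hx h1.1 h2 h0 h1.2
      obtain ⟨f, hf, hf'⟩ := hasMatrixUnit_cons_of_isUnit h3 h4 (by rw [h5]; exact h1.2)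
        (ih h3 h4 h3 h4 rfl) h6
      obtain ⟨a, ha, ha'⟩ := (ih h1.1 h2 h3 h4 h5.symm).exists_tail
      obtain ⟨b, hb, hb'⟩ := (ih h3 h4 h1.1 h2 h5).exists_tail
      refine ⟨a * f * b, mul_mem (mul_mem ha hf) hb, fun t h7 h8 => ?_⟩
      rcases t with _ | ⟨r, t⟩
      · simp at h8
      rw [Module.End.mul_apply, Module.End.mul_apply, hb' r t h7.1 (by simpa using h8)]
      by_cases e : t = s
      · subst e
        rw [if_pos rfl, hf' (r :: q :: u) ⟨h3, by rw [h5]; exact h7.2⟩ (by simpa using h4)]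
        by_cases e' : r = p
        · subst e'
          rw [if_pos rfl, if_pos rfl, ha' _ _ h3 h4, if_pos rfl]
        · rw [if_neg (by simpa using e'), if_neg (by simpa using e'), map_zero]
      · rw [if_neg e, if_neg (by simp [e]), map_zero, map_zero]
    have head : ∀ {p s s'}, IsStd (p :: s) → s.length = n → IsStd (p :: s') → s'.length = n →
        shape s = shape s' → HasMatrixUnit x (n + 1) (p :: s) (p :: s') := by
      classical
      intro p s s' h1 h2 h3 h4 h5
      obtain ⟨a, ha, ha'⟩ := (ih h1.1 h2 h3.1 h4 h5).exists_tail
      obtain ⟨f, hf, hf'⟩ := diag h3 h4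
      refine ⟨a * f, mul_mem ha hf, fun t h7 h8 => ?_⟩
      rw [Module.End.mul_apply, hf' t h7 h8]
      split_ifs with e
      · rw [ha' p s' h3.1 h4, if_pos rfl]
      · simp
    rcases s with _ | ⟨p, s⟩
    · simp at hl
    rcases s' with _ | ⟨p', s'⟩
    · simp at hl'
    simp only [List.length_cons, Nat.add_right_cancel_iff] at hl hl'
    rcases eq_or_ne p p' with rfl | hne
    · exact head hs hl hs' hl' (addNode_injective hs.2 hs'.2 h)
    -- For different heads, both are removable from the common shape. The path goes through `p :: p'
    -- :: u` and `p' :: p :: u`, which the last generator exchanges.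
    · have hr : Removable (shape (p :: s)) p' := by
        rw [h]; exact Addable.removable_addNode _ _
      have hf : Far p p' := (Addable.removable_addNode (shape s) p).far hr hne
      obtain ⟨u, h1, h2, h3⟩ := hs.1.exists_cons_of_removable ((hf.removable_addNode _).1 hr)
      have h4 : IsStd (p :: p' :: u) := ⟨h1, by rw [h2]; exact hs.2⟩
      obtain ⟨h5, h6⟩ := h4.swap hf
      have h7 : shape (p :: p' :: u) = shape (p :: s) := by
        change addNode (shape (p' :: u)) p = addNode (shape s) p
        rw [h2]
      rw [hl] at h3
      have h8 : (p :: u).length = n := by simpa using h3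
      have t1 := head hs hl h4 h3 h2.symm
      have t2 := hasMatrixUnit_cons_cons hx h5 (by simpa using h8) hf.symm (diag h5 h8) (diag h4 h3)
      have t3 := head h5 h8 hs' hl' (addNode_injective h5.2 hs'.2 ((h6.trans h7).trans h))
      exact (t1.trans t2 h4 (by simpa using h3)).trans t3 h5 (by simpa using h8)

end MatrixUnits

/-! ### Counting pairs of standard bitableaux of the same shape -/

section Counting

/-- The diagram agrees with the empty one outside a bounded set. -/
def IsMaya (m : Node → Bool) : Prop :=
  ∃ L : ℕ, ∀ p : Node, (p.2 < -(L : ℤ) → m p = true) ∧ ((L : ℤ) ≤ p.2 → m p = false)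

theorem isMaya_emptyShape : IsMaya emptyShape :=
  ⟨0, fun p => ⟨fun h => by simpa [emptyShape] using h, fun h => by simpa [emptyShape] using h⟩⟩

theorem IsMaya.of_agree {m m' : Node → Bool} (h : IsMaya m) (p : Node)
    (hm : ∀ r, r ≠ p → r ≠ (p.1, p.2 - 1) → m' r = m r) : IsMaya m' := by
  obtain ⟨L, hL⟩ := h
  refine ⟨L + p.2.natAbs + 2, fun r => ⟨fun h => ?_, fun h => ?_⟩⟩
  · rw [hm r]
    · exact (hL r).1 (by omega)
    · rintro rfl; omega
    · rintro rfl; simp only at h; omega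
  · rw [hm r]
    · exact (hL r).2 (by omega)
    · rintro rfl; omega
    · rintro rfl; simp only at h; omega

theorem IsMaya.add {m : Node → Bool} (h : IsMaya m) (p : Node) : IsMaya (addNode m p) :=
  h.of_agree p fun _ h1 h2 => addNode_of_ne m h1 h2

theorem IsMaya.remove {m : Node → Bool} (h : IsMaya m) (p : Node) : IsMaya (removeNode m p) :=
  h.of_agree p fun _ h1 h2 => removeNode_of_ne m h1 h2

theorem isMaya_shape (t : List Node) : IsMaya (shape t) := by
  induction t with
  | nil => exact isMaya_emptyShape
  | cons p t ih => exact ih.add p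

theorem IsMaya.exists_window {m : Node → Bool} (h : IsMaya m) :
    ∃ L : ℕ, (∀ ε, m (ε, -(L : ℤ) - 1) = true) ∧ (∀ ε, m (ε, (L : ℤ)) = false) ∧
      (∀ p, Addable m p → p ∈ Finset.univ ×ˢ Finset.Icc (-(L : ℤ)) L) ∧
      (∀ p, Removable m p → p ∈ Finset.univ ×ˢ Finset.Icc (-(L : ℤ)) L) := by
  obtain ⟨L, hL⟩ := h
  refine ⟨L, fun ε => (hL _).1 (by simp), fun ε => (hL _).2 (by simp), fun p hp => ?_,
    fun p hp => ?_⟩ <;> simp only [Finset.mem_product, Finset.mem_univ, true_and, Finset.mem_Icc]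
  · constructor
    · by_contra h1
      have := (hL p).1 (by omega)
      rw [hp.2] at this
      exact absurd this (by simp)
    · by_contra h1
      have := (hL (p.1, p.2 - 1)).2 (by simp only; omega)
      rw [hp.1] at this
      exact absurd this (by simp)
  · constructor
    · by_contra h1
      have := (hL (p.1, p.2 - 1)).1 (by simp only; omega)
      rw [hp.1] at this
      exact absurd this (by simp)
    · by_contra h1
      have := (hL p).2 (by omega)
      rw [hp.2] at this
      exact absurd this (by simp)

open Classical in
/-- The finite set of addable nodes. -/
noncomputable def addables (m : Node → Bool) : Finset Node :=
  if h : {p | Addable m p}.Finite then h.toFinset else ∅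

open Classical in
/-- The finite set of removable nodes. -/
noncomputable def removables (m : Node → Bool) : Finset Node :=
  if h : {p | Removable m p}.Finite then h.toFinset else ∅

theorem IsMaya.mem_addables {m : Node → Bool} (h : IsMaya m) {p : Node} :
    p ∈ addables m ↔ Addable m p := by
  obtain ⟨L, _, _, h3, _⟩ := h.exists_window
  have hf : {p | Addable m p}.Finite := (Finset.finite_toSet _).subset h3
  simp [addables, hf]

theorem IsMaya.mem_removables {m : Node → Bool} (h : IsMaya m) {p : Node} :
    p ∈ removables m ↔ Removable m p := by
  obtain ⟨L, _, _, _, h3⟩ := h.exists_window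
  have hf : {p | Removable m p}.Finite := (Finset.finite_toSet _).subset h3
  simp [removables, hf]

theorem sum_Ico_sub_telescope (h : ℤ → ℤ) (a : ℤ) (N : ℕ) :
    ∑ c ∈ Finset.Ico a (a + N), (h (c - 1) - h c) = h (a - 1) - h (a + N - 1) := by
  induction N with
  | zero => simp
  | succ N ih =>
    have : Finset.Ico a (a + (N + 1 : ℕ)) = insert (a + N) (Finset.Ico a (a + N)) := by
      ext c
      simp only [Finset.mem_Ico, Finset.mem_insert]
      push_cast
      omega
    rw [this, Finset.sum_insert (by simp), ih]
    push_cast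
    rw [show a + ((N : ℤ) + 1) - 1 = a + N by ring]
    ring

/-- The indicator of addability minus that of removability at c is the bead count at c - 1 minus
that at c. The sum telescopes to 1 in each of the two components. -/
theorem IsMaya.card_addables {m : Node → Bool} (h : IsMaya m) :
    (addables m).card = (removables m).card + 2 := by
  classical
  obtain ⟨L, h1, h2, h3, h4⟩ := h.exists_window
  have e1 : addables m = (Finset.univ ×ˢ Finset.Icc (-(L : ℤ)) L).filter (Addable m) := by
    ext p
    rw [h.mem_addables, Finset.mem_filter]
    exact ⟨fun h => ⟨h3 p h, h⟩, fun h => h.2⟩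
  have e2 : removables m = (Finset.univ ×ˢ Finset.Icc (-(L : ℤ)) L).filter (Removable m) := by
    ext p
    rw [h.mem_removables, Finset.mem_filter]
    exact ⟨fun h => ⟨h4 p h, h⟩, fun h => h.2⟩
  have e3 : ((addables m).card : ℤ) - (removables m).card = 2 := by
    rw [e1, e2, Finset.card_filter, Finset.card_filter]
    push_cast
    rw [← Finset.sum_sub_distrib, Finset.sum_product]
    have e4 : ∀ ε : Bool, ∑ c ∈ Finset.Icc (-(L : ℤ)) L,
        ((if Addable m (ε, c) then (1 : ℤ) else 0) - if Removable m (ε, c) then 1 else 0) = 1 := by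
      intro ε
      have e5 : ∀ c, ((if Addable m (ε, c) then (1 : ℤ) else 0) -
          if Removable m (ε, c) then 1 else 0) =
          (m (ε, c - 1)).toNat - (m (ε, c)).toNat := by
        intro c
        rcases Bool.eq_false_or_eq_true (m (ε, c - 1)) with h5 | h5 <;>
          rcases Bool.eq_false_or_eq_true (m (ε, c)) with h6 | h6 <;>
          simp [Addable, Removable, h5, h6]
      rw [Finset.sum_congr rfl fun c _ => e5 c]
      have := sum_Ico_sub_telescope (fun c => ((m (ε, c)).toNat : ℤ)) (-L) (2 * L + 1)
      rw [show Finset.Ico (-(L : ℤ)) (-L + (2 * L + 1 : ℕ)) = Finset.Icc (-(L : ℤ)) L by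
        ext c; simp only [Finset.mem_Ico, Finset.mem_Icc]; push_cast; omega] at this
      rw [this, h1, show -(L : ℤ) + (2 * L + 1 : ℕ) - 1 = L by push_cast; ring, h2]
      simp
    rw [Finset.sum_congr rfl fun ε _ => e4 ε]
    simp
  omega

open Classical in
/-- The finite set of standard lists of length `n`. -/
noncomputable def stdFinset : ℕ → Finset (List Node)
  | 0 => {[]}
  | n + 1 => (stdFinset n).biUnion fun t => (addables (shape t)).image fun p => p :: t

theorem mem_stdFinset {n : ℕ} {t : List Node} : t ∈ stdFinset n ↔ IsStd t ∧ t.length = n := by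
  induction n generalizing t with
  | zero =>
    rw [stdFinset, Finset.mem_singleton, List.length_eq_zero_iff]
    exact ⟨fun h => ⟨h ▸ trivial, h⟩, fun h => h.2⟩
  | succ n ih =>
    simp only [stdFinset, Finset.mem_biUnion, Finset.mem_image, (isMaya_shape _).mem_addables]
    constructor
    · rintro ⟨s, hs, p, hp, rfl⟩
      obtain ⟨h1, h2⟩ := ih.1 hs
      exact ⟨⟨h1, hp⟩, by simp [h2]⟩
    · rintro ⟨h1, h2⟩
      rcases t with _ | ⟨p, t⟩
      · simp at h2
      · exact ⟨t, ih.2 ⟨h1.1, by simpa using h2⟩, p, h1.2, rfl⟩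

theorem sum_stdFinset_succ (n : ℕ) (g : List Node → ℕ) :
    ∑ t ∈ stdFinset (n + 1), g t = ∑ t ∈ stdFinset n, ∑ p ∈ addables (shape t), g (p :: t) := by
  classical
  rw [stdFinset, Finset.sum_biUnion]
  · refine Finset.sum_congr rfl fun t _ => ?_
    rw [Finset.sum_image]
    intro a _ b _ h
    simpa using h
  · intro s _ t _ hst
    rw [Function.onFun, Finset.disjoint_left]
    intro u hu hu'
    obtain ⟨p, _, rfl⟩ := Finset.mem_image.1 hu
    obtain ⟨q, _, h⟩ := Finset.mem_image.1 hu'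
    exact hst (by simpa using (congrArg List.tail h).symm)

open Classical in
/-- The number of standard lists of given length and shape. -/
noncomputable def stdCount (n : ℕ) (m : Node → Bool) : ℕ :=
  ∑ t ∈ stdFinset n, if shape t = m then 1 else 0

theorem stdCount_zero_addNode (m : Node → Bool) (p : Node) : stdCount 0 (addNode m p) = 0 := by
  classical
  rw [stdCount, stdFinset, Finset.sum_singleton, if_neg]
  intro h
  apply not_removable_emptyShape p
  change emptyShape = _ at h
  rw [h]
  exact Addable.removable_addNode _ _

theorem IsMaya.stdCount_succ {m : Node → Bool} (h : IsMaya m) (n : ℕ) :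
    stdCount (n + 1) m = ∑ p ∈ removables m, stdCount n (removeNode m p) := by
  classical
  simp only [stdCount]
  rw [sum_stdFinset_succ, Finset.sum_comm]
  refine Finset.sum_congr rfl fun t _ => ?_
  rw [← Finset.sum_filter, ← Finset.sum_filter]
  refine Finset.sum_congr ?_ fun _ _ => rfl
  ext p
  rw [Finset.mem_filter, Finset.mem_filter, (isMaya_shape t).mem_addables, h.mem_removables]
  constructor
  · rintro ⟨h1, rfl⟩
    exact ⟨Addable.removable_addNode _ _, h1.removeNode_addNode.symm⟩
  · rintro ⟨h1, h2⟩
    rw [h2]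
    refine ⟨Removable.addable_removeNode _ _, ?_⟩
    change addNode (shape t) p = m
    rw [h2, h1.addNode_removeNode]

/-- The relation DU - UD = 2 of a differential poset. Adding `p` and removing `d` commute when they
differ; the terms with `p = d` return to `m`, once for each addable and each removable node. -/
theorem IsMaya.sum_addables_sum_removables {m : Node → Bool} (h : IsMaya m) (g : (Node → Bool) → ℕ) :
    ∑ p ∈ addables m, ∑ d ∈ removables (addNode m p), g (removeNode (addNode m p) d) =
      2 * g m + ∑ d ∈ removables m, ∑ p ∈ addables (removeNode m d), g (addNode (removeNode m d) p) := by
  classical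
  have e1 : ∀ p ∈ addables m,
      ∑ d ∈ removables (addNode m p), g (removeNode (addNode m p) d) =
        ∑ d ∈ (removables (addNode m p)).erase p, g (removeNode (addNode m p) d) + g m := by
    intro p hp
    rw [h.mem_addables] at hp
    rw [← Finset.sum_erase_add _ _ ((h.add p).mem_removables.2 (Addable.removable_addNode m p)),
      hp.removeNode_addNode]
  have e2 : ∀ d ∈ removables m,
      ∑ p ∈ addables (removeNode m d), g (addNode (removeNode m d) p) =
        ∑ p ∈ (addables (removeNode m d)).erase d, g (addNode (removeNode m d) p) + g m := by
    intro d hd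
    rw [h.mem_removables] at hd
    rw [← Finset.sum_erase_add _ _
      ((h.remove d).mem_addables.2 (Removable.addable_removeNode m d)), hd.addNode_removeNode]
  have key : ∀ p d, (p ∈ addables m ∧ d ∈ (removables (addNode m p)).erase p) ↔
      (p ∈ (addables (removeNode m d)).erase d ∧ d ∈ removables m) := by
    intro p d
    rw [Finset.mem_erase, Finset.mem_erase, h.mem_addables, h.mem_removables,
      (h.add p).mem_removables, (h.remove d).mem_addables]
    constructor
    · rintro ⟨h1, h2, h3⟩
      have hf : Far d p := h3.far (Addable.removable_addNode m p) h2
      exact ⟨⟨h2.symm, (hf.addable_removeNode m).2 h1⟩, (hf.symm.removable_addNode m).1 h3⟩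
    · rintro ⟨⟨h1, h2⟩, h3⟩
      have hf : Far p d := h2.far (Removable.addable_removeNode m d) h1
      exact ⟨(hf.symm.addable_removeNode m).1 h2, h1.symm, (hf.removable_addNode m).2 h3⟩
  rw [Finset.sum_congr rfl e1, Finset.sum_congr rfl e2, Finset.sum_add_distrib,
    Finset.sum_add_distrib, Finset.sum_comm' key, Finset.sum_const, Finset.sum_const,
    h.card_addables]
  have e3 : ∑ d ∈ removables m, ∑ p ∈ (addables (removeNode m d)).erase d,
      g (removeNode (addNode m p) d) = ∑ d ∈ removables m,
        ∑ p ∈ (addables (removeNode m d)).erase d, g (addNode (removeNode m d) p) := by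
    refine Finset.sum_congr rfl fun d hd => Finset.sum_congr rfl fun p hp => ?_
    rw [h.mem_removables] at hd
    rw [Finset.mem_erase, (h.remove d).mem_addables] at hp
    have hf : Far p d := hp.2.far (Removable.addable_removeNode m d) hp.1
    rw [hf.removeNode_addNode hd]
  rw [e3]
  simp only [smul_eq_mul]
  ring

/-- A count of standard lists is the sum of the counts after removing the last box. The commutation
relation then contributes 2 for each of the n + 1 boxes. -/
theorem IsMaya.sum_addables_stdCount {m : Node → Bool} (h : IsMaya m) (n : ℕ) :
    ∑ p ∈ addables m, stdCount (n + 1) (addNode m p) = 2 * (n + 1) * stdCount n m := by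
  induction n generalizing m with
  | zero =>
    rw [Finset.sum_congr rfl fun p _ => (h.add p).stdCount_succ 0,
      h.sum_addables_sum_removables (stdCount 0)]
    simp [stdCount_zero_addNode]
  | succ n ih =>
    rw [Finset.sum_congr rfl fun p _ => (h.add p).stdCount_succ (n + 1),
      h.sum_addables_sum_removables, Finset.sum_congr rfl fun d _ => ih (h.remove d),
      ← Finset.mul_sum, ← h.stdCount_succ]
    ring

/-- The left side counts pairs of standard lists of equal shape, that is, the sum of the squares of
the block sizes. -/
theorem sum_stdCount (n : ℕ) :
    ∑ t ∈ stdFinset n, stdCount n (shape t) = 2 ^ n * n.factorial := by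
  induction n with
  | zero => rw [stdFinset, Finset.sum_singleton, stdCount, stdFinset, Finset.sum_singleton]; simp
  | succ n ih =>
    have h : ∀ t ∈ stdFinset n, ∑ p ∈ addables (shape t), stdCount (n + 1) (shape (p :: t)) =
        2 * (n + 1) * stdCount n (shape t) :=
      fun t _ => (isMaya_shape t).sum_addables_stdCount n
    rw [sum_stdFinset_succ, Finset.sum_congr rfl h, ← Finset.mul_sum, ih, Nat.factorial_succ, pow_succ]
    ring

end Counting

/-! ### The seminormal representation by block matrices -/

section Blocks

/-- The standard lists of length `n`. -/
abbrev StdList (n : ℕ) : Type := {t : List Node // t ∈ stdFinset n}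

open Classical in
/-- The shapes of the standard lists of length `n`. -/
abbrev Shape (n : ℕ) : Type := {m : Node → Bool // m ∈ (stdFinset n).image shape}

/-- The standard lists of a given shape. -/
abbrev StdOfShape {n : ℕ} (m : Shape n) : Type := {t : StdList n // shape t.1 = m.1}

noncomputable instance {n : ℕ} (m : Shape n) : Fintype (StdOfShape m) := Fintype.ofFinite _

noncomputable instance {n : ℕ} (m : Shape n) : DecidableEq (StdOfShape m) := Classical.decEq _

noncomputable instance {n : ℕ} : DecidableEq (Shape n) := Classical.decEq _

/-- The product, over all shapes, of the matrix algebras indexed by the standard lists of this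
shape. -/
abbrev Blocks (K : Type*) (n : ℕ) : Type _ := (m : Shape n) → Matrix (StdOfShape m) (StdOfShape m) K

instance {n : ℕ} (m : Shape n) : Nonempty (StdOfShape m) := by
  classical
  obtain ⟨t, ht, h⟩ := Finset.mem_image.1 m.2
  exact ⟨⟨⟨t, ht⟩, h⟩⟩

variable {K : Type*} [CommRing K]

/-- The diagonal blocks of the matrix of an endomorphism with respect to the standard lists. -/
noncomputable def block (n : ℕ) : Module.End K (List Node →₀ K) →ₗ[K] Blocks K n where
  toFun f := fun _ => Matrix.of fun t t' => f (vec K t'.1.1) t.1.1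
  map_add' _ _ := rfl
  map_smul' _ _ := rfl

theorem block_apply (n : ℕ) (f : Module.End K (List Node →₀ K)) (m : Shape n)
    (t t' : StdOfShape m) : block n f m t t' = f (vec K t'.1.1) t.1.1 := rfl

theorem StdOfShape.isStd {n : ℕ} {m : Shape n} (t : StdOfShape m) : IsStd t.1.1 :=
  (mem_stdFinset.1 t.1.2).1

theorem StdOfShape.length_eq {n : ℕ} {m : Shape n} (t : StdOfShape m) : t.1.1.length = n :=
  (mem_stdFinset.1 t.1.2).2

theorem StdOfShape.mem_stdLists {n : ℕ} {m : Shape n} (t : StdOfShape m) :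
    t.1.1 ∈ stdLists n m.1 := ⟨t.isStd, t.length_eq, t.2⟩

theorem block_congr {n : ℕ} {f g : Module.End K (List Node →₀ K)} (h : EqOnStd n f g) :
    block n f = block n g := by
  funext m
  ext t t'
  rw [block_apply, block_apply, h _ t'.isStd t'.length_eq]

theorem block_one (n : ℕ) : block n (1 : Module.End K (List Node →₀ K)) = 1 := by
  funext m
  ext t t'
  rw [block_apply, Module.End.one_apply, Pi.one_apply, Matrix.one_apply]
  by_cases h : t = t'
  · subst h; simp
  · rw [if_neg h, Finsupp.single_apply, if_neg]
    intro h'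
    exact h (Subtype.ext (Subtype.ext h'.symm))

theorem apply_eq_sum_of_mem_supported {n : ℕ} (f : Module.End K (List Node →₀ K)) (m : Shape n)
    {v : List Node →₀ K} (hv : v ∈ Finsupp.supported K K (stdLists n m.1)) :
    f v = ∑ t : StdOfShape m, v t.1.1 • f (vec K t.1.1) := by
  rw [Finsupp.supported_eq_span_single] at hv
  induction hv using Submodule.span_induction with
  | mem v hv =>
    obtain ⟨t, ht, rfl⟩ := hv
    obtain ⟨h1, h2, h3⟩ := ht
    rw [Finset.sum_eq_single (⟨⟨t, mem_stdFinset.2 ⟨h1, h2⟩⟩, h3⟩ : StdOfShape m)]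
    · simp
    · intro s _ hs
      rw [Finsupp.single_apply, if_neg, zero_smul]
      rintro rfl
      exact hs rfl
    · simp
  | zero => simp
  | add a b _ _ ha hb => simp [ha, hb, add_smul, Finset.sum_add_distrib]
  | smul c a _ ha => simp [ha, Finset.smul_sum, smul_smul]

/-- Cutting out blocks is multiplicative only because the right factor does not leave the span of
the standard lists of one shape. -/
theorem block_mul {n : ℕ} (f : Module.End K (List Node →₀ K)) {g : Module.End K (List Node →₀ K)}
    (hg : PreservesStd n g) : block n (f * g) = block n f * block n g := by
  funext m
  ext t t'
  rw [Pi.mul_apply, Matrix.mul_apply, block_apply, Module.End.mul_apply,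
    apply_eq_sum_of_mem_supported f m (hg m.1 _ (vec_mem_supported t'.mem_stdLists)),
    Finsupp.finsetSum_apply]
  refine Finset.sum_congr rfl fun s _ => ?_
  rw [block_apply, block_apply, Finsupp.smul_apply, smul_eq_mul, mul_comm]

theorem preservesStd_mul {n : ℕ} {f g : Module.End K (List Node →₀ K)} (hf : PreservesStd n f)
    (hg : PreservesStd n g) : PreservesStd n (f * g) := fun m v hv => hf m _ (hg m v hv)

theorem heckeRelations_block {x : Kˣ} {n : ℕ} (hx : QUnits x n) :
    HeckeRelations (x : K) n fun i => block n (seminormal x n i) where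
  sq_zero h := by
    rw [← block_mul _ (preservesStd_seminormal x n _), block_congr (seminormal_sq_zero x h),
      map_smul]
  sq_succ i h := by
    rw [← block_mul _ (preservesStd_seminormal x n _), block_congr (seminormal_sq_succ hx i h),
      map_add, map_smul, map_smul, block_one]
  braid_zero h := by
    simp only [← block_mul _ (preservesStd_seminormal x n _)]
    exact block_congr (seminormal_braid_zero x h)
  braid_succ i h := by
    simp only [← block_mul _ (preservesStd_seminormal x n _)]
    exact block_congr (seminormal_braid_succ hx i h)
  comm i j h h' := by
    simp only [← block_mul _ (preservesStd_seminormal x n _)]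
    exact block_congr (seminormal_comm x i j h h')
  vanish i h := by rw [seminormal_eq_zero x h, map_zero]

theorem block_mem_adjoin {x : Kˣ} {n : ℕ} {f : Module.End K (List Node →₀ K)}
    (hf : f ∈ seminormalAlgebra x n) :
    PreservesStd n f ∧
      block n f ∈ Algebra.adjoin K (Set.range fun i => block n (seminormal x n i)) := by
  induction hf using Algebra.adjoin_induction with
  | mem f hf =>
    obtain ⟨i, rfl⟩ := hf
    exact ⟨preservesStd_seminormal x n i, Algebra.subset_adjoin ⟨i, rfl⟩⟩
  | algebraMap r =>
    constructor
    · intro m v hv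
      rw [Module.algebraMap_end_apply]
      exact Submodule.smul_mem _ _ hv
    · rw [Algebra.algebraMap_eq_smul_one, map_smul, block_one]
      exact Subalgebra.smul_mem _ (one_mem _) _
  | add a b _ _ ha hb =>
    constructor
    · intro m v hv
      exact add_mem (ha.1 m v hv) (hb.1 m v hv)
    · rw [map_add]
      exact add_mem ha.2 hb.2
  | mul a b _ _ ha hb =>
    refine ⟨preservesStd_mul ha.1 hb.1, ?_⟩
    rw [block_mul a hb.1]
    exact mul_mem ha.2 hb.2

theorem adjoin_block_eq_top {x : Kˣ} {n : ℕ} (hx : QUnits x n) (hy : IsUnit (1 + (x : K))) :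
    Algebra.adjoin K (Set.range fun i => block n (seminormal x n i)) = ⊤ := by
  classical
  rw [eq_top_iff]
  intro M _
  have hM : M = ∑ m, ∑ t, ∑ t', M m t t' • Pi.single m (Matrix.single t t' (1 : K)) := by
    funext m
    rw [Finset.sum_apply, Finset.sum_eq_single m]
    · conv_lhs => rw [Matrix.matrix_eq_sum_single (M m)]
      simp [Finset.sum_apply]
    · intro m' _ h
      simp [Finset.sum_apply, Pi.single_eq_of_ne h.symm]
    · simp
  rw [hM]
  refine sum_mem fun m _ => sum_mem fun t _ => sum_mem fun t' _ => Subalgebra.smul_mem _ ?_ _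
  obtain ⟨f, hf, hf'⟩ := hasMatrixUnit hx hy t.isStd t.length_eq t'.isStd t'.length_eq
    (t.2.trans t'.2.symm)
  have : Pi.single m (Matrix.single t t' (1 : K)) = block n f := by
    funext m'
    ext s s'
    rw [block_apply, hf' _ s'.isStd s'.length_eq]
    by_cases h : m' = m
    · subst h
      rw [Pi.single_eq_same, Matrix.single_apply]
      by_cases h1 : t' = s'
      · subst h1
        rw [if_pos rfl, Finsupp.single_apply]
        by_cases h2 : t = s
        · subst h2; simp
        · rw [if_neg (by simp [h2]), if_neg]
          intro h3
          exact h2 (Subtype.ext (Subtype.ext h3))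
      · rw [if_neg (by simp [h1]), if_neg]
        · simp
        · intro h3
          exact h1 (Subtype.ext (Subtype.ext h3.symm))
    · rw [Pi.single_eq_of_ne h, if_neg]
      · simp
      · intro h3
        apply h
        apply Subtype.ext
        rw [← s'.2, ← t'.2, h3]
  rw [this]
  exact (block_mem_adjoin hf).2

theorem finrank_blocks [Nontrivial K] (n : ℕ) :
    Module.finrank K (Blocks K n) = 2 ^ n * n.factorial := by
  classical
  rw [Module.finrank_pi_fintype, ← sum_stdCount n]
  have h : ∀ m : Shape n, Fintype.card (StdOfShape m) = stdCount n m.1 := by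
    intro m
    rw [Fintype.card_subtype, stdCount, ← Finset.sum_coe_sort (stdFinset n), Finset.card_filter]
  have h2 : ∀ m : Shape n, Module.finrank K (Matrix (StdOfShape m) (StdOfShape m) K) =
      ∑ t : StdOfShape m, stdCount n m.1 := by
    intro m
    rw [Module.finrank_matrix, Module.finrank_self, mul_one, Finset.sum_const, Finset.card_univ, h,
      smul_eq_mul]
  rw [Finset.sum_congr rfl fun m _ => h2 m, ← Finset.sum_coe_sort (stdFinset n),
    ← Finset.sum_fiberwise_of_maps_to (t := Finset.univ) (g := fun t : StdList n =>
      (⟨shape t.1, Finset.mem_image_of_mem _ t.2⟩ : Shape n)) (by simp)]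
  refine Finset.sum_congr rfl fun m _ => ?_
  rw [Finset.sum_const, Finset.card_univ, Fintype.card_subtype,
    Finset.sum_congr rfl (g := fun _ => stdCount n m.1), Finset.sum_const]
  · congr 2
    ext t
    simp [Subtype.ext_iff]
  · intro t ht
    simp only [Finset.mem_filter, Finset.mem_univ, true_and] at ht
    rw [← ht]

end Blocks

/-! ### The Hecke algebra is free, and split where the quantum factorial is invertible -/

section Splitting

theorem HeckeRelations.restrictScalars {Λ K B : Type*} [CommRing Λ] [CommRing K] [Algebra Λ K]
    [Ring B] [Algebra K B] [Algebra Λ B] [IsScalarTower Λ K B] {x : Λ} {n : ℕ} {T : ℕ → B}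
    (h : HeckeRelations (algebraMap Λ K x) n T) : HeckeRelations x n T where
  sq_zero h1 := by
    rw [h.sq_zero h1, ← algebraMap_smul K (1 + x)]; simp
  sq_succ i h1 := by
    rw [h.sq_succ i h1, ← algebraMap_smul K (x - 1), ← algebraMap_smul K x]; simp
  braid_zero := h.braid_zero
  braid_succ := h.braid_succ
  comm := h.comm
  vanish := h.vanish

theorem injective_of_surjective_of_finrank_eq {K M N : Type*} [CommRing K] [Nontrivial K]
    [AddCommGroup M] [AddCommGroup N] [Module K M] [Module K N] [Module.Free K M]
    [Module.Finite K M] [Module.Free K N] [Module.Finite K N]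
    (h : Module.finrank K M = Module.finrank K N) (f : M →ₗ[K] N) (hf : Function.Surjective f) :
    Function.Injective f := by
  have e : N ≃ₗ[K] M := LinearEquiv.ofFinrankEq _ _ h.symm
  have h1 : Function.Injective (e.toLinearMap ∘ₗ f) :=
    OrzechProperty.injective_of_surjective_endomorphism _ (e.surjective.comp hf)
  exact fun a b hab => h1 (by simp [hab])

variable {Λ : Type*} [CommRing Λ]

/-- The maps K^(2^n n!) → K ⊗ H → blocks are both surjective and the outer modules are free of the
same rank. The composite is therefore bijective, hence so are both maps. -/
theorem exists_spanning_and_blocks (x : Λˣ) (n : ℕ) (K : Type*) [CommRing K] [Nontrivial K]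
    [Algebra Λ K] (hx : QUnits (Units.map (algebraMap Λ K : Λ →* K) x) n)
    (hy : IsUnit (1 + algebraMap Λ K x)) :
    (∃ m : Fin (2 ^ n * n.factorial) → HeckeB (x : Λ) n, Submodule.span Λ (Set.range m) = ⊤ ∧
      LinearIndependent K fun i => (1 : K) ⊗ₜ[Λ] m i) ∧
    Nonempty (K ⊗[Λ] HeckeB (x : Λ) n ≃ₐ[K] Blocks K n) := by
  have hrel : HeckeRelations (x : Λ) n fun i =>
      block n (seminormal (Units.map (algebraMap Λ K : Λ →* K) x) n i) :=
    HeckeRelations.restrictScalars (K := K) (heckeRelations_block hx)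
  obtain ⟨φ, hφ⟩ := hrel.exists_algHom
  obtain ⟨m, hm⟩ := (HeckeB.relations (x : Λ) n).exists_span_eq_top (HeckeB.adjoin_range_gen _ n)
  have hcomm : ∀ (r : K) (a : HeckeB (x : Λ) n), Commute (Algebra.ofId K (Blocks K n) r) (φ a) :=
    fun r a => Algebra.commutes r (φ a)
  let Φ : K ⊗[Λ] HeckeB (x : Λ) n →ₐ[K] Blocks K n :=
    Algebra.TensorProduct.lift (Algebra.ofId K _) φ hcomm
  have hΦ : Function.Surjective Φ := by
    rw [← AlgHom.range_eq_top, eq_top_iff, ← adjoin_block_eq_top hx (by simpa using hy)]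
    refine Algebra.adjoin_le ?_
    rintro _ ⟨i, rfl⟩
    exact ⟨1 ⊗ₜ HeckeB.gen _ n i, by
      change Algebra.TensorProduct.lift _ _ _ _ = _
      rw [Algebra.TensorProduct.lift_tmul, map_one, one_mul, hφ]⟩
  let g : (Fin (2 ^ n * n.factorial) → K) →ₗ[K] K ⊗[Λ] HeckeB (x : Λ) n :=
    Fintype.linearCombination K fun i => (1 : K) ⊗ₜ[Λ] m i
  have hg : Function.Surjective g := by
    rw [← LinearMap.range_eq_top, Fintype.range_linearCombination, eq_top_iff]
    rintro v -
    induction v using TensorProduct.induction_on with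
    | zero => exact zero_mem _
    | add a b ha hb => exact add_mem ha hb
    | tmul k a =>
      have ha : a ∈ Submodule.span Λ (Set.range m) := by rw [hm]; trivial
      induction ha using Submodule.span_induction with
      | mem a ha =>
        obtain ⟨i, rfl⟩ := ha
        rw [show k ⊗ₜ[Λ] m i = k • ((1 : K) ⊗ₜ[Λ] m i) by simp [TensorProduct.smul_tmul']]
        exact Submodule.smul_mem _ _ (Submodule.subset_span ⟨i, rfl⟩)
      | zero => rw [TensorProduct.tmul_zero]; exact zero_mem _
      | add a b _ _ ha hb => rw [TensorProduct.tmul_add]; exact add_mem ha hb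
      | smul c a _ ha =>
        rw [TensorProduct.tmul_smul, ← algebraMap_smul K c]
        exact Submodule.smul_mem _ _ ha
  have hinj : Function.Injective (Φ.toLinearMap ∘ₗ g) :=
    injective_of_surjective_of_finrank_eq (by rw [finrank_blocks]; simp) _ (hΦ.comp hg)
  have hginj : Function.Injective g := fun a b h => hinj (by simp [h])
  refine ⟨⟨m, hm, ?_⟩, ⟨AlgEquiv.ofBijective Φ ⟨?_, hΦ⟩⟩⟩
  · rw [Fintype.linearIndependent_iff]
    intro c hc i
    have : c = 0 := hginj (by rw [map_zero, ← hc]; rfl)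
    rw [this, Pi.zero_apply]
  · intro a b hab
    obtain ⟨a, rfl⟩ := hg a
    obtain ⟨b, rfl⟩ := hg b
    rw [hinj (by exact hab : (Φ.toLinearMap ∘ₗ g) a = (Φ.toLinearMap ∘ₗ g) b)]

/-- The spanning family is already defined over Λ; a linear relation over Λ becomes one over K,
where its coefficients vanish. -/
theorem nonempty_basis_heckeB (x : Λˣ) (n : ℕ) (K : Type*) [CommRing K] [Nontrivial K]
    [Algebra Λ K] (hx : QUnits (Units.map (algebraMap Λ K : Λ →* K) x) n)
    (hy : IsUnit (1 + algebraMap Λ K x)) (hinj : Function.Injective (algebraMap Λ K)) :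
    Nonempty (Module.Basis (Fin (2 ^ n * n.factorial)) Λ (HeckeB (x : Λ) n)) := by
  obtain ⟨⟨m, hm, hli⟩, -⟩ := exists_spanning_and_blocks x n K hx hy
  refine ⟨Module.Basis.mk (v := m) ?_ hm.ge⟩
  rw [Fintype.linearIndependent_iff] at hli ⊢
  intro c hc i
  apply hinj
  rw [map_zero]
  refine hli (fun i => algebraMap Λ K (c i)) ?_ i
  have : ∑ i, algebraMap Λ K (c i) • ((1 : K) ⊗ₜ[Λ] m i) = (1 : K) ⊗ₜ[Λ] ∑ i, c i • m i := by
    rw [TensorProduct.tmul_sum]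
    refine Finset.sum_congr rfl fun i _ => ?_
    rw [TensorProduct.tmul_smul, algebraMap_smul]
  rw [this, hc, TensorProduct.tmul_zero]

end Splitting

/-! ### Split algebras -/

section SplitAlgebra

theorem isSplitAlgebra_of_algEquiv_pi {R A : Type*} [CommRing R] [Ring A] [Algebra R A]
    {ι : Type*} [Finite ι] {F : ι → Type*} [∀ i, Fintype (F i)] [∀ i, DecidableEq (F i)]
    [∀ i, Nonempty (F i)] (e : A ≃ₐ[R] ((i : ι) → Matrix (F i) (F i) R)) : IsSplitAlgebra R A := by
  obtain ⟨r, ⟨ε⟩⟩ := Finite.exists_equiv_fin ι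
  refine ⟨r, fun i => Fintype.card (F (ε.symm i)), fun i => Fintype.card_pos, ⟨e.trans ?_⟩⟩
  refine (AlgEquiv.piCongrLeft' R _ ε).trans (AlgEquiv.piCongrRight fun i => ?_)
  exact Matrix.reindexAlgEquiv R R (Fintype.equivFin _)

theorem IsSplitAlgebra.of_algEquiv {R A B : Type*} [CommRing R] [Ring A] [Algebra R A] [Ring B]
    [Algebra R B] (h : IsSplitAlgebra R B) (e : A ≃ₐ[R] B) : IsSplitAlgebra R A := by
  obtain ⟨r, d, hd, ⟨f⟩⟩ := h
  exact ⟨r, d, hd, ⟨e.trans f⟩⟩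

theorem IsSeparableAlgebra.of_algEquiv {R A B : Type*} [CommRing R] [Ring A] [Algebra R A] [Ring B]
    [Algebra R B] (h : IsSeparableAlgebra R B) (e : A ≃ₐ[R] B) : IsSeparableAlgebra R A := by
  obtain ⟨u, hu, hu'⟩ := h
  let f := Algebra.TensorProduct.map e.symm.toAlgHom e.symm.toAlgHom
  refine ⟨f u, fun a => ?_, ?_⟩
  · have := congrArg f (hu (e a))
    simpa [f] using this
  · have h1 : ∀ w : B ⊗[R] B, LinearMap.mul' R A (f w) = e.symm (LinearMap.mul' R B w) := by
      intro w
      induction w using TensorProduct.induction_on with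
      | zero => simp
      | add a b ha hb => simp [ha, hb]
      | tmul a b => simp [f]
    rw [h1, hu', map_one]

/-- The separability idempotent is the sum of e_{so} ⊗ e_{os} over all blocks and indices s, with
one fixed index o in each block. -/
theorem isSeparableAlgebra_pi_matrix (R : Type*) [CommRing R] {ι : Type*} [Fintype ι]
    [DecidableEq ι] (F : ι → Type*) [∀ i, Fintype (F i)] [∀ i, DecidableEq (F i)]
    [∀ i, Nonempty (F i)] : IsSeparableAlgebra R ((i : ι) → Matrix (F i) (F i) R) := by
  let o : ∀ i, F i := fun i => Classical.arbitrary _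
  let E : ∀ i, F i → F i → ((i : ι) → Matrix (F i) (F i) R) :=
    fun i s t => Pi.single i (Matrix.single s t 1)
  have hE : ∀ i s t v, E i s t * E i t v = E i s v := by
    intro i s t v
    simp [E, ← Pi.single_mul]
  have hE' : ∀ i s t u v, t ≠ u → E i s t * E i u v = 0 := by
    intro i s t u v h
    simp only [E, ← Pi.single_mul]
    rw [Matrix.single_mul_single_of_ne _ _ _ _ h, Pi.single_zero]
  have hE'' : ∀ i s t j u v, i ≠ j → E i s t * E j u v = 0 := by
    intro i s t j u v h
    funext k
    simp only [E, Pi.mul_apply, Pi.zero_apply]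
    rcases eq_or_ne k i with rfl | hk
    · rw [Pi.single_eq_of_ne h, mul_zero]
    · rw [Pi.single_eq_of_ne hk, zero_mul]
  have hspan : ∀ a : (i : ι) → Matrix (F i) (F i) R, a = ∑ i, ∑ s, ∑ t, a i s t • E i s t := by
    intro a
    funext m
    rw [Finset.sum_apply, Finset.sum_eq_single m]
    · conv_lhs => rw [Matrix.matrix_eq_sum_single (a m)]
      simp [Finset.sum_apply, E]
    · intro m' _ h
      simp [Finset.sum_apply, E, Pi.single_eq_of_ne h.symm]
    · simp
  have key : ∀ j u v, (E j u v ⊗ₜ[R] 1) * ∑ i, ∑ s, E i s (o i) ⊗ₜ[R] E i (o i) s =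
      (∑ i, ∑ s, E i s (o i) ⊗ₜ[R] E i (o i) s) * (1 ⊗ₜ[R] E j u v) := by
    intro j u v
    simp only [Finset.mul_sum, Finset.sum_mul, Algebra.TensorProduct.tmul_mul_tmul, one_mul,
      mul_one]
    rw [Finset.sum_eq_single j _ (by simp), Finset.sum_eq_single v _ (by simp),
      Finset.sum_eq_single j _ (by simp), Finset.sum_eq_single u _ (by simp), hE, hE]
    · intro s _ hs
      rw [hE' _ _ _ _ _ hs, TensorProduct.tmul_zero]
    · intro i _ hi
      exact Finset.sum_eq_zero fun s _ => by rw [hE'' _ _ _ _ _ _ hi, TensorProduct.tmul_zero]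
    · intro s _ hs
      rw [hE' _ _ _ _ _ hs.symm, TensorProduct.zero_tmul]
    · intro i _ hi
      exact Finset.sum_eq_zero fun s _ => by rw [hE'' _ _ _ _ _ _ hi.symm, TensorProduct.zero_tmul]
  refine ⟨∑ i, ∑ s, E i s (o i) ⊗ₜ[R] E i (o i) s, fun a => ?_, ?_⟩
  · rw [hspan a]
    generalize ∑ i, ∑ s, E i s (o i) ⊗ₜ[R] E i (o i) s = e at key
    simp only [TensorProduct.sum_tmul, TensorProduct.tmul_sum, Finset.sum_mul, Finset.mul_sum,
      ← TensorProduct.smul_tmul', TensorProduct.tmul_smul, smul_mul_assoc, mul_smul_comm, key]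
  · simp only [map_sum, LinearMap.mul'_apply, hE]
    rw [hspan 1]
    refine Finset.sum_congr rfl fun i _ => Finset.sum_congr rfl fun s _ => ?_
    rw [Finset.sum_eq_single s]
    · simp
    · intro t _ ht
      simp [Matrix.one_apply_ne ht.symm]
    · simp

theorem IsSplitAlgebra.isSeparableAlgebra {R A : Type*} [CommRing R] [Ring A] [Algebra R A]
    (h : IsSplitAlgebra R A) : IsSeparableAlgebra R A := by
  obtain ⟨r, d, hd, ⟨e⟩⟩ := h
  have : ∀ i, Nonempty (Fin (d i)) := fun i => ⟨⟨0, hd i⟩⟩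
  exact (isSeparableAlgebra_pi_matrix R fun i => Fin (d i)).of_algEquiv e

end SplitAlgebra

/-! ### Reflections in the Weyl group of type `B_n` -/

section WeylGroup

variable {n : ℕ}

/-- The change of the sign of the coordinate `j`. -/
def signChange (j : Fin n) : WeylB n :=
  SemidirectProduct.inl (Pi.mulSingle j (Multiplicative.ofAdd 1))

/-- A permutation of the coordinates. -/
def permElt (σ : Equiv.Perm (Fin n)) : WeylB n := SemidirectProduct.inr σ

theorem permElt_mul (σ τ : Equiv.Perm (Fin n)) : permElt (σ * τ) = permElt σ * permElt τ :=
  map_mul SemidirectProduct.inr σ τ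

theorem permElt_mul_signChange (σ : Equiv.Perm (Fin n)) (j : Fin n) :
    permElt σ * signChange j = signChange (σ j) * permElt σ := by
  refine SemidirectProduct.ext ?_ ?_
  · funext i
    simp only [permElt, signChange, SemidirectProduct.mul_left, SemidirectProduct.left_inr,
      SemidirectProduct.right_inr, SemidirectProduct.left_inl, SemidirectProduct.right_inl,
      one_mul, map_one, mul_one, mulAutArrow_apply_apply, Pi.mulSingle_apply]
    change (Pi.mulSingle j (Multiplicative.ofAdd (1 : ZMod 2)) : Fin n → _) (σ⁻¹ • i) = _
    simp only [Pi.mulSingle_apply, Equiv.Perm.smul_def, Equiv.Perm.inv_eq_iff_eq]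
  · simp [permElt, signChange]

theorem signChange_mul_self (j : Fin n) : signChange j * signChange j = 1 := by
  rw [signChange, ← map_mul, ← Pi.mulSingle_mul]
  have : (Multiplicative.ofAdd (1 : ZMod 2)) * Multiplicative.ofAdd 1 = 1 := by decide
  rw [this]
  simp

theorem signChange_comm (i j : Fin n) :
    signChange i * signChange j = signChange j * signChange i := by
  rw [signChange, signChange, ← map_mul, ← map_mul, mul_comm]

theorem permElt_swap_mul_self (i j : Fin n) :
    permElt (Equiv.swap i j) * permElt (Equiv.swap i j) = 1 := by
  rw [← permElt_mul, Equiv.swap_mul_self]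
  exact map_one _

theorem signChange_mul_permElt_braid (i j : Fin n) :
    signChange i * permElt (Equiv.swap i j) * signChange i * permElt (Equiv.swap i j) =
      permElt (Equiv.swap i j) * signChange i * permElt (Equiv.swap i j) * signChange i := by
  rw [mul_assoc (signChange i), permElt_mul_signChange, Equiv.swap_apply_left, ← mul_assoc,
    mul_assoc (_ * _), permElt_swap_mul_self, mul_assoc (signChange j), permElt_swap_mul_self,
    mul_one, mul_one, signChange_comm]

theorem submonoid_eq_top_of_reflections (M : Submonoid (WeylB (n + 1)))
    (h0 : signChange 0 ∈ M) (h : ∀ i : Fin n, permElt (Equiv.swap i.castSucc i.succ) ∈ M) :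
    M = ⊤ := by
  have hperm : ∀ σ, permElt σ ∈ M := by
    intro σ
    have : (⊤ : Submonoid (Equiv.Perm (Fin (n + 1)))) ≤ M.comap SemidirectProduct.inr := by
      rw [← Equiv.Perm.mclosure_swap_castSucc_succ, Submonoid.closure_le]
      rintro _ ⟨i, rfl⟩
      exact h i
    exact this (Submonoid.mem_top σ)
  have hsign : ∀ j, signChange j ∈ M := by
    intro j
    have h1 := permElt_mul_signChange (Equiv.swap 0 j) 0
    rw [Equiv.swap_apply_left] at h1
    have h2 : signChange j = permElt (Equiv.swap 0 j) * signChange 0 * permElt (Equiv.swap 0 j) := by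
      rw [h1, mul_assoc, permElt_swap_mul_self, mul_one]
    rw [h2]
    exact mul_mem (mul_mem (hperm _) h0) (hperm _)
  have hinl : ∀ a, SemidirectProduct.inl a ∈ M := by
    intro a
    have h1 : a ∈ M.comap (SemidirectProduct.inl : _ →* WeylB (n + 1)) := by
      rw [← Finset.univ_prod_mulSingle a]
      refine Submonoid.prod_mem _ fun j _ => ?_
      have h2 : ∀ z : Multiplicative (ZMod 2), z = 1 ∨ z = Multiplicative.ofAdd 1 := by decide
      rcases h2 (a j) with h3 | h3
      · rw [h3, Pi.mulSingle_one]
        exact one_mem _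
      · rw [h3]
        exact hsign j
    exact h1
  rw [eq_top_iff]
  intro g _
  rw [← SemidirectProduct.inl_left_mul_inr_right g]
  exact mul_mem (hinl _) (hperm _)

theorem card_weylB (n : ℕ) : Nat.card (WeylB n) = 2 ^ n * n.factorial := by
  rw [Nat.card_congr SemidirectProduct.equivProd, Nat.card_prod, Nat.card_eq_fintype_card,
    Nat.card_eq_fintype_card, Fintype.card_perm, Fintype.card_pi]
  simp [ZMod.card]

open Classical in
/-- The images of the generators of the Hecke algebra in the group ring. -/
noncomputable def groupRingGen (n : ℕ) : ℕ → MonoidAlgebra ℤ (WeylB n)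
  -- The element 1 - s_0 satisfies T² = 2T, the special quadratic relation at x = 1.
  | 0 => if h : 0 < n then 1 - MonoidAlgebra.of ℤ _ (signChange ⟨0, h⟩) else 0
  | i + 1 => if h : i + 1 < n then
      MonoidAlgebra.of ℤ _ (permElt (Equiv.swap ⟨i, by omega⟩ ⟨i + 1, h⟩)) else 0

theorem heckeRelations_groupRingGen (n : ℕ) : HeckeRelations (1 : ℤ) n (groupRingGen n) where
  sq_zero h := by
    simp only [groupRingGen, h, dif_pos]
    have := congrArg (MonoidAlgebra.of ℤ _) (signChange_mul_self (⟨0, h⟩ : Fin n))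
    rw [map_mul, map_one] at this
    rw [mul_sub, sub_mul, sub_mul, this]
    simp only [mul_one, one_mul]
    rw [show (1 + 1 : ℤ) = 2 from rfl, two_smul]
    abel
  sq_succ i h := by
    simp only [groupRingGen, h, dif_pos]
    rw [← map_mul, permElt_swap_mul_self, map_one]
    simp
  braid_zero h := by
    have h0 : 0 < n := by omega
    simp only [groupRingGen, h, h0, zero_add, dif_pos]
    have h1 := congrArg (MonoidAlgebra.of ℤ _)
      (signChange_mul_permElt_braid (⟨0, h0⟩ : Fin n) ⟨1, h⟩)
    have h2 := congrArg (MonoidAlgebra.of ℤ _)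
      (permElt_swap_mul_self (⟨0, h0⟩ : Fin n) ⟨1, h⟩)
    simp only [map_mul, map_one] at h1 h2
    generalize MonoidAlgebra.of ℤ (WeylB n) (signChange ⟨0, h0⟩) = s at *
    generalize MonoidAlgebra.of ℤ (WeylB n) (permElt (Equiv.swap ⟨0, h0⟩ ⟨1, h⟩)) = t at *
    simp only [sub_mul, mul_sub, one_mul, mul_one, h1, h2]
    rw [show s * t * t = s by rw [mul_assoc, h2, mul_one]]
    abel
  braid_succ i h := by
    have h1 : i + 1 < n := by omega
    have h2 : i + 1 + 1 < n := h
    simp only [groupRingGen, h1, h2, dif_pos]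
    rw [← map_mul, ← map_mul, ← map_mul, ← map_mul, ← permElt_mul, ← permElt_mul, ← permElt_mul,
      ← permElt_mul]
    congr 2
    have e1 := Equiv.swap_mul_swap_mul_swap (x := (⟨i + 1 + 1, h2⟩ : Fin n))
      (y := ⟨i + 1, h1⟩) (z := ⟨i, by omega⟩) (by simp) (by simp [Fin.ext_iff]; omega)
    have e2 := Equiv.swap_mul_swap_mul_swap (x := (⟨i, by omega⟩ : Fin n))
      (y := ⟨i + 1, h1⟩) (z := ⟨i + 1 + 1, h2⟩) (by simp) (by simp [Fin.ext_iff]; omega)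
    generalize (⟨i, _⟩ : Fin n) = a at *
    generalize (⟨i + 1, _⟩ : Fin n) = b at *
    generalize (⟨i + 1 + 1, _⟩ : Fin n) = c at *
    rw [e2, Equiv.swap_comm c a, ← e1, Equiv.swap_comm a b, Equiv.swap_comm b c]
  comm i j h h' := by
    obtain ⟨j, rfl⟩ : ∃ j', j = j' + 1 := ⟨j - 1, by omega⟩
    rcases i with _ | i
    · have h0 : 0 < n := by omega
      simp only [groupRingGen, h0, h', dif_pos]
      rw [sub_mul, mul_sub, one_mul, mul_one, ← map_mul, ← map_mul, permElt_mul_signChange,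
        Equiv.swap_apply_of_ne_of_ne]
      · simp [Fin.ext_iff]; omega
      · simp [Fin.ext_iff]
    · have h1 : i + 1 < n := by omega
      simp only [groupRingGen, h1, h', dif_pos]
      rw [← map_mul, ← map_mul, ← permElt_mul, ← permElt_mul, Equiv.mul_swap_eq_swap_mul,
        Equiv.swap_apply_of_ne_of_ne, Equiv.swap_apply_of_ne_of_ne]
      all_goals simp [Fin.ext_iff]; try omega
  vanish i h := by
    rcases i with _ | i
    · simp only [groupRingGen]
      rw [dif_neg (by omega)]
    · simp only [groupRingGen]
      rw [dif_neg (by omega)]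

theorem subring_eq_top_of_groupRingGen_mem (n : ℕ) (R : Subring (MonoidAlgebra ℤ (WeylB n)))
    (hR : ∀ i, groupRingGen n i ∈ R) : R = ⊤ := by
  have key : ∀ g, MonoidAlgebra.of ℤ (WeylB n) g ∈ R := by
    have : R.toSubmonoid.comap (MonoidAlgebra.of ℤ (WeylB n)) = ⊤ := by
      rcases n with _ | n
      · rw [eq_top_iff]
        intro g _
        have : g = 1 := SemidirectProduct.ext (Subsingleton.elim _ _) (Subsingleton.elim _ _)
        rw [this]
        exact one_mem _
      · refine submonoid_eq_top_of_reflections _ ?_ fun i => ?_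
        · have h := hR 0
          simp only [groupRingGen, Nat.succ_pos, dif_pos] at h
          have h2 := R.sub_mem R.one_mem h
          rw [sub_sub_cancel] at h2
          exact h2
        · have h := hR (i + 1)
          simp only [groupRingGen, Nat.add_lt_add_iff_right, i.2, dif_pos] at h
          exact h
    intro g
    have h : g ∈ R.toSubmonoid.comap (MonoidAlgebra.of ℤ (WeylB n)) := by rw [this]; trivial
    exact h
  rw [eq_top_iff]
  intro a _
  induction a using MonoidAlgebra.induction_on with
  | of g => exact key g
  | add a b ha hb => exact add_mem (ha trivial) (hb trivial)
  | smul r a ha => exact zsmul_mem (ha trivial) r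

end WeylGroup

/-! ### Deformations of the group ring -/

section Deformation

/-- An algebra which is free of rank `#G`, with a surjective specialization to the integral group
ring, is a deformation of the group ring: an integral basis of the group ring can be lifted. -/
theorem nonempty_groupRingDeformation {R : Type*} [CommRing R] [Nontrivial R] (ε : R →+* ℤ)
    {G : Type*} [Group G] [Finite G] {A : Type*} [Ring A] [Algebra R A] {N : ℕ}
    (hN : Nat.card G = N) (m : Module.Basis (Fin N) R A) (red : A →+* MonoidAlgebra ℤ G)
    (hred : ∀ r a, red (r • a) = ε r • red a) (hsurj : Function.Surjective red) :
    Nonempty (GroupRingDeformation ε G A) := by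
  have := Fintype.ofFinite G
  have hG : Fintype.card G = N := by rw [← hN, Nat.card_eq_fintype_card]
  have fA : Module.Free R A := .of_basis m
  have fA' : Module.Finite R A := .of_basis m
  have fG : Module.Finite ℤ (MonoidAlgebra ℤ G) := .of_basis (MonoidAlgebra.basis G ℤ)
  have fG' : Module.Free ℤ (MonoidAlgebra ℤ G) := .of_basis (MonoidAlgebra.basis G ℤ)
  have hspan : Submodule.span ℤ (Set.range fun i => red (m i)) = ⊤ := by
    rw [eq_top_iff]
    rintro b -
    obtain ⟨a, rfl⟩ := hsurj b
    rw [← m.sum_repr a, map_sum]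
    refine sum_mem fun i _ => ?_
    rw [hred]
    exact Submodule.smul_mem _ _ (Submodule.subset_span ⟨i, rfl⟩)
  have hli : LinearIndependent ℤ fun i => red (m i) := by
    have h1 : Function.Injective (Fintype.linearCombination ℤ fun i => red (m i)) := by
      refine injective_of_surjective_of_finrank_eq ?_ _ ?_
      · rw [Module.finrank_eq_card_basis (MonoidAlgebra.basis G ℤ), hG]
        simp
      · rw [← LinearMap.range_eq_top, Fintype.range_linearCombination, hspan]
    rw [Fintype.linearIndependent_iff]
    intro c hc i
    have : c = 0 := h1 (by rw [map_zero, ← hc]; rfl)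
    rw [this, Pi.zero_apply]
  let bZ : Module.Basis (Fin N) ℤ (MonoidAlgebra ℤ G) := Module.Basis.mk hli hspan.ge
  -- The images of the basis form a ℤ-basis of the group ring. The additive section `ψ` sends them
  -- back, so the base change to the group elements, an integral matrix, is lifted with the same
  -- entries.
  let ψ : MonoidAlgebra ℤ G →ₗ[ℤ] A := bZ.constr ℤ m
  have hψm : ∀ i, ψ (red (m i)) = m i := by
    intro i
    have := bZ.constr_basis ℤ m i
    rwa [Module.Basis.mk_apply] at this
  have hψ : ∀ b, red (ψ b) = b := by
    have : (red.toAddMonoidHom.toIntLinearMap) ∘ₗ ψ = LinearMap.id := by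
      refine bZ.ext fun i => ?_
      simp [bZ, hψm]
    exact fun b => LinearMap.congr_fun this b
  let v : G → A := fun g => ψ (MonoidAlgebra.single g 1)
  have hv : ⊤ ≤ Submodule.span R (Set.range v) := by
    rw [← m.span_eq, Submodule.span_le]
    rintro _ ⟨i, rfl⟩
    rw [← hψm i, ← (MonoidAlgebra.basis G ℤ).sum_repr (red (m i)), map_sum]
    refine sum_mem fun g _ => ?_
    rw [map_zsmul, MonoidAlgebra.basis_apply]
    have h : ψ (MonoidAlgebra.single g 1) ∈ Submodule.span R (Set.range v) :=
      Submodule.subset_span ⟨g, rfl⟩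
    exact zsmul_mem h _
  have hv' : LinearIndependent R v := by
    have h1 : Function.Injective (Fintype.linearCombination R v) := by
      refine injective_of_surjective_of_finrank_eq ?_ _ ?_
      · rw [Module.finrank_eq_card_basis m]
        simp [hG]
      · rw [← LinearMap.range_eq_top, Fintype.range_linearCombination, eq_top_iff]
        exact hv
    rw [Fintype.linearIndependent_iff]
    intro c hc i
    have : c = 0 := h1 (by rw [map_zero, ← hc]; rfl)
    rw [this, Pi.zero_apply]
  refine ⟨⟨Module.Basis.mk hv' hv, red, fun r g => ?_⟩⟩
  rw [Module.Basis.mk_apply, hred, hψ]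
  simp

/-- The unit `q ^ 2` of `ℤ[q, q⁻¹]`. -/
noncomputable def qSq : Zqˣ where
  val := q ^ 2
  inv := LaurentPolynomial.T (-2)
  val_inv := by
    rw [q, LaurentPolynomial.T_pow, ← LaurentPolynomial.T_add]
    simp
  inv_val := by
    rw [q, LaurentPolynomial.T_pow, ← LaurentPolynomial.T_add]
    simp

theorem val_qSq : (qSq : Zq) = q ^ 2 := rfl

theorem evalOne_q : evalOne q = 1 := by
  rw [q, evalOne, LaurentPolynomial.eval₂_T]
  simp

theorem substOneAdd_q : substOneAdd q = 1 + PowerSeries.X := by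
  rw [q, substOneAdd, LaurentPolynomial.eval₂_T]
  simp

theorem zq_hom_ext {R : Type*} [CommRing R] {f g : Zq →+* R} (h : f q = g q) : f = g := by
  refine IsLocalization.ringHom_ext (Submonoid.powers (Polynomial.X : Polynomial ℤ)) ?_
  refine Polynomial.ringHom_ext (fun a => by simp) ?_
  have e : algebraMap (Polynomial ℤ) Zq Polynomial.X = q := Polynomial.toLaurent_X
  rw [RingHom.comp_apply, RingHom.comp_apply, e, h]

/-- The deformation of the integral group ring of the Weyl group over `ℤ[q, q⁻¹]`. -/
abbrev HeckeZq (n : ℕ) : Type := HeckeB (qSq : Zq) n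

theorem exists_reduction (n : ℕ) : ∃ red : HeckeZq n →+* MonoidAlgebra ℤ (WeylB n),
    (∀ r a, red (r • a) = evalOne r • red a) ∧ Function.Surjective red := by
  let _ : Algebra Zq ℤ := evalOne.toAlgebra
  have h1 : algebraMap Zq ℤ (qSq : Zq) = 1 := by
    change evalOne (q ^ 2) = 1
    rw [map_pow, evalOne_q, one_pow]
  have h2 : HeckeRelations (qSq : Zq) n (groupRingGen n) :=
    HeckeRelations.restrictScalars (K := ℤ) (by rw [h1]; exact heckeRelations_groupRingGen n)
  obtain ⟨f, hf⟩ := h2.exists_algHom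
  refine ⟨f.toRingHom, fun r a => ?_, ?_⟩
  · change f (r • a) = evalOne r • f a
    rw [map_smul, ← algebraMap_smul ℤ r]
    rfl
  · rw [← RingHom.range_eq_top]
    exact subring_eq_top_of_groupRingGen_mem n _ fun i => ⟨_, hf i⟩

/-- Extension of a reduction along a change of the ring of parameters. -/
theorem exists_reduction_baseChange {R : Type} [CommRing R] [Algebra Zq R] (ε : R →+* ℤ)
    (hε : ∀ r, ε (algebraMap Zq R r) = evalOne r) {B A : Type*} [Ring A] [Algebra Zq A] [Ring B]
    (red : A →+* B) (hred : ∀ r a, red (r • a) = evalOne r • red a)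
    (hsurj : Function.Surjective red) : ∃ red' : R ⊗[Zq] A →+* B,
    (∀ r a, red' (r • a) = ε r • red' a) ∧ Function.Surjective red' := by
  -- Both parameter rings act on `B` through ℤ, so the reduction becomes an algebra map and extends
  -- by the universal property of the tensor product.
  let _ : Algebra R B := ((Int.castRingHom B).comp ε).toAlgebra' fun r b =>
    Int.cast_commute (ε r) b
  let _ : Algebra Zq B := ((Int.castRingHom B).comp evalOne).toAlgebra' fun r b =>
    Int.cast_commute (evalOne r) b
  have hR : ∀ r, algebraMap R B r = (ε r : B) := fun r => rfl
  have hZ : ∀ r, algebraMap Zq B r = (evalOne r : B) := fun r => rfl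
  have : IsScalarTower Zq R B := IsScalarTower.of_algebraMap_eq fun r => by
    rw [hR, hZ, hε]
  let f : A →ₐ[Zq] B := { red with
    commutes' := fun r => by
      change red (algebraMap Zq A r) = _
      rw [Algebra.algebraMap_eq_smul_one, hred, map_one, hZ, zsmul_one] }
  have hf : ∀ a, f a = red a := fun a => rfl
  have hcomm : ∀ (r : R) (a : A), Commute (Algebra.ofId R B r) (f a) :=
    fun r a => Algebra.commutes r (f a)
  let F : R ⊗[Zq] A →ₐ[R] B := Algebra.TensorProduct.lift (Algebra.ofId R B) f hcomm
  refine ⟨F.toRingHom, fun r a => ?_, fun b => ?_⟩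
  · change F (r • a) = ε r • F a
    rw [map_smul, Algebra.smul_def, hR, zsmul_eq_mul]
  · obtain ⟨a, rfl⟩ := hsurj b
    refine ⟨1 ⊗ₜ a, ?_⟩
    change F (1 ⊗ₜ a) = red a
    rw [Algebra.TensorProduct.lift_tmul, map_one, one_mul, hf]

/-! ### Invertibility of quantum integers -/

theorem map_quantumFactorial {R R' : Type*} [CommRing R] [CommRing R'] (f : R →+* R') (x : R)
    (n : ℕ) : f (quantumFactorial x n) = quantumFactorial (f x) n := by
  simp [quantumFactorial, map_prod, map_sum]

theorem qUnits_of_isUnit_quantumFactorial {K : Type*} [CommRing K] (x : Kˣ) {N : ℕ}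
    (h : IsUnit (quantumFactorial (x : K) N)) : QUnits x N := by
  intro j h0 hj
  rcases eq_or_ne j 1 with rfl | h1
  · simp
  · rw [qInt_natCast]
    refine isUnit_of_dvd_unit ?_ h
    exact Finset.dvd_prod_of_mem (fun i => ∑ j ∈ Finset.range i, (x : K) ^ j)
      (Finset.mem_Icc.2 ⟨by omega, hj⟩)

theorem qUnits_qSq (n N : ℕ) (hN : 2 ≤ N) (hn : n ≤ N) (K : Type*) [CommRing K] [Nontrivial K]
    [Algebra Zq K] (h : IsUnit (algebraMap Zq K (quantumFactorial (q ^ 2) N))) :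
    QUnits (Units.map (algebraMap Zq K : Zq →* K) qSq) n ∧ IsUnit (1 + algebraMap Zq K qSq) := by
  rw [map_quantumFactorial] at h
  have h1 : QUnits (Units.map (algebraMap Zq K : Zq →* K) qSq) N :=
    qUnits_of_isUnit_quantumFactorial _ (by simpa [val_qSq] using h)
  refine ⟨h1.mono hn, ?_⟩
  -- The unit 1 + q² is the quantum integer 2, which is why N ≥ 2 is required.
  have h2 := h1 2 (by omega) hN
  rw [qInt_natCast] at h2
  simpa [Finset.sum_range_succ] using h2

/-- Each factor is a polynomial in X with leading coefficient 1, so the argument applies to ℤ/p as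
well as to ℤ. -/
theorem quantumFactorial_powerSeries_ne_zero {R : Type*} [CommRing R] [IsDomain R] (N : ℕ) :
    quantumFactorial ((1 + PowerSeries.X : PowerSeries R) ^ 2) N ≠ 0 := by
  rw [quantumFactorial, Finset.prod_ne_zero_iff]
  intro i hi h
  rw [Finset.mem_Icc] at hi
  obtain ⟨i, rfl⟩ : ∃ i', i = i' + 1 := ⟨i - 1, by omega⟩
  have h1 : ((∑ j ∈ Finset.range (i + 1), ((1 + Polynomial.X : Polynomial R) ^ 2) ^ j :
      Polynomial R) : PowerSeries R) = 0 := by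
    rw [← h, ← Polynomial.coeToPowerSeries.ringHom_apply]
    simp
  rw [Polynomial.coe_eq_zero_iff] at h1
  have h2 : (∑ j ∈ Finset.range (i + 1), ((1 + Polynomial.X : Polynomial R) ^ 2) ^ j).coeff
      (2 * i) = 1 := by
    rw [Polynomial.finsetSum_coeff, Finset.sum_range_succ, Finset.sum_eq_zero, zero_add, ← pow_mul,
      Polynomial.coeff_one_add_X_pow, Nat.choose_self, Nat.cast_one]
    intro j hj
    rw [Finset.mem_range] at hj
    rw [← pow_mul, Polynomial.coeff_one_add_X_pow, Nat.choose_eq_zero_of_lt (by omega),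
      Nat.cast_zero]
  rw [h1] at h2
  simp at h2

theorem substOneAdd_quantumFactorial (N : ℕ) : substOneAdd (quantumFactorial (q ^ 2) N) =
    quantumFactorial ((1 + PowerSeries.X : PowerSeries ℤ) ^ 2) N := by
  rw [map_quantumFactorial, map_pow, substOneAdd_q]

theorem quantumFactorial_q_ne_zero (N : ℕ) : quantumFactorial (q ^ 2) N ≠ 0 := by
  intro h
  apply quantumFactorial_powerSeries_ne_zero (R := ℤ) N
  rw [← substOneAdd_quantumFactorial, h, map_zero]

theorem nontrivial_localization_powers {R : Type*} [CommRing R] [IsDomain R] {r : R} (hr : r ≠ 0) :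
    Nontrivial (Localization (Submonoid.powers r)) :=
  (IsLocalization.injective (Localization (Submonoid.powers r))
    (powers_le_nonZeroDivisors_of_noZeroDivisors hr)).nontrivial

/-- Power series over ℤ/p form a domain in which the quantum factorial is nonzero, so no power of it
is divisible by p. -/
theorem disjoint_powers_span_natCast {p : ℕ} (hp : p.Prime) (N : ℕ) :
    Disjoint (Submonoid.powers (quantumFactorial ((1 + PowerSeries.X : PowerSeries ℤ) ^ 2) N) :
      Set (PowerSeries ℤ)) (Ideal.span {(p : PowerSeries ℤ)} : Set (PowerSeries ℤ)) := by
  have : Fact p.Prime := ⟨hp⟩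
  rw [Set.disjoint_left]
  rintro _ ⟨k, rfl⟩ h
  rw [SetLike.mem_coe, Ideal.mem_span_singleton] at h
  have h1 := map_dvd (PowerSeries.map (Int.castRingHom (ZMod p))) h
  simp only [map_natCast] at h1
  rw [← map_natCast (PowerSeries.C (R := ZMod p)), ZMod.natCast_self, map_zero, zero_dvd_iff,
    map_pow, map_quantumFactorial] at h1
  refine quantumFactorial_powerSeries_ne_zero (R := ZMod p) N ?_
  simpa using eq_zero_of_pow_eq_zero h1

end Deformation

/-! ### The split global solution -/

section GlobalSolution

/-- Transitivity of the extension of scalars, for a noncommutative algebra. -/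
noncomputable def baseChangeTransEquiv (R S A C : Type*) [CommRing R] [CommRing S] [CommRing A]
    [Ring C] [Algebra R S] [Algebra S A] [Algebra R A] [IsScalarTower R S A] [Algebra R C] :
    A ⊗[S] (S ⊗[R] C) ≃ₐ[A] A ⊗[R] C :=
  AlgEquiv.symm <| AlgEquiv.ofLinearEquiv
    (TensorProduct.AlgebraTensorModule.cancelBaseChange R S A A C).symm
    (by simp [Algebra.TensorProduct.one_def]) <|
      LinearMap.map_mul_of_map_mul_tmul (fun _ _ _ _ => by simp)

theorem isSplitAlgebra_tensor_heckeZq (n N : ℕ) (hN : 2 ≤ N) (hn : n ≤ N) (K : Type*) [CommRing K]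
    [Nontrivial K] [Algebra Zq K] (h : IsUnit (algebraMap Zq K (quantumFactorial (q ^ 2) N))) :
    IsSplitAlgebra K (K ⊗[Zq] HeckeZq n) := by
  obtain ⟨h1, h2⟩ := qUnits_qSq n N hN hn K h
  obtain ⟨-, ⟨e⟩⟩ := exists_spanning_and_blocks qSq n K h1 h2
  exact isSplitAlgebra_of_algEquiv_pi e

theorem nonempty_basis_heckeZq (n : ℕ) :
    Nonempty (Module.Basis (Fin (2 ^ n * n.factorial)) Zq (HeckeZq n)) := by
  -- The maximum with 2 makes 1 + q² invertible for n ≤ 1 too; the basis itself is over ℤ[q, q⁻¹].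
  have h0 := quantumFactorial_q_ne_zero (max n 2)
  have := nontrivial_localization_powers h0
  have hu : IsUnit (algebraMap Zq (Zqn (max n 2)) (quantumFactorial (q ^ 2) (max n 2))) :=
    IsLocalization.Away.algebraMap_isUnit _
  obtain ⟨h1, h2⟩ := qUnits_qSq n (max n 2) (le_max_right _ _) (le_max_left _ _)
    (Zqn (max n 2)) hu
  exact nonempty_basis_heckeB qSq n (Zqn (max n 2)) h1 h2
    (IsLocalization.injective _ (powers_le_nonZeroDivisors_of_noZeroDivisors h0))

instance finite_weylB (n : ℕ) : Finite (WeylB n) :=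
  Finite.of_equiv _ SemidirectProduct.equivProd.symm

theorem nonempty_deformation_heckeZq (n : ℕ) :
    Nonempty (GroupRingDeformation evalOne (WeylB n) (HeckeZq n)) := by
  obtain ⟨m⟩ := nonempty_basis_heckeZq n
  obtain ⟨red, h1, h2⟩ := exists_reduction n
  exact nonempty_groupRingDeformation evalOne (card_weylB n) m red h1 h2

theorem constantCoeff_substOneAdd (r : Zq) :
    PowerSeries.constantCoeff (R := ℤ) (substOneAdd r) = evalOne r := by
  have h : (PowerSeries.constantCoeff (R := ℤ)).comp substOneAdd = evalOne := zq_hom_ext (by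
    rw [RingHom.comp_apply, substOneAdd_q, evalOne_q]
    simp)
  exact RingHom.congr_fun h r

theorem isSplitGlobalSolution_heckeZq (n N : ℕ) (hN : 2 ≤ N) (hn : n ≤ N) :
    IsSplitGlobalSolution (WeylB n) (PowerSeries ℤ ⊗[Zq] HeckeZq n)
      (Submonoid.powers (quantumFactorial ((1 + PowerSeries.X : PowerSeries ℤ) ^ 2) N)) := by
  have h0 := quantumFactorial_powerSeries_ne_zero (R := ℤ) N
  set S := Submonoid.powers (quantumFactorial ((1 + PowerSeries.X : PowerSeries ℤ) ^ 2) N) with hS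
  have : Nontrivial (Localization S) := nontrivial_localization_powers h0
  have hu : IsUnit (algebraMap Zq (Localization S) (quantumFactorial (q ^ 2) N)) := by
    rw [IsScalarTower.algebraMap_apply Zq (PowerSeries ℤ) (Localization S)]
    change IsUnit (algebraMap _ _ (substOneAdd _))
    rw [substOneAdd_quantumFactorial]
    exact IsLocalization.map_units (Localization S) (⟨_, Submonoid.mem_powers _⟩ : S)
  have hsplit : IsSplitAlgebra (Localization S)
      (Localization S ⊗[PowerSeries ℤ] (PowerSeries ℤ ⊗[Zq] HeckeZq n)) :=
    (isSplitAlgebra_tensor_heckeZq n N hN hn (Localization S) hu).of_algEquiv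
      (baseChangeTransEquiv Zq (PowerSeries ℤ) (Localization S) (HeckeZq n))
  refine ⟨⟨?_, fun p hp _ => disjoint_powers_span_natCast hp N, hsplit.isSeparableAlgebra⟩, hsplit⟩
  obtain ⟨m⟩ := nonempty_basis_heckeZq n
  obtain ⟨red, h1, h2⟩ := exists_reduction n
  obtain ⟨red', h3, h4⟩ := exists_reduction_baseChange (PowerSeries.constantCoeff (R := ℤ))
    constantCoeff_substOneAdd red h1 h2
  exact nonempty_groupRingDeformation _ (card_weylB n) (m.baseChange (PowerSeries ℤ)) red' h3 h4

end GlobalSolution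

/-! ### Rationality of the irreducible representations -/

section Rationality

/-- The matrix units of a direct sum of matrix algebras. -/
def piMatrixUnit (R : Type*) [CommRing R] {ι : Type*} [DecidableEq ι] (d : ι → ℕ) (i : ι)
    (s t : Fin (d i)) : (i : ι) → Matrix (Fin (d i)) (Fin (d i)) R :=
  Pi.single i (Matrix.single s t 1)

theorem piMatrixUnit_apply_self {R ι : Type*} [CommRing R] [DecidableEq ι] (d : ι → ℕ) (i : ι)
    (s t : Fin (d i)) : piMatrixUnit R d i s t i = Matrix.single s t 1 := Pi.single_eq_same _ _

theorem mul_piMatrixUnit {R ι : Type*} [CommRing R] [DecidableEq ι] {d : ι → ℕ}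
    (a : (i : ι) → Matrix (Fin (d i)) (Fin (d i)) R) (i : ι) (s t : Fin (d i)) :
    a * piMatrixUnit R d i s t = ∑ s', a i s' s • piMatrixUnit R d i s' t := by
  funext j
  rw [Finset.sum_apply, Pi.mul_apply]
  rcases eq_or_ne j i with rfl | hj
  · simp only [Pi.smul_apply, piMatrixUnit_apply_self]
    ext u v
    rw [Matrix.sum_apply]
    rcases eq_or_ne v t with rfl | hv
    · simp [Matrix.single_apply]
    · simp [hv.symm, Matrix.mul_apply]
  · simp [piMatrixUnit, Pi.single_eq_of_ne hj]

theorem sum_piMatrixUnit {R ι : Type*} [CommRing R] [Fintype ι] [DecidableEq ι] (d : ι → ℕ) :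
    ∑ i, ∑ s, piMatrixUnit R d i s s = 1 := by
  funext j
  rw [Finset.sum_apply, Finset.sum_eq_single j _ (by simp)]
  · simp [Finset.sum_apply, piMatrixUnit_apply_self, Matrix.sum_single_one]
  · intro i _ hi
    simp [Finset.sum_apply, piMatrixUnit, Pi.single_eq_of_ne hi.symm]

universe v in
/-- If the rational group algebra is a direct sum of matrix algebras, then the complex irreducible
representations are rational. -/
theorem complexIrreduciblesRational_of_isSplitAlgebra (G : Type*) [Group G]
    (h : IsSplitAlgebra ℚ (MonoidAlgebra ℚ G)) : ComplexIrreduciblesRational.{v} G := by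
  obtain ⟨r, d, -, ⟨e⟩⟩ := h
  intro V _ _ ρ hρ
  let _ : Module ℚ V := Module.compHom V (algebraMap ℚ ℂ)
  have : IsScalarTower ℚ ℂ V := ⟨fun a b v => by
    change (a • b) • v = algebraMap ℚ ℂ a • (b • v)
    rw [Algebra.smul_def, mul_smul]⟩
  let φ : ((i : Fin r) → Matrix (Fin (d i)) (Fin (d i)) ℚ) →ₐ[ℚ] Module.End ℂ V :=
    (MonoidAlgebra.lift ℚ (Module.End ℂ V) G ρ).comp e.symm.toAlgHom
  have hφ : ∀ g, φ (e (MonoidAlgebra.of ℚ G g)) = ρ g := by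
    intro g
    simp [φ]
  let U : ∀ i, Fin (d i) → Fin (d i) → Module.End ℂ V :=
    fun i s t => φ (piMatrixUnit ℚ d i s t)
  have hU : ∀ a i s t w, φ a (U i s t w) = ∑ s', (a i s' s : ℂ) • U i s' t w := by
    intro a i s t w
    rw [← Module.End.mul_apply, ← map_mul, mul_piMatrixUnit, map_sum, LinearMap.sum_apply]
    refine Finset.sum_congr rfl fun s' _ => ?_
    rw [map_smul, LinearMap.smul_apply]
    rfl
  have hUU : ∀ i t s s' w, U i t s (U i s' t w) = if s = s' then U i t t w else 0 := by
    intro i t s s' w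
    change φ _ _ = _
    rw [hU]
    rw [piMatrixUnit_apply_self, Finset.sum_eq_single t]
    · by_cases h : s = s' <;> simp [h]
    · intro u _ hu
      simp [hu.symm]
    · simp
  have hone : ∀ w, w = ∑ i, ∑ s, U i s s w := by
    intro w
    have h1 := congrArg (fun a => φ a w) (sum_piMatrixUnit (R := ℚ) d).symm
    simpa [map_sum, LinearMap.sum_apply] using h1
  obtain ⟨w₀, hw₀⟩ : ∃ w : V, w ≠ 0 := by
    by_contra! hV
    obtain ⟨a, b, hab⟩ := hρ.exists_pair_ne
    refine hab (SetLike.ext fun x => ?_)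
    rw [hV x]
    exact ⟨fun _ => b.toSubmodule.zero_mem, fun _ => a.toSubmodule.zero_mem⟩
  obtain ⟨i, t, hw⟩ : ∃ i t, U i t t w₀ ≠ 0 := by
    by_contra! h0
    exact hw₀ ((hone w₀).trans (Finset.sum_eq_zero fun i _ => Finset.sum_eq_zero fun s _ => h0 i s))
  -- With t fixed, these vectors span a copy of the column module of the i-th block. The group acts
  -- on it through the rational entries of that block, and irreducibility makes it all of `V`.
  let v : Fin (d i) → V := fun s => U i s t w₀
  have hact : ∀ g s, ρ g (v s) = ∑ s', (e (MonoidAlgebra.of ℚ G g) i s' s : ℂ) • v s' := by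
    intro g s
    rw [← hφ]
    exact hU _ _ _ _ _
  have hli : LinearIndependent ℂ v := by
    rw [Fintype.linearIndependent_iff]
    intro c hc s
    have h1 := congrArg (U i t s) hc
    simp only [map_sum, map_smul, v, hUU, map_zero, smul_ite, smul_zero, Finset.sum_ite_eq,
      Finset.mem_univ, if_true] at h1
    exact (smul_eq_zero.1 h1).resolve_right hw
  let W : Subrepresentation ρ :=
    { toSubmodule := Submodule.span ℂ (Set.range v)
      apply_mem_toSubmodule := by
        intro g x hx
        induction hx using Submodule.span_induction with
        | mem x hx =>
          obtain ⟨s, rfl⟩ := hx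
          rw [hact]
          exact sum_mem fun s' _ => Submodule.smul_mem _ _ (Submodule.subset_span ⟨s', rfl⟩)
        | zero => rw [map_zero]; exact zero_mem _
        | add a b _ _ ha hb => rw [map_add]; exact add_mem ha hb
        | smul c a _ ha => rw [map_smul]; exact Submodule.smul_mem _ _ ha }
  have hspan : ⊤ ≤ Submodule.span ℂ (Set.range v) := by
    rcases hρ.eq_bot_or_eq_top W with h1 | h1
    · exfalso
      have h2 : v t ∈ W.toSubmodule := Submodule.subset_span ⟨t, rfl⟩
      rw [h1] at h2
      exact hw ((Submodule.mem_bot ℂ).1 h2)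
    · exact (congrArg Subrepresentation.toSubmodule h1).ge
  refine ⟨d i, Module.Basis.mk hli hspan, (Pi.evalMonoidHom (fun i => Matrix (Fin (d i)) (Fin (d i)) ℚ) i).comp
    ((e : MonoidAlgebra ℚ G →* _).comp (MonoidAlgebra.of ℚ G)), fun g => ?_⟩
  ext s' s
  rw [LinearMap.toMatrix_apply, Module.Basis.mk_apply, hact]
  have hb : ∀ s, (Module.Basis.mk hli hspan).repr (v s) = Finsupp.single s 1 := by
    intro s
    rw [← Module.Basis.mk_apply hli hspan s, Module.Basis.repr_self]
  simp [hb, Finsupp.single_apply]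

theorem HeckeRelations.map {R S A B : Type*} [CommRing R] [CommRing S] [Ring A] [Ring B]
    [Algebra R A] [Algebra S B] {x : R} {n : ℕ} {T : ℕ → A} (h : HeckeRelations x n T)
    (ε : R →+* S) (f : A →+* B) (hf : ∀ r a, f (r • a) = ε r • f a) :
    HeckeRelations (ε x) n fun i => f (T i) where
  sq_zero h1 := by simp only [← map_mul, h.sq_zero h1, hf, map_add, map_one]
  sq_succ i h1 := by
    simp only [← map_mul, h.sq_succ i h1, hf, map_add, map_sub, map_one]
  braid_zero h1 := by simp only [← map_mul, h.braid_zero h1]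
  braid_succ i h1 := by simp only [← map_mul, h.braid_succ i h1]
  comm i j h1 h2 := by simp only [← map_mul, h.comm i j h1 h2]
  vanish i h1 := by simp only [h.vanish i h1, map_zero]

/-- The rational group algebra of the Weyl group is a direct sum of matrix algebras. -/
theorem isSplitAlgebra_monoidAlgebra_weylB (n : ℕ) :
    IsSplitAlgebra ℚ (MonoidAlgebra ℚ (WeylB n)) := by
  have hx : QUnits (Units.map (algebraMap ℚ ℚ : ℚ →* ℚ) 1) n := by
    intro j h0 hj
    rw [map_one, qInt_natCast]
    simp [h0.ne']
  obtain ⟨-, ⟨e⟩⟩ := exists_spanning_and_blocks (1 : ℚˣ) n ℚ hx (by norm_num)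
  let e' : HeckeB ((1 : ℚˣ) : ℚ) n ≃ₐ[ℚ] Blocks ℚ n := (Algebra.TensorProduct.lid ℚ _).symm.trans e
  let f : MonoidAlgebra ℤ (WeylB n) →+* MonoidAlgebra ℚ (WeylB n) :=
    MonoidAlgebra.mapRingHom _ (Int.castRingHom ℚ)
  have hrel : HeckeRelations ((1 : ℚˣ) : ℚ) n fun i => f (groupRingGen n i) := by
    have := (heckeRelations_groupRingGen n).map (Int.castRingHom ℚ) f fun r a => by
      rw [map_zsmul]
      exact (Int.cast_smul_eq_zsmul ℚ r _).symm
    rwa [map_one] at this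
  obtain ⟨φ, hφ⟩ := hrel.exists_algHom
  have hφ' : Function.Surjective φ := by
    rw [← AlgHom.coe_toLinearMap, ← LinearMap.range_eq_top, eq_top_iff,
      ← (MonoidAlgebra.basis (WeylB n) ℚ).span_eq, Submodule.span_le]
    rintro _ ⟨g, rfl⟩
    have h : φ.toRingHom.range.comap f = ⊤ :=
      subring_eq_top_of_groupRingGen_mem n _ fun i => ⟨_, hφ i⟩
    have h' : MonoidAlgebra.single g 1 ∈ φ.toRingHom.range.comap f := by rw [h]; trivial
    obtain ⟨a, ha⟩ := h'
    refine ⟨a, ?_⟩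
    rw [MonoidAlgebra.basis_apply]
    exact ha.trans (by simp [f])
  have := Fintype.ofFinite (WeylB n)
  have : Module.Finite ℚ (MonoidAlgebra ℚ (WeylB n)) :=
    .of_basis (MonoidAlgebra.basis (WeylB n) ℚ)
  have : Module.Finite ℚ (HeckeB ((1 : ℚˣ) : ℚ) n) := Module.Finite.equiv e'.symm.toLinearEquiv
  -- The Hecke algebra at x = 1 and the group algebra both have dimension 2^n n! over ℚ.
  have hinj : Function.Injective φ := by
    refine injective_of_surjective_of_finrank_eq ?_ φ.toLinearMap hφ'
    rw [e'.toLinearEquiv.finrank_eq, finrank_blocks,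
      Module.finrank_eq_card_basis (MonoidAlgebra.basis (WeylB n) ℚ), ← Nat.card_eq_fintype_card,
      card_weylB]
  exact isSplitAlgebra_of_algEquiv_pi ((AlgEquiv.ofBijective φ ⟨hinj, hφ'⟩).symm.trans e')

end Rationality

end DonaldFlanigan

theorem theorem8 (n : ℕ) :
    -- there is a split global solution, starting from the integers
    (∃ (A : Type) (_ : Ring A) (_ : Algebra (PowerSeries ℤ) A) (S : Submonoid (PowerSeries ℤ)),
      IsSplitGlobalSolution (WeylB n) A S) ∧
    -- the coefficient ring after deformation can be taken to be `ℤ[q, q⁻¹, 1 / n_{q²}!]`: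
    -- the solution can be defined over `ℤ[q, q⁻¹]`, where `q = 1 + t`, and splits over this ring
    (2 ≤ n → ∃ (A : Type) (_ : Ring A) (_ : Algebra Zq A),
      Nonempty (GroupRingDeformation evalOne (WeylB n) A) ∧
      IsSplitAlgebra (Zqn n) (Zqn n ⊗[Zq] A) ∧
      IsSplitGlobalSolution (WeylB n) (PowerSeries ℤ ⊗[Zq] A)
        (Submonoid.powers (quantumFactorial ((1 + PowerSeries.X : PowerSeries ℤ) ^ 2) n))) ∧
    -- all complex irreducible representations are rational
    ComplexIrreduciblesRational.{u} (WeylB n) := by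
  -- The first clause includes n ≤ 1, where the empty factorial would not invert 1 + q²; hence `max
  -- n 2`.
  refine ⟨⟨_, inferInstance, inferInstance, _,
    isSplitGlobalSolution_heckeZq n (max n 2) (le_max_right _ _) (le_max_left _ _)⟩,
    fun hn => ⟨HeckeZq n, inferInstance, inferInstance, nonempty_deformation_heckeZq n, ?_,
      isSplitGlobalSolution_heckeZq n n hn le_rfl⟩,
    complexIrreduciblesRational_of_isSplitAlgebra _ (isSplitAlgebra_monoidAlgebra_weylB n)⟩
  have := nontrivial_localization_powers (quantumFactorial_q_ne_zero n)
  exact isSplitAlgebra_tensor_heckeZq n n hn le_rfl (Zqn n)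
    (IsLocalization.Away.algebraMap_isUnit _)
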